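/- **Setting.** Let $m,T\ge 1$ and $n\ge 0$ be integers, let $f,F:\mathbb R^m\times\mathbb R^n\to\mathbb R$, and let $\mathcal S(x)=\operatorname{argmin}_{y\in\mathbb R^n}f(x,y)$. A function is called $L$-smooth if it is differentiable with $L$-Lipschitz gradient. Assume: * $f$ is $L_f$-smooth and twice differentiable, and $\|\nabla\nabla_y f(x_1,y_1)-\nabla\nabla_y f(x_2,y_2)\|\le H_f(\|x_1-x_2\|+\|y_1-y_2\|)$ for all $x_i,y_i$ (operator norm); * $\mathcal S(x)$ is nonempty, closed and convex for every $x$; * there is $\tau>0$ with $\operatorname{dist}(y,\mathcal S(x))\le\tau\|\nabla_yf(x,y)\|$ for all $x,y$; * $F$ is $M_F$-Lipschitz and $L_F$-smooth. Let $\varphi_o(x)=\inf_{y\in\mathcal S(x)}F(x,y)$ and $\varphi_p(x)=\sup_{y\in\mathcal S(x)}F(x,y)$, and assume in the optimistic case that $\varphi_o(x^\star)>-\infty$ for some $x^\star$, in the pessimistic case that $\varphi_p(x^\star)<+\infty$ for some $x^\star$. Put $M_\varphi=M_F(1+L_f\tau)$, $L_{\mathcal S}=\max\{2H_f\tau(1+9L_f^2\tau^2),\,4L_f^2\tau^2\}$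 and $\rho=M_FL_{\mathcal S}+L_F(1+L_{\mathcal S})$. For Lipschitz $g:\mathbb R^m\to\mathbb R$, the Clarke subdifferential $\partial g(x)$ is the convex hull of all limits $\lim_k\nabla g(x_k)$ with $x_k\to x$ and $g$ differentiable at each $x_k$; $\mathbb B(x,\delta)$ is the closed ball; $g_\gamma(x)=\inf_z\{g(z)+\frac1{2\gamma}\|x-z\|^2\}$ is the Moreau envelope. **Algorithm.** Let $\varphi\in\{\varphi_o,\varphi_p\}$ and let $A:\mathbb R^m\to\mathbb R$ be a (deterministic, measurable) function with $|A(x)-\varphi(x)|\le w$ for all $x$. From $x_0\in\mathbb R^m$ the inexact zeroth-order method computes, for $t=0,\dots,T-1$, $$x_{t+1}=x_t-\eta\,\frac{m}{2\varepsilon}\bigl(A(x_t+\varepsilon u_t)-A(x_t-\varepsilon u_t)\bigr)u_t ,$$ where $u_0,\dots,u_{T-1}$ are independent and uniformly distributed on the unit sphere of $\mathbb R^m$, and returns $\bar x=x_R$, where $R$ is uniform on $\{0,\dots,T-1\}$ and independent of $(u_t)$. **Parameters.** For fixed constants $c_\eta>0$ and $C_\eta,C_\varepsilon,C_w,C_r$,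 let $c_\eta (mT)^{-1/2}\le\eta\le C_\eta (mT)^{-1/2}$, $0<\varepsilon\le C_\varepsilon T^{-1/2}$, $0<w\le C_wm^{-3/4}T^{-3/4}$ and $w/\varepsilon\le C_rm^{-3/4}T^{-1/4}$. (The last condition follows from the bound on $w$, with another constant, if $\varepsilon$ is of exact order $T^{-1/2}$.) **Theorem.** (i) *Optimistic case.* There are constants $K,C$ depending only on $L_f,H_f,\tau,M_F,L_F,c_\eta,C_\eta,C_\varepsilon,C_w,C_r$ (not on $m,n,T,f,F,A,x_0$) such that, if $\varphi_o$ is bounded below, then, with $\Delta_o=\varphi_o(x_0)-\inf\varphi_o+2M_\varphi\varepsilon$, there is $\delta$ with $0\le\delta\le KT^{-1/4}$, chosen independently of $A$, $x_0$ and the run, such that $$\mathbb E\Bigl[\operatorname{dist}\Bigl(0,\bigcup_{z\in\mathbb B(\bar x,\delta)}\partial\varphi_o(z)\Bigr)^2\Bigr]\le C\,\frac{\sqrt m\,(\Delta_o+1)}{\sqrt T}.$$ (ii) *Pessimistic case.* For every $\gamma\in(0,\frac1{\rho+1})$ there is a constant $C$ depending only on $\gamma$ and the constants listed in (i) such that the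 Moreau envelope $\varphi_{p,\gamma}$ of $\varphi_p$ is differentiable and, if it is bounded below, then, with $\Delta_p=\varphi_{p,\gamma}(x_0)-\inf\varphi_{p,\gamma}$, $$\mathbb E\bigl[\|\nabla\varphi_{p,\gamma}(\bar x)\|^2\bigr]\le C\,\frac{\sqrt m\,(\Delta_p+1)}{\sqrt T}.$$ -/

import Mathlib

open MeasureTheory ProbabilityTheory Filter Topology
open scoped NNReal ENNReal Gradient

noncomputable section

namespace Bilevel

/-- Euclidean space `ℝ^k`. -/
abbrev Vec (k : ℕ) := EuclideanSpace ℝ (Fin k)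

/-- `ℝ^m × ℝ^n` with the Euclidean norm of the joint variable `(x, y)`. -/
abbrev Joint (m n : ℕ) := WithLp 2 (Vec m × Vec n)

/-- The pair `(x, y)` as a joint variable. -/
abbrev pair {m n : ℕ} (x : Vec m) (y : Vec n) : Joint m n := WithLp.toLp 2 (x, y)

/-- A function is `L`-smooth: differentiable with `L`-Lipschitz gradient. -/
structure IsSmooth {E : Type*} [NormedAddCommGroup E] [InnerProductSpace ℝ E] [CompleteSpace E]
    (L : ℝ≥0) (g : E → ℝ) : Prop where
  differentiable : Differentiable ℝ g
  lipschitz_gradient : LipschitzWith L (∇ g)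

/-- The partial gradient `∇_y f` at `p = (x, y)`. -/
def gradY {m n : ℕ} (f : Joint m n → ℝ) (p : Joint m n) : Vec n :=
  ∇ (fun y : Vec n => f (pair p.fst y)) p.snd

/-- The lower-level solution set `S(x) = argmin_y f(x, y)`. -/
def solSet {m n : ℕ} (f : Joint m n → ℝ) (x : Vec m) : Set (Vec n) :=
  {y | ∀ y' : Vec n, f (pair x y) ≤ f (pair x y')}

/-- The values of the upper-level function on the lower-level solutions at `x`. -/
def upperValues {m n : ℕ} (f F : Joint m n → ℝ) (x : Vec m) : Set ℝ :=
  (fun y => F (pair x y)) '' solSet f x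

/-- The optimistic hyper-objective. -/
def phiO {m n : ℕ} (f F : Joint m n → ℝ) (x : Vec m) : ℝ := sInf (upperValues f F x)

/-- The pessimistic hyper-objective. -/
def phiP {m n : ℕ} (f F : Joint m n → ℝ) (x : Vec m) : ℝ := sSup (upperValues f F x)

/-- Assumptions on the lower-level function: smoothness, Lipschitz continuity of `∇∇_y f`
(in operator norm), nonempty closed convex solution sets, and the uniform error bound. -/
structure LowerLevel {m n : ℕ} (Lf Hf : ℝ≥0) (τ : ℝ) (f : Joint m n → ℝ) : Prop where
  smooth : IsSmooth Lf f
  twice_differentiable : Differentiable ℝ (∇ f)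
  lipschitz_hessian : ∀ p q : Joint m n,
    ‖fderiv ℝ (gradY f) p - fderiv ℝ (gradY f) q‖
      ≤ Hf * (‖p.fst - q.fst‖ + ‖p.snd - q.snd‖)
  sol_nonempty : ∀ x, (solSet f x).Nonempty
  sol_closed : ∀ x, IsClosed (solSet f x)
  sol_convex : ∀ x, Convex ℝ (solSet f x)
  tau_pos : 0 < τ
  error_bound : ∀ (x : Vec m) (y : Vec n),
    Metric.infDist y (solSet f x) ≤ τ * ‖gradY f (pair x y)‖

/-- Assumptions on the upper-level function. -/
structure UpperLevel {m n : ℕ} (MF LF : ℝ≥0) (F : Joint m n → ℝ) : Prop where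
  lipschitz : LipschitzWith MF F
  smooth : IsSmooth LF F

/-- The Lipschitz modulus `M_F (1 + L_f τ)` of the hyper-objectives. -/
def Mphi (Lf MF : ℝ≥0) (τ : ℝ) : ℝ := MF * (1 + Lf * τ)

/-- The set-smoothness modulus of the solution map. -/
def LS (Lf Hf : ℝ≥0) (τ : ℝ) : ℝ :=
  max (2 * Hf * τ * (1 + 9 * (Lf : ℝ) ^ 2 * τ ^ 2)) (4 * (Lf : ℝ) ^ 2 * τ ^ 2)

/-- The weak convexity/concavity modulus of the hyper-objectives. -/
def rho (Lf Hf MF LF : ℝ≥0) (τ : ℝ) : ℝ := MF * LS Lf Hf τ + LF * (1 + LS Lf Hf τ)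

/-- The Clarke subdifferential: convex hull of all limits of gradients at nearby points of
differentiability. -/
def clarke {m : ℕ} (g : Vec m → ℝ) (x : Vec m) : Set (Vec m) :=
  convexHull ℝ {s | ∃ z : ℕ → Vec m, Tendsto z atTop (𝓝 x) ∧
    (∀ k, DifferentiableAt ℝ g (z k)) ∧ Tendsto (fun k => ∇ g (z k)) atTop (𝓝 s)}

/-- The union of the Clarke subdifferentials over the closed ball of radius `δ` around `x`. -/
def clarkeBall {m : ℕ} (g : Vec m → ℝ) (δ : ℝ) (x : Vec m) : Set (Vec m) :=
  ⋃ z ∈ Metric.closedBall x δ, clarke g z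

/-- The Moreau envelope `g_γ`. -/
def moreau {m : ℕ} (γ : ℝ) (g : Vec m → ℝ) (x : Vec m) : ℝ :=
  ⨅ z : Vec m, (g z + 1 / (2 * γ) * ‖x - z‖ ^ 2)

/-- The uniform distribution on the unit sphere, as a measure on `ℝ^m`: the push-forward of
the normalized surface measure. -/
def sphereUniform (m : ℕ) : Measure (Vec m) :=
  ((((volume : Measure (Vec m)).toSphere Set.univ)⁻¹ •
    (volume : Measure (Vec m)).toSphere)).map Subtype.val

/-- The inexact two-point gradient estimator at `x` in direction `u`, where `A` returns the
(approximate) function values. -/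
def estimator {m : ℕ} (A : Vec m → ℝ) (ε : ℝ) (x u : Vec m) : Vec m :=
  ((m : ℝ) / (2 * ε) * (A (x + ε • u) - A (x - ε • u))) • u

/-- The iterates `x_0, ..., x_T` of the inexact zeroth-order method with sampled directions
`u_0, ..., u_{T-1}` (constant after time `T`). -/
def iterate {m T : ℕ} (A : Vec m → ℝ) (η ε : ℝ) (x₀ : Vec m) (u : Fin T → Vec m) : ℕ → Vec m
  | 0 => x₀
  | t + 1 =>
    if h : t < T then
      iterate A η ε x₀ u t - η • estimator A ε (iterate A η ε x₀ u t) (u ⟨t, h⟩)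
    else iterate A η ε x₀ u t

/-- The random inputs of the method: independent directions `u_t`, uniform on the unit sphere,
and an independent output index `R`, uniform on `{0, ..., T-1}`. -/
structure IsSampling {m T : ℕ} {Ω : Type*} [MeasurableSpace Ω] (P : Measure Ω)
    (u : Fin T → Ω → Vec m) (R : Ω → Fin T) : Prop where
  measurable_dir : ∀ t, Measurable (u t)
  law_dir : ∀ t, P.map (u t) = sphereUniform m
  indep_dir : iIndepFun u P
  measurable_index : Measurable R
  law_index : ∀ t, P (R ⁻¹' {t}) = (T : ℝ≥0∞)⁻¹
  indep_index : IndepFun (fun ω t => u t ω) R P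

/-- The output of the method: the iterate with the random index. -/
def output {m T : ℕ} {Ω : Type*} (A : Vec m → ℝ) (η ε : ℝ) (x₀ : Vec m)
    (u : Fin T → Ω → Vec m) (R : Ω → Fin T) (ω : Ω) : Vec m :=
  iterate A η ε x₀ (fun t => u t ω) (R ω)

/-- `A` is a (deterministic, measurable) evaluation subroutine for `φ` with accuracy `w`. -/
structure IsSubroutine {m : ℕ} (φ : Vec m → ℝ) (w : ℝ) (A : Vec m → ℝ) : Prop where
  measurable : Measurable A
  accurate : ∀ x, |A x - φ x| ≤ w

/-- The parameter choice `η = Θ(m^{-1/2} T^{-1/2})`, `ε = O(T^{-1/2})`,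
`w = O(m^{-3/4} T^{-3/4})`. The evaluation error is of the required order relative to the
radius too, `w / ε = O(m^{-3/4} T^{-1/4})`; this last condition is automatic (with another
constant) when `ε` is of exact order `T^{-1/2}`. -/
structure IsParameterChoice (cη Cη Cε Cw Cr : ℝ) (m T : ℕ) (η ε w : ℝ) : Prop where
  step_lower : cη * ((m : ℝ) ^ (-(1 / 2) : ℝ) * (T : ℝ) ^ (-(1 / 2) : ℝ)) ≤ η
  step_upper : η ≤ Cη * ((m : ℝ) ^ (-(1 / 2) : ℝ) * (T : ℝ) ^ (-(1 / 2) : ℝ))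
  radius_pos : 0 < ε
  radius_upper : ε ≤ Cε * (T : ℝ) ^ (-(1 / 2) : ℝ)
  error_pos : 0 < w
  error_upper : w ≤ Cw * ((m : ℝ) ^ (-(3 / 4) : ℝ) * (T : ℝ) ^ (-(3 / 4) : ℝ))
  error_radius : w / ε ≤ Cr * ((m : ℝ) ^ (-(3 / 4) : ℝ) * (T : ℝ) ^ (-(1 / 4) : ℝ))

end Bilevel

end

/-! The error bound makes the solution map regular to second order. Let `y` solve the lower problem
at an intermediate point of `[x₂, x₁]`. Some solution `y₂` at `x₂` is close to `y`; continue the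
line from `y₂` through `y` until it reaches a point `y₁'` above `x₁`. Along the joint segment `∇_y
f` vanishes at two points and has a Lipschitz derivative, so it is `O(‖x₁ - x₂‖²)` at the end, and
the error bound supplies a true solution `y₁` that close to `y₁'`
(`LowerLevel.exists_interpolation`). Interpolating the smooth function `F` along this segment shows
that `φ_p` is `ρ`-weakly convex (`LowerLevel.strongConvexOn_phiP`). Replacing `F` by `-F` makes
`φ_o` `ρ`-weakly concave.

By the divergence theorem the exact two-point estimator is unbiased for the gradient `g` of the
average of `φ` over the `ε`-ball; inexact values add a bias of at most `m w / ε`. Its second moment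
is of order `m`, not `m²`, because an odd `L`-Lipschitz function on the sphere has second moment
`O(L² / m)` (`lintegral_sphereUniform_sq_le`). That bound follows from a rotation argument in the
manner of Maurey and Pisier.

In the optimistic case weak concavity gives the smoothed objective a quadratic upper model with
constant `ρ`, whatever `ε` is. The usual descent argument then bounds the mean of `‖g‖²`, and a
proximal step turns a small `g` into a small Clarke subgradient at distance `O(√ε)`
(`exists_mem_clarkeBall`). In the pessimistic case the Moreau envelope serves as the potential: it
has an upper model with constant `γ⁻¹`, and since `g` is a subgradient of `φ_p` up to `2Mε`, moving
along `-g` approaches the proximal point (`lintegral_moreau_output_le`). The step size balances `1 /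
(η T)` against `η m`; both are of order `√m / √T`. -/

namespace Bilevel

/-! ### Uniform measure on the sphere and polar coordinates. -/

section Sphere

variable {m : ℕ}

lemma nontrivial_vec (hm : 0 < m) : Nontrivial (Vec m) := by
  have : Nonempty (Fin m) := ⟨⟨0, hm⟩⟩
  infer_instance

lemma toSphere_univ_ne_zero (hm : 0 < m) :
    (volume : Measure (Vec m)).toSphere Set.univ ≠ 0 := by
  have := nontrivial_vec hm
  exact Measure.measure_univ_ne_zero.2 (Measure.toSphere_ne_zero _)

lemma isProbabilityMeasure_sphereUniform (hm : 0 < m) :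
    IsProbabilityMeasure (sphereUniform m) := by
  unfold sphereUniform
  have : IsProbabilityMeasure (((volume : Measure (Vec m)).toSphere Set.univ)⁻¹ •
      (volume : Measure (Vec m)).toSphere) := by
    refine ⟨?_⟩
    rw [Measure.smul_apply, smul_eq_mul]
    exact ENNReal.inv_mul_cancel (toSphere_univ_ne_zero hm) (measure_ne_top _ _)
  exact Measure.isProbabilityMeasure_map measurable_subtype_coe.aemeasurable

lemma ae_norm_sphereUniform : ∀ᵐ u ∂(sphereUniform m), ‖u‖ = 1 := by
  unfold sphereUniform
  rw [ae_map_iff measurable_subtype_coe.aemeasurable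
    (measurableSet_eq_fun measurable_norm measurable_const)]
  exact ae_of_all _ fun u => by simp

lemma lintegral_sphereUniform (H : Vec m → ℝ≥0∞) (hH : Measurable H) :
    ∫⁻ u, H u ∂(sphereUniform m) = ((volume : Measure (Vec m)).toSphere Set.univ)⁻¹ *
      ∫⁻ u : Metric.sphere (0 : Vec m) 1, H u ∂(volume : Measure (Vec m)).toSphere := by
  unfold sphereUniform
  rw [lintegral_map hH measurable_subtype_coe, lintegral_smul_measure, smul_eq_mul]

lemma integral_sphereUniform (H : Vec m → ℝ) :
    ∫ u, H u ∂(sphereUniform m) = ((volume : Measure (Vec m)).toSphere.real Set.univ)⁻¹ *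
      ∫ u : Metric.sphere (0 : Vec m) 1, H u ∂(volume : Measure (Vec m)).toSphere := by
  unfold sphereUniform
  rw [(MeasurableEmbedding.subtype_coe Metric.isClosed_sphere.measurableSet).integral_map,
    integral_smul_measure, smul_eq_mul, ENNReal.toReal_inv, Measure.real]

/-- Polar coordinates for products of a radial and an angular function. -/
lemma integral_radial_mul_angular (hm : 0 < m) (k : ℝ → ℝ) (H : Vec m → ℝ) :
    ∫ x : Vec m, k ‖x‖ * H (‖x‖⁻¹ • x) =
      (∫ u, H u ∂(sphereUniform m)) * ∫ x : Vec m, k ‖x‖ := by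
  have := nontrivial_vec hm
  set μ : Measure (Vec m) := volume
  have key : ∀ G : Vec m → ℝ, ∫ x : Vec m, k ‖x‖ * G (‖x‖⁻¹ • x) =
      (∫ u : Metric.sphere (0 : Vec m) 1, G u ∂μ.toSphere) *
        ∫ r : Set.Ioi (0 : ℝ), k r ∂(Measure.volumeIoiPow (Module.finrank ℝ (Vec m) - 1)) := by
    intro G
    calc ∫ x : Vec m, k ‖x‖ * G (‖x‖⁻¹ • x)
        = ∫ x : ({(0)}ᶜ : Set (Vec m)), k ‖x.1‖ * G (‖x.1‖⁻¹ • x.1) ∂(μ.comap (↑)) := by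
          rw [integral_subtype_comap (measurableSet_singleton _).compl
            fun x ↦ k ‖x‖ * G (‖x‖⁻¹ • x), restrict_compl_singleton]
      _ = ∫ p, G p.1 * k p.2
            ∂μ.toSphere.prod (.volumeIoiPow (Module.finrank ℝ (Vec m) - 1)) := by
          rw [← μ.measurePreserving_homeomorphUnitSphereProd.integral_comp
            (Homeomorph.measurableEmbedding _)]
          refine integral_congr_ae (ae_of_all _ fun x => ?_)
          simp [mul_comm]
      _ = _ := integral_prod_mul (fun u : Metric.sphere (0 : Vec m) 1 => G u)
          (fun r : Set.Ioi (0 : ℝ) => k r)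
  -- The constant angular function expresses the one-dimensional radial integral through `∫ k ‖x‖`;
  -- the total mass of the surface measure then cancels against the normalization.
  have h1 := key fun _ => 1
  simp only [mul_one, integral_const, smul_eq_mul] at h1
  have hne : μ.toSphere.real Set.univ ≠ 0 := by
    rw [Measure.real, ENNReal.toReal_ne_zero]
    exact ⟨toSphere_univ_ne_zero hm, measure_ne_top _ _⟩
  rw [key H, h1, show ∫ u, H u ∂(sphereUniform m) = (μ.toSphere.real Set.univ)⁻¹ *
    ∫ u : Metric.sphere (0 : Vec m) 1, H u ∂μ.toSphere from integral_sphereUniform H]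
  field_simp

/-- Polar coordinates for products of a radial and an angular function, Lebesgue integrals. -/
lemma lintegral_radial_mul_angular (hm : 0 < m) (k : ℝ → ℝ≥0∞) (hk : Measurable k)
    (H : Vec m → ℝ≥0∞) (hH : Measurable H) :
    ∫⁻ x : Vec m, k ‖x‖ * H (‖x‖⁻¹ • x) =
      (∫⁻ u, H u ∂(sphereUniform m)) * ∫⁻ x : Vec m, k ‖x‖ := by
  have := nontrivial_vec hm
  set μ : Measure (Vec m) := volume
  have key : ∀ G : Vec m → ℝ≥0∞, Measurable G → ∫⁻ x : Vec m, k ‖x‖ * G (‖x‖⁻¹ • x) =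
      (∫⁻ u : Metric.sphere (0 : Vec m) 1, G u ∂μ.toSphere) *
        ∫⁻ r : Set.Ioi (0 : ℝ), k r ∂(Measure.volumeIoiPow (Module.finrank ℝ (Vec m) - 1)) := by
    intro G hG
    calc ∫⁻ x : Vec m, k ‖x‖ * G (‖x‖⁻¹ • x)
        = ∫⁻ x : ({(0)}ᶜ : Set (Vec m)), k ‖x.1‖ * G (‖x.1‖⁻¹ • x.1) ∂(μ.comap (↑)) := by
          rw [lintegral_subtype_comap (measurableSet_singleton _).compl
            fun x ↦ k ‖x‖ * G (‖x‖⁻¹ • x), restrict_compl_singleton]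
      _ = ∫⁻ p, G p.1 * k p.2
            ∂μ.toSphere.prod (.volumeIoiPow (Module.finrank ℝ (Vec m) - 1)) := by
          rw [← μ.measurePreserving_homeomorphUnitSphereProd.lintegral_comp_emb
            (Homeomorph.measurableEmbedding _)]
          refine lintegral_congr fun x => ?_
          simp [mul_comm]
      _ = _ := lintegral_prod_mul (f := fun u : Metric.sphere (0 : Vec m) 1 => G u)
          (g := fun r : Set.Ioi (0 : ℝ) => k r)
          (hG.comp measurable_subtype_coe).aemeasurable
          (hk.comp measurable_subtype_coe).aemeasurable
  have h1 := key (fun _ => 1) measurable_const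
  simp only [mul_one, lintegral_const, one_mul] at h1
  have hne : μ.toSphere Set.univ ≠ 0 := toSphere_univ_ne_zero hm
  rw [key H hH, h1, lintegral_sphereUniform _ hH]
  rw [mul_comm _ (∫⁻ u : Metric.sphere (0 : Vec m) 1, H u ∂μ.toSphere), mul_assoc,
    ← mul_assoc _ _ (∫⁻ r : Set.Ioi (0 : ℝ), _ ∂_),
    ENNReal.inv_mul_cancel hne (measure_ne_top _ _), one_mul]

end Sphere

/-! ### The divergence theorem on the unit ball for Lipschitz functions. -/

section Stokes

variable {m : ℕ}

/-- The radial cutoff that is `1` on the unit ball and decreases linearly to `0` at radius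
`1 + s`. -/
noncomputable def radialCutoff {E : Type*} [NormedAddCommGroup E] (s : ℝ) (x : E) : ℝ :=
  max 0 (min 1 (s⁻¹ * (1 + s - ‖x‖)))

section

variable {E : Type*} [NormedAddCommGroup E] {s : ℝ}

lemma lipschitzWith_radialCutoff (hs : 0 < s) :
    LipschitzWith ⟨s⁻¹, (inv_pos.2 hs).le⟩ (radialCutoff (E := E) s) := by
  refine LipschitzWith.const_max (LipschitzWith.const_min ?_ _) _
  refine LipschitzWith.of_dist_le_mul fun x y => ?_
  have : dist (s⁻¹ * (1 + s - ‖x‖)) (s⁻¹ * (1 + s - ‖y‖)) = s⁻¹ * |‖y‖ - ‖x‖| := by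
    rw [Real.dist_eq, ← mul_sub, abs_mul, abs_of_pos (inv_pos.2 hs)]
    congr 2; ring
  rw [this, dist_comm, dist_eq_norm]
  exact mul_le_mul_of_nonneg_left (abs_norm_sub_norm_le y x) (inv_pos.2 hs).le

lemma radialCutoff_of_norm_le (hs : 0 < s) {x : E} (hx : ‖x‖ ≤ 1) : radialCutoff s x = 1 := by
  unfold radialCutoff
  rw [min_eq_left, max_eq_right zero_le_one]
  rw [← div_eq_inv_mul, le_div_iff₀ hs]
  linarith

lemma radialCutoff_of_le_norm (hs : 0 < s) {x : E} (hx : 1 + s ≤ ‖x‖) : radialCutoff s x = 0 := by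
  unfold radialCutoff
  refine max_eq_left (min_le_of_right_le ?_)
  exact mul_nonpos_of_nonneg_of_nonpos (inv_pos.2 hs).le (by linarith)

lemma radialCutoff_of_mem_shell (hs : 0 < s) {x : E} (hx : 1 ≤ ‖x‖) (hx' : ‖x‖ ≤ 1 + s) :
    radialCutoff s x = s⁻¹ * (1 + s - ‖x‖) := by
  unfold radialCutoff
  rw [min_eq_right, max_eq_right]
  · exact mul_nonneg (inv_pos.2 hs).le (by linarith)
  · rw [← div_eq_inv_mul, div_le_iff₀ hs]
    linarith

lemma radialCutoff_nonneg (x : E) : 0 ≤ radialCutoff s x := le_max_left _ _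

lemma radialCutoff_le_one (x : E) : radialCutoff s x ≤ 1 :=
  max_le zero_le_one (min_le_left _ _)

lemma hasCompactSupport_radialCutoff [ProperSpace E] (hs : 0 < s) :
    HasCompactSupport (radialCutoff (E := E) s) := by
  refine HasCompactSupport.intro (isCompact_closedBall (0 : E) (1 + s)) fun x hx => ?_
  refine radialCutoff_of_le_norm hs ?_
  simp only [Metric.mem_closedBall, dist_zero_right, not_le] at hx
  exact hx.le

end

/-- The sign of `-v` is the one produced by integration by parts, so that the outward normal appears
with a plus sign. The two excluded spheres are null sets. -/
lemma lineDeriv_radialCutoff {s : ℝ} (hs : 0 < s) (v x : Vec m) (h1 : ‖x‖ ≠ 1)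
    (h2 : ‖x‖ ≠ 1 + s) :
    lineDeriv ℝ (radialCutoff s) x (-v) =
      Set.indicator {x : Vec m | 1 < ‖x‖ ∧ ‖x‖ < 1 + s}
        (fun x => s⁻¹ * inner ℝ (‖x‖⁻¹ • x) v) x := by
  rcases lt_or_gt_of_ne h1 with h | h
  · rw [Set.indicator_of_notMem (fun hx => absurd hx.1 (not_lt.2 h.le))]
    have : radialCutoff s =ᶠ[𝓝 x] fun _ => (1 : ℝ) := by
      filter_upwards [(isOpen_lt continuous_norm continuous_const).mem_nhds h] with y hy
      exact radialCutoff_of_norm_le hs (le_of_lt hy)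
    rw [this.lineDeriv_eq]
    simp [lineDeriv]
  rcases lt_or_gt_of_ne h2 with h' | h'
  · rw [Set.indicator_of_mem (show x ∈ {x : Vec m | 1 < ‖x‖ ∧ ‖x‖ < 1 + s} from ⟨h, h'⟩)]
    have : radialCutoff s =ᶠ[𝓝 x] fun y => s⁻¹ * (1 + s - ‖y‖) := by
      filter_upwards [(isOpen_lt continuous_const continuous_norm).mem_nhds h,
        (isOpen_lt continuous_norm continuous_const).mem_nhds h'] with y hy hy'
      exact radialCutoff_of_mem_shell hs (le_of_lt hy) (le_of_lt hy')
    rw [this.lineDeriv_eq, lineDeriv]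
    refine HasDerivAt.deriv ?_
    have hx0 : ‖x‖ ≠ 0 := by positivity
    have hlin : HasDerivAt (fun t : ℝ => x + t • (-v)) (-v) 0 := by
      simpa using ((hasDerivAt_id (0 : ℝ)).smul_const (-v)).const_add x
    have hsq := hlin.norm_sq
    have hsqrt := hsq.sqrt (by simpa using hx0)
    simp only [Real.sqrt_sq (norm_nonneg _)] at hsqrt
    convert! (hsqrt.const_sub (1 + s)).const_mul s⁻¹ using 1
    simp only [zero_smul, add_zero, inner_neg_right, real_inner_smul_left]
    field_simp
  · rw [Set.indicator_of_notMem (fun hx => absurd hx.2 (not_lt.2 h'.le))]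
    have : radialCutoff s =ᶠ[𝓝 x] fun _ => (0 : ℝ) := by
      filter_upwards [(isOpen_lt continuous_const continuous_norm).mem_nhds h'] with y hy
      exact radialCutoff_of_le_norm hs (le_of_lt hy)
    rw [this.lineDeriv_eq]
    simp [lineDeriv]

lemma measureReal_shell {s : ℝ} (hs : 0 < s) :
    (volume : Measure (Vec m)).real {x : Vec m | 1 < ‖x‖ ∧ ‖x‖ < 1 + s} =
      ((1 + s) ^ m - 1) * (volume : Measure (Vec m)).real (Metric.ball 0 1) := by
  have h : {x : Vec m | 1 < ‖x‖ ∧ ‖x‖ < 1 + s} =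
      Metric.ball 0 (1 + s) \ Metric.closedBall 0 1 := by
    ext x; simp [and_comm]
  have hsub : Metric.closedBall (0 : Vec m) 1 ⊆ Metric.ball 0 (1 + s) :=
    Metric.closedBall_subset_ball (by linarith)
  rw [h, measureReal_sdiff hsub Metric.isClosed_closedBall.measurableSet,
    Measure.real, Measure.addHaar_ball_of_pos _ _ (by linarith), Measure.real,
    Measure.addHaar_closedBall _ _ zero_le_one]
  simp [Measure.real, ENNReal.toReal_ofReal, (by linarith : (0 : ℝ) ≤ 1 + s)]
  ring

/-- The limit is the derivative of `r ^ m` at `r = 1`; this is the source of the dimension factor in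
the estimator. -/
lemma tendsto_measureReal_shell :
    Tendsto (fun s : ℝ => s⁻¹ * (volume : Measure (Vec m)).real
      {x : Vec m | 1 < ‖x‖ ∧ ‖x‖ < 1 + s}) (𝓝[>] 0)
      (𝓝 (m * (volume : Measure (Vec m)).real (Metric.ball 0 1))) := by
  have h := (hasDerivAt_pow m (1 : ℝ)).tendsto_slope_zero_right
  simp only [one_pow, mul_one, smul_eq_mul] at h
  refine (h.mul_const ((volume : Measure (Vec m)).real (Metric.ball 0 1))).congr' ?_
  filter_upwards [self_mem_nhdsWithin] with s hs
  rw [measureReal_shell hs, mul_assoc]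

/-- The cutoffs converge pointwise to the indicator of the closed ball, and for `s ≤ 1` they live in
the ball of radius `2`, so dominated convergence applies. -/
lemma tendsto_integral_lineDeriv_mul_radialCutoff {C : ℝ≥0} {f : Vec m → ℝ}
    (hf : LipschitzWith C f) (v : Vec m) :
    Tendsto (fun s : ℝ => ∫ x, lineDeriv ℝ f x v * radialCutoff s x) (𝓝[>] 0)
      (𝓝 (∫ x in Metric.closedBall (0 : Vec m) 1, lineDeriv ℝ f x v)) := by
  rw [← integral_indicator Metric.isClosed_closedBall.measurableSet]
  refine tendsto_integral_filter_of_dominated_convergence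
    ((Metric.closedBall (0 : Vec m) 2).indicator fun _ => C * ‖v‖) ?_ ?_ ?_ ?_
  · filter_upwards [self_mem_nhdsWithin] with s hs
    exact (aestronglyMeasurable_lineDeriv hf.continuous volume).mul
      (lipschitzWith_radialCutoff hs).continuous.aestronglyMeasurable
  · filter_upwards [Ioc_mem_nhdsGT zero_lt_one] with s hs
    refine ae_of_all _ fun x => ?_
    by_cases hx : x ∈ Metric.closedBall (0 : Vec m) 2
    · rw [Set.indicator_of_mem hx, norm_mul, Real.norm_of_nonneg (radialCutoff_nonneg x)]
      calc _ ≤ C * ‖v‖ * 1 := mul_le_mul (norm_lineDeriv_le_of_lipschitz ℝ hf)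
            (radialCutoff_le_one x) (radialCutoff_nonneg x) (by positivity)
        _ = _ := mul_one _
    · rw [Set.indicator_of_notMem hx]
      simp only [Metric.mem_closedBall, dist_zero_right, not_le] at hx
      rw [radialCutoff_of_le_norm hs.1 (by linarith [hs.2])]
      simp
  · exact (integrable_indicator_iff Metric.isClosed_closedBall.measurableSet).2
      (integrableOn_const (measure_closedBall_lt_top.ne))
  · refine ae_of_all _ fun x => ?_
    by_cases hx : x ∈ Metric.closedBall (0 : Vec m) 1
    · rw [Set.indicator_of_mem hx]
      refine tendsto_const_nhds.congr' ?_
      filter_upwards [self_mem_nhdsWithin] with s hs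
      rw [radialCutoff_of_norm_le hs (by simpa using hx), mul_one]
    · rw [Set.indicator_of_notMem hx]
      simp only [Metric.mem_closedBall, dist_zero_right, not_le] at hx
      refine tendsto_const_nhds.congr' ?_
      filter_upwards [Ioc_mem_nhdsGT (sub_pos.2 hx)] with s hs
      rw [radialCutoff_of_le_norm hs.1 (by linarith [hs.2]), mul_zero]

/-- The derivative of the cutoff is concentrated on a shell of thickness `s`, with size `s⁻¹`. There
`f x` may be replaced by its value at the radial projection at a cost `C * s`, after which the
integral factors exactly in polar coordinates. -/
lemma tendsto_integral_lineDeriv_radialCutoff_mul (hm : 0 < m) {C : ℝ≥0} {f : Vec m → ℝ}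
    (hf : LipschitzWith C f) (v : Vec m) :
    Tendsto (fun s : ℝ => ∫ x, lineDeriv ℝ (radialCutoff s) x (-v) * f x) (𝓝[>] 0)
      (𝓝 ((∫ u, f u * inner ℝ u v ∂(sphereUniform m)) *
        (m * (volume : Measure (Vec m)).real (Metric.ball 0 1)))) := by
  have := nontrivial_vec hm
  set S : ℝ → Set (Vec m) := fun s => {x : Vec m | 1 < ‖x‖ ∧ ‖x‖ < 1 + s} with hS
  have hSm : ∀ s, MeasurableSet (S s) := fun s =>
    ((isOpen_lt continuous_const continuous_norm).inter
      (isOpen_lt continuous_norm continuous_const)).measurableSet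
  have hSfin : ∀ s, volume (S s) < ∞ := fun s =>
    (measure_mono (fun x hx => by simpa using hx.2)).trans_lt
      (measure_ball_lt_top (x := (0 : Vec m)) (r := 1 + s))
  set H : Vec m → ℝ := fun u => f u * inner ℝ u v
  have hunit : Measurable fun x : Vec m => ‖x‖⁻¹ • x := by fun_prop
  have hHm : Measurable H := (hf.continuous.mul (by fun_prop)).measurable
  -- the angular part
  have hang : ∀ s, 0 < s → ∫ x in S s, s⁻¹ * H (‖x‖⁻¹ • x) =
      (∫ u, H u ∂(sphereUniform m)) * (s⁻¹ * (volume : Measure (Vec m)).real (S s)) := by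
    intro s hs
    have h := integral_radial_mul_angular hm ((Set.Ioo 1 (1 + s)).indicator fun _ => s⁻¹) H
    have e1 : ∀ x : Vec m, (Set.Ioo 1 (1 + s)).indicator (fun _ => s⁻¹) ‖x‖ * H (‖x‖⁻¹ • x) =
        (S s).indicator (fun x => s⁻¹ * H (‖x‖⁻¹ • x)) x := by
      intro x
      by_cases hx : x ∈ S s
      · rw [Set.indicator_of_mem hx, Set.indicator_of_mem (show ‖x‖ ∈ Set.Ioo 1 (1 + s) from hx)]
      · rw [Set.indicator_of_notMem hx,
          Set.indicator_of_notMem (show ‖x‖ ∉ Set.Ioo 1 (1 + s) from hx), zero_mul]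
    have e2 : ∀ x : Vec m, (Set.Ioo 1 (1 + s)).indicator (fun _ => s⁻¹) ‖x‖ =
        (S s).indicator (fun _ => s⁻¹) x := fun x => rfl
    simp only [e1] at h
    simp only [e2] at h
    rw [integral_indicator (hSm s), integral_indicator (hSm s), setIntegral_const,
      smul_eq_mul, mul_comm _ s⁻¹] at h
    exact h
  have hrw : ∀ s, 0 < s → ∫ x, lineDeriv ℝ (radialCutoff s) x (-v) * f x =
      ∫ x in S s, s⁻¹ * inner ℝ (‖x‖⁻¹ • x) v * f x := by
    intro s hs
    rw [← integral_indicator (hSm s)]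
    refine integral_congr_ae ?_
    have n1 : ∀ᵐ x : Vec m, x ∉ Metric.sphere (0 : Vec m) 1 :=
      measure_eq_zero_iff_ae_notMem.1 (Measure.addHaar_sphere _ _ _)
    have n2 : ∀ᵐ x : Vec m, x ∉ Metric.sphere (0 : Vec m) (1 + s) :=
      measure_eq_zero_iff_ae_notMem.1 (Measure.addHaar_sphere _ _ _)
    filter_upwards [n1, n2] with x h1 h2
    rw [lineDeriv_radialCutoff hs v x (by simpa using h1) (by simpa using h2)]
    exact (Set.indicator_mul_left (S s) (fun x => s⁻¹ * inner ℝ (‖x‖⁻¹ • x) v) f).symm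
  -- The error is `s` times a quantity that stays bounded, because `s⁻¹` times the volume of the
  -- shell converges.
  have hdiff : ∀ s, 0 < s → s ≤ 1 →
      ‖(∫ x, lineDeriv ℝ (radialCutoff s) x (-v) * f x) -
        (∫ u, H u ∂(sphereUniform m)) * (s⁻¹ * (volume : Measure (Vec m)).real (S s))‖ ≤
      s * (‖v‖ * C * (s⁻¹ * (volume : Measure (Vec m)).real (S s))) := by
    intro s hs hs1
    have hun : ∀ x ∈ S s, ‖‖x‖⁻¹ • x‖ = 1 := by
      intro x hx
      have : ‖x‖ ≠ 0 := by linarith [hx.1]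
      rw [norm_smul, norm_inv, norm_norm, inv_mul_cancel₀ this]
    have hin : ∀ x ∈ S s, ‖(inner ℝ (‖x‖⁻¹ • x) v : ℝ)‖ ≤ ‖v‖ := by
      intro x hx
      refine (norm_inner_le_norm _ _).trans ?_
      rw [hun x hx, one_mul]
    have hfb : ∀ x : Vec m, ‖x‖ ≤ 2 → ‖f x‖ ≤ ‖f 0‖ + C * 2 := by
      intro x hx
      have h1 := hf.norm_sub_le x 0
      have h2 : ‖f x‖ ≤ ‖f x - f 0‖ + ‖f 0‖ := by simpa using norm_add_le (f x - f 0) (f 0)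
      have h3 : (C : ℝ) * ‖x - 0‖ ≤ C * 2 := by
        rw [sub_zero]; gcongr
      linarith
    have hsn : ‖s⁻¹‖ = s⁻¹ := Real.norm_of_nonneg (inv_pos.2 hs).le
    have i1 : IntegrableOn (fun x => s⁻¹ * inner ℝ (‖x‖⁻¹ • x) v * f x) (S s) := by
      refine Measure.integrableOn_of_bounded (M := s⁻¹ * ‖v‖ * (‖f 0‖ + C * 2)) (hSfin s).ne
        ?_ ?_
      · exact ((measurable_const.mul (hunit.inner measurable_const)).mul
          hf.continuous.measurable).aestronglyMeasurable
      · refine (ae_restrict_iff' (hSm s)).2 (ae_of_all _ fun x hx => ?_)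
        rw [norm_mul, norm_mul, hsn]
        have := hin x hx
        have := hfb x (by linarith [hx.2])
        gcongr
    have i2 : IntegrableOn (fun x => s⁻¹ * H (‖x‖⁻¹ • x)) (S s) := by
      refine Measure.integrableOn_of_bounded (M := s⁻¹ * ((‖f 0‖ + C * 2) * ‖v‖)) (hSfin s).ne
        ?_ ?_
      · exact (measurable_const.mul (hHm.comp hunit)).aestronglyMeasurable
      · refine (ae_restrict_iff' (hSm s)).2 (ae_of_all _ fun x hx => ?_)
        rw [norm_mul, norm_mul, hsn]
        have := hin x hx
        have := hfb (‖x‖⁻¹ • x) (by linarith [hun x hx])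
        gcongr
    rw [hrw s hs, ← hang s hs, ← integral_sub i1 i2]
    have hs0 : s * (‖v‖ * C * (s⁻¹ * (volume : Measure (Vec m)).real (S s))) =
        (‖v‖ * C) * (volume : Measure (Vec m)).real (S s) := by field_simp
    rw [hs0]
    refine norm_setIntegral_le_of_norm_le_const (hSfin s) fun x hx => ?_
    have e : s⁻¹ * inner ℝ (‖x‖⁻¹ • x) v * f x - s⁻¹ * H (‖x‖⁻¹ • x) =
        s⁻¹ * (inner ℝ (‖x‖⁻¹ • x) v * (f x - f (‖x‖⁻¹ • x))) := by
      simp only [H]; ring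
    have hd : ‖f x - f (‖x‖⁻¹ • x)‖ ≤ C * s := by
      refine (hf.norm_sub_le _ _).trans ?_
      have hx0 : ‖x‖ ≠ 0 := by linarith [hx.1]
      have : x - ‖x‖⁻¹ • x = (‖x‖ - 1) • (‖x‖⁻¹ • x) := by
        rw [sub_smul, smul_smul, mul_inv_cancel₀ hx0, one_smul, one_smul]
      rw [this, norm_smul, hun x hx, mul_one, Real.norm_of_nonneg (by linarith [hx.1])]
      gcongr
      linarith [hx.2]
    rw [e, norm_mul, norm_mul, hsn]
    calc s⁻¹ * (‖(inner ℝ (‖x‖⁻¹ • x) v : ℝ)‖ * ‖f x - f (‖x‖⁻¹ • x)‖)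
        ≤ s⁻¹ * (‖v‖ * (C * s)) := by
          have := hin x hx
          gcongr
      _ = ‖v‖ * C := by field_simp
  have hA : Tendsto (fun s : ℝ => s⁻¹ * (volume : Measure (Vec m)).real (S s)) (𝓝[>] 0)
      (𝓝 (m * (volume : Measure (Vec m)).real (Metric.ball 0 1))) := tendsto_measureReal_shell
  have hmain := hA.const_mul (∫ u, H u ∂(sphereUniform m))
  have hzero : Tendsto (fun s : ℝ => s * (‖v‖ * C * (s⁻¹ * (volume : Measure (Vec m)).real (S s))))
      (𝓝[>] 0) (𝓝 0) := by
    have h0 : Tendsto (fun s : ℝ => s) (𝓝[>] 0) (𝓝 0) := tendsto_nhdsWithin_of_tendsto_nhds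
      tendsto_id
    simpa using h0.mul (hA.const_mul (‖v‖ * (C : ℝ)))
  have hd0 := squeeze_zero_norm' (a := fun s : ℝ => s * (‖v‖ * C *
      (s⁻¹ * (volume : Measure (Vec m)).real (S s)))) (f := fun s =>
      (∫ x, lineDeriv ℝ (radialCutoff s) x (-v) * f x) -
        (∫ u, H u ∂(sphereUniform m)) * (s⁻¹ * (volume : Measure (Vec m)).real (S s)))
      (t₀ := 𝓝[>] (0 : ℝ)) (by
        filter_upwards [Ioc_mem_nhdsGT zero_lt_one] with s hs using hdiff s hs.1 hs.2) hzero
  simpa only [sub_add_cancel, zero_add] using hd0.add hmain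

/-- The divergence theorem on the unit ball for Lipschitz functions. -/
theorem integral_closedBall_lineDeriv (hm : 0 < m) {C : ℝ≥0} {f : Vec m → ℝ}
    (hf : LipschitzWith C f) (v : Vec m) :
    ∫ x in Metric.closedBall (0 : Vec m) 1, lineDeriv ℝ f x v =
      (∫ u, f u * inner ℝ u v ∂(sphereUniform m)) *
        (m * (volume : Measure (Vec m)).real (Metric.ball 0 1)) := by
  refine tendsto_nhds_unique (tendsto_integral_lineDeriv_mul_radialCutoff hf v) ?_
  refine (tendsto_integral_lineDeriv_radialCutoff_mul hm hf v).congr' ?_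
  filter_upwards [self_mem_nhdsWithin] with s hs
  exact (hf.integral_lineDeriv_mul_eq (lipschitzWith_radialCutoff hs)
    (hasCompactSupport_radialCutoff hs) v).symm

end Stokes

/-! ### Second moments of odd Lipschitz functions on the sphere, by rotation in a doubled space. -/

section SphericalVariance

variable {m : ℕ}

/-- Rotation by the angle `θ` in `ℝ^m × ℝ^m`. -/
noncomputable def rot (θ : ℝ) (p : Vec m × Vec m) : Vec m × Vec m :=
  (Real.cos θ • p.1 + Real.sin θ • p.2, -Real.sin θ • p.1 + Real.cos θ • p.2)

lemma rot_normSq (θ : ℝ) (p : Vec m × Vec m) :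
    ‖(rot θ p).1‖ ^ 2 + ‖(rot θ p).2‖ ^ 2 = ‖p.1‖ ^ 2 + ‖p.2‖ ^ 2 := by
  simp only [rot]
  rw [norm_add_sq_real, norm_add_sq_real]
  simp only [norm_smul, real_inner_smul_left, real_inner_smul_right, mul_pow, norm_neg,
    Real.norm_eq_abs, sq_abs]
  linear_combination (‖p.1‖ ^ 2 + ‖p.2‖ ^ 2) * Real.sin_sq_add_cos_sq θ

lemma rot_add (s t : ℝ) (p : Vec m × Vec m) : rot (t + s) p = rot s (rot t p) := by
  simp only [rot, Real.cos_add, Real.sin_add]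
  ext i <;> simp <;> ring

/-- Rotation in `ℝ^m × ℝ^m` as an isometry of the Euclidean product. -/
noncomputable def rotIsometry (θ : ℝ) : Joint m m →ₗᵢ[ℝ] Joint m m where
  toFun p := WithLp.toLp 2 (rot θ p.ofLp)
  map_add' p q := by
    refine (WithLp.ofLp_injective 2) ?_
    simp only [rot]
    ext i <;> simp <;> ring
  map_smul' c p := by
    refine (WithLp.ofLp_injective 2) ?_
    simp only [rot]
    ext i <;> simp <;> ring
  norm_map' p := by
    refine (sq_eq_sq₀ (norm_nonneg _) (norm_nonneg _)).1 ?_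
    have h1 := WithLp.prod_norm_sq_eq_of_L2 p
    rw [h1]
    exact (WithLp.prod_norm_sq_eq_of_L2 _).trans (rot_normSq θ p.ofLp)

lemma measurePreserving_rot_prod (θ : ℝ) :
    MeasurePreserving (rot (m := m) θ) (volume.prod volume) (volume.prod volume) := by
  have h := ((rotIsometry (m := m) θ).toLinearIsometryEquiv rfl).measurePreserving
  exact (WithLp.volume_preserving_ofLp (Vec m) (Vec m)).comp
    (h.comp (WithLp.volume_preserving_toLp (Vec m) (Vec m)))

/-- The Euclidean unit ball of `ℝ^m × ℝ^m`. -/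
def pairBall (m : ℕ) : Set (Vec m × Vec m) := {p | ‖p.1‖ ^ 2 + ‖p.2‖ ^ 2 ≤ 1}

lemma measurableSet_pairBall : MeasurableSet (pairBall m) :=
  (isClosed_le (by fun_prop) continuous_const).measurableSet

/-- Lebesgue measure on the Euclidean unit ball of `ℝ^m × ℝ^m`. -/
noncomputable def pairMeasure (m : ℕ) : Measure (Vec m × Vec m) :=
  ((volume : Measure (Vec m)).prod volume).restrict (pairBall m)

lemma measurePreserving_rot (θ : ℝ) :
    MeasurePreserving (rot θ) (pairMeasure m) (pairMeasure m) := by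
  have h := (measurePreserving_rot_prod (m := m) θ).restrict_preimage
    (measurableSet_pairBall (m := m))
  have e : rot θ ⁻¹' pairBall m = pairBall m := by
    ext p
    simp only [pairBall, Set.mem_preimage, Set.mem_ofPred_eq, rot_normSq]
  rwa [e] at h

lemma norm_le_one_of_mem_pairBall {p : Vec m × Vec m} (hp : p ∈ pairBall m) :
    ‖p.1‖ ≤ 1 ∧ ‖p.2‖ ≤ 1 := by
  have hp : ‖p.1‖ ^ 2 + ‖p.2‖ ^ 2 ≤ 1 := hp
  constructor <;> nlinarith [norm_nonneg p.1, norm_nonneg p.2]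

instance : IsFiniteMeasure (pairMeasure m) := by
  refine ⟨?_⟩
  rw [pairMeasure, Measure.restrict_apply_univ]
  refine (measure_mono (t := Metric.closedBall 0 1 ×ˢ Metric.closedBall 0 1) ?_).trans_lt ?_
  · intro p hp
    simpa using norm_le_one_of_mem_pairBall hp
  · rw [Measure.prod_prod]
    exact ENNReal.mul_lt_top measure_closedBall_lt_top measure_closedBall_lt_top

lemma ae_mem_pairBall : ∀ᵐ p ∂(pairMeasure m), p ∈ pairBall m :=
  ae_restrict_mem measurableSet_pairBall

/-- The indicator of the unit disc as a function of two radii. -/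
noncomputable def discWeight (r s : ℝ) : ℝ≥0∞ :=
  {q : ℝ × ℝ | q.1 ^ 2 + q.2 ^ 2 ≤ 1}.indicator (fun _ => 1) (r, s)

lemma measurable_discWeight : Measurable (Function.uncurry discWeight) :=
  measurable_const.indicator (isClosed_le (by fun_prop) continuous_const).measurableSet

lemma lintegral_pairMeasure (F : Vec m × Vec m → ℝ≥0∞) (hF : Measurable F) :
    ∫⁻ p, F p ∂(pairMeasure m) = ∫⁻ x : Vec m, ∫⁻ y : Vec m, discWeight ‖x‖ ‖y‖ * F (x, y) := by
  have hw : Measurable fun p : Vec m × Vec m => discWeight ‖p.1‖ ‖p.2‖ :=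
    measurable_discWeight.comp (by fun_prop : Measurable fun p : Vec m × Vec m => (‖p.1‖, ‖p.2‖))
  rw [pairMeasure, ← lintegral_indicator measurableSet_pairBall,
    ← lintegral_prod (fun p : Vec m × Vec m => discWeight ‖p.1‖ ‖p.2‖ * F p)
      (hw.mul hF).aemeasurable]
  refine lintegral_congr fun p => ?_
  by_cases hp : p ∈ pairBall m
  · rw [Set.indicator_of_mem hp, discWeight, Set.indicator_of_mem (by exact hp), one_mul]
  · rw [Set.indicator_of_notMem hp, discWeight, Set.indicator_of_notMem (by exact hp), zero_mul]

/-- A radial weight distributes the second moment evenly over all directions. -/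
lemma lintegral_radial_mul_inner_sq (k : ℝ → ℝ≥0∞) (hk : Measurable k) (v : Vec m) :
    m * ∫⁻ y : Vec m, k ‖y‖ * ENNReal.ofReal (inner ℝ v y ^ 2) =
      ENNReal.ofReal (‖v‖ ^ 2) * ∫⁻ y : Vec m, k ‖y‖ * ENNReal.ofReal (‖y‖ ^ 2) := by
  -- A reflection carries `v` to any vector of the same length and preserves the radial weight;
  -- summing over a rescaled orthonormal basis then gives the factor `m`.
  have hrot : ∀ w : Vec m, ‖v‖ = ‖w‖ →
      ∫⁻ y : Vec m, k ‖y‖ * ENNReal.ofReal (inner ℝ v y ^ 2) =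
        ∫⁻ y : Vec m, k ‖y‖ * ENNReal.ofReal (inner ℝ w y ^ 2) := by
    intro w hw
    set ρ := (Submodule.reflection (Submodule.span ℝ {v - w})ᗮ)
    have hρ : ρ v = w := Submodule.reflection_sub hw
    rw [← ρ.measurePreserving.lintegral_comp_emb ρ.toHomeomorph.measurableEmbedding
      (fun y => k ‖y‖ * ENNReal.ofReal (inner ℝ w y ^ 2))]
    refine lintegral_congr fun y => ?_
    rw [LinearIsometryEquiv.norm_map, ← hρ, LinearIsometryEquiv.inner_map_map]
  set b := EuclideanSpace.basisFun (Fin m) ℝ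
  have hk' : Measurable fun y : Vec m => k ‖y‖ := hk.comp measurable_norm
  have hsum : ∀ y : Vec m, ∑ i, ENNReal.ofReal (inner ℝ (‖v‖ • b i) y ^ 2) =
      ENNReal.ofReal (‖v‖ ^ 2) * ENNReal.ofReal (‖y‖ ^ 2) := by
    intro y
    rw [← ENNReal.ofReal_sum_of_nonneg (fun i _ => sq_nonneg _), ← ENNReal.ofReal_mul (sq_nonneg _)]
    congr 1
    simp only [real_inner_smul_left, mul_pow, ← Finset.mul_sum]
    rw [b.sum_sq_inner_right]
  calc m * ∫⁻ y : Vec m, k ‖y‖ * ENNReal.ofReal (inner ℝ v y ^ 2)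
      = ∑ i : Fin m, ∫⁻ y : Vec m, k ‖y‖ * ENNReal.ofReal (inner ℝ (‖v‖ • b i) y ^ 2) := by
        rw [Finset.sum_congr rfl fun i _ => (hrot (‖v‖ • b i) (by simp [norm_smul])).symm]
        simp
    _ = ∫⁻ y : Vec m, ∑ i : Fin m, k ‖y‖ * ENNReal.ofReal (inner ℝ (‖v‖ • b i) y ^ 2) := by
        rw [lintegral_finsetSum]
        intro i _
        exact hk'.mul (by fun_prop)
    _ = ∫⁻ y : Vec m, ENNReal.ofReal (‖v‖ ^ 2) * (k ‖y‖ * ENNReal.ofReal (‖y‖ ^ 2)) := by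
        refine lintegral_congr fun y => ?_
        rw [← Finset.mul_sum, hsum]
        ring
    _ = _ := lintegral_const_mul _ (hk'.mul (by fun_prop))

/-- With the first variable fixed, the disc weight is radial in the second, so the squared inner
product averages to `‖v‖² ‖y‖² / m`. This is where the gain of `1 / m` arises. -/
lemma lintegral_pairMeasure_inner_sq_le {K : ℝ} (v : Vec m → Vec m)
    (hvm : Measurable v) (hv : ∀ x, ‖v x‖ ≤ K) :
    m * ∫⁻ p, ENNReal.ofReal (inner ℝ (v p.1) p.2 ^ 2) ∂(pairMeasure m) ≤
      ENNReal.ofReal (K ^ 2) * ∫⁻ p, ENNReal.ofReal (‖p.2‖ ^ 2) ∂(pairMeasure m) := by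
  have hF : Measurable fun p : Vec m × Vec m => ENNReal.ofReal (inner ℝ (v p.1) p.2 ^ 2) := by
    fun_prop
  have hG : Measurable fun p : Vec m × Vec m => ENNReal.ofReal (‖p.2‖ ^ 2) := by fun_prop
  have hw : Measurable fun p : Vec m × Vec m => discWeight ‖p.1‖ ‖p.2‖ :=
    measurable_discWeight.comp (by fun_prop : Measurable fun p : Vec m × Vec m => (‖p.1‖, ‖p.2‖))
  rw [lintegral_pairMeasure _ hF, lintegral_pairMeasure _ hG,
    ← lintegral_const_mul _ (show Measurable fun x : Vec m => ∫⁻ y : Vec m,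
      discWeight ‖x‖ ‖y‖ * ENNReal.ofReal (inner ℝ (v x) y ^ 2) from
        (hw.mul hF).lintegral_prod_right'),
    ← lintegral_const_mul _ (show Measurable fun x : Vec m => ∫⁻ y : Vec m,
      discWeight ‖x‖ ‖y‖ * ENNReal.ofReal (‖y‖ ^ 2) from (hw.mul hG).lintegral_prod_right')]
  refine lintegral_mono fun x => ?_
  have hd : Measurable (discWeight ‖x‖) := measurable_discWeight.comp measurable_prodMk_left
  simp only
  rw [lintegral_radial_mul_inner_sq (discWeight ‖x‖) hd (v x)]
  gcongr
  exact hv x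

/-- A half turn in the plane of `p.1` and `p.2` leads from `p.1` to `-p.1`. It is cut into `N` equal
rotations, and Cauchy–Schwarz bounds the square of the telescoping sum by `N` times the sum of
squares. All increments have the same law because the measure is rotation invariant, whence the
factor `N²`. -/
lemma lintegral_sq_neg_sub_le {f : Vec m → ℝ} (hf : Continuous f) (N : ℕ) (hN : 0 < N) :
    ∫⁻ p, ENNReal.ofReal ((f (-p.1) - f p.1) ^ 2) ∂(pairMeasure m) ≤
      ∫⁻ p, ENNReal.ofReal ((N * (f (rot (Real.pi / N) p).1 - f p.1)) ^ 2) ∂(pairMeasure m) := by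
  set s := Real.pi / N
  have hrotc : ∀ t : ℝ, Measurable (rot (m := m) t) := fun t => by unfold rot; fun_prop
  have hfm := hf.measurable
  have hinc : ∀ k : ℕ, ∫⁻ p, ENNReal.ofReal ((f (rot ((k + 1 : ℕ) * s) p).1 -
      f (rot (k * s) p).1) ^ 2) ∂(pairMeasure m) =
      ∫⁻ p, ENNReal.ofReal ((f (rot s p).1 - f p.1) ^ 2) ∂(pairMeasure m) := by
    intro k
    rw [← (measurePreserving_rot (m := m) (k * s)).lintegral_comp (f := fun p =>
      ENNReal.ofReal ((f (rot s p).1 - f p.1) ^ 2))]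
    · refine lintegral_congr fun p => ?_
      rw [← rot_add]
      push_cast
      rw [add_mul, one_mul]
    · have := hrotc s
      fun_prop
  have h0 : ∀ p : Vec m × Vec m, (rot ((0 : ℕ) * s) p).1 = p.1 := fun p => by simp [rot]
  have hNs : (N : ℝ) * s = Real.pi := by
    have : (N : ℝ) ≠ 0 := by positivity
    simp only [s]; field_simp
  have h1 : ∀ p : Vec m × Vec m, (rot (N * s) p).1 = -p.1 := fun p => by
    rw [hNs]; simp [rot]
  calc ∫⁻ p, ENNReal.ofReal ((f (-p.1) - f p.1) ^ 2) ∂(pairMeasure m)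
      ≤ ∫⁻ p, ENNReal.ofReal N * ∑ k ∈ Finset.range N, ENNReal.ofReal
          ((f (rot ((k + 1 : ℕ) * s) p).1 - f (rot (k * s) p).1) ^ 2) ∂(pairMeasure m) := by
        refine lintegral_mono fun p => ?_
        simp only
        rw [← ENNReal.ofReal_sum_of_nonneg (fun i _ => sq_nonneg _),
          ← ENNReal.ofReal_mul (by positivity)]
        refine ENNReal.ofReal_le_ofReal ?_
        have htel := Finset.sum_range_sub (fun k : ℕ => f (rot (k * s) p).1) N
        rw [h0, h1] at htel
        rw [← htel]
        simpa using sq_sum_le_card_mul_sum_sq (s := Finset.range N)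
          (f := fun k => f (rot ((k + 1 : ℕ) * s) p).1 - f (rot (k * s) p).1)
    _ = ENNReal.ofReal N * (N * ∫⁻ p, ENNReal.ofReal ((f (rot s p).1 - f p.1) ^ 2)
          ∂(pairMeasure m)) := by
        rw [lintegral_const_mul, lintegral_finsetSum]
        · rw [Finset.sum_congr rfl fun k _ => hinc k]
          simp
        · intro k _
          have := hrotc ((k + 1 : ℕ) * s)
          have := hrotc (k * s)
          fun_prop
        · refine Finset.measurable_fun_sum _ fun k _ => ?_
          have := hrotc ((k + 1 : ℕ) * s)
          have := hrotc (k * s)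
          fun_prop
    _ = _ := by
        rw [ENNReal.ofReal_natCast, ← mul_assoc, ← lintegral_const_mul]
        · refine lintegral_congr fun p => ?_
          rw [mul_pow, ENNReal.ofReal_mul (by positivity),
            ENNReal.ofReal_pow (Nat.cast_nonneg N), ENNReal.ofReal_natCast, sq (N : ℝ≥0∞)]
        · have := hrotc s
          fun_prop

lemma norm_rot_fst_sub_le (s : ℝ) {p : Vec m × Vec m} (hp : p ∈ pairBall m) :
    ‖(rot s p).1 - p.1‖ ≤ 2 * |s| := by
  obtain ⟨hp1, hp2⟩ := norm_le_one_of_mem_pairBall hp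
  have e : (rot s p).1 - p.1 = (Real.cos s - 1) • p.1 + Real.sin s • p.2 := by
    simp only [rot, sub_smul, one_smul]; abel
  have hc : |Real.cos s - 1| ≤ |s| := by simpa using Real.abs_cos_sub_cos_le s 0
  have hs : |Real.sin s| ≤ |s| := Real.abs_sin_le_abs
  rw [e]
  refine (norm_add_le _ _).trans ?_
  rw [norm_smul, norm_smul, Real.norm_eq_abs, Real.norm_eq_abs]
  have h1 : |Real.cos s - 1| * ‖p.1‖ ≤ |s| * 1 := by gcongr
  have h2 : |Real.sin s| * ‖p.2‖ ≤ |s| * 1 := by gcongr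
  linarith

lemma ae_differentiableAt_fst {K : ℝ≥0} {f : Vec m → ℝ} (hf : LipschitzWith K f) :
    ∀ᵐ p ∂(pairMeasure m), DifferentiableAt ℝ f p.1 := by
  refine ae_restrict_of_ae ?_
  exact Measure.quasiMeasurePreserving_fst.ae hf.ae_differentiableAt

lemma measurable_gradient (f : Vec m → ℝ) : Measurable (∇ f) :=
  (LinearIsometryEquiv.continuous _).measurable.comp (measurable_fderiv ℝ f)

lemma norm_gradient_le {K : ℝ≥0} {f : Vec m → ℝ} (hf : LipschitzWith K f) (x : Vec m) :
    ‖∇ f x‖ ≤ K := by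
  rw [gradient, LinearIsometryEquiv.norm_map]
  exact norm_fderiv_le_of_lipschitz ℝ hf

/-- The limit `N → ∞` of the previous bound: the first component of the rotation has velocity `p.2`
at angle `0`, and `f` is differentiable almost everywhere by Rademacher. The Lipschitz bound
dominates the scaled increments. -/
lemma lintegral_sq_neg_sub_le_gradient {K : ℝ≥0} {f : Vec m → ℝ} (hf : LipschitzWith K f) :
    ∫⁻ p, ENNReal.ofReal ((f (-p.1) - f p.1) ^ 2) ∂(pairMeasure m) ≤
      ∫⁻ p, ENNReal.ofReal ((Real.pi * inner ℝ (∇ f p.1) p.2) ^ 2) ∂(pairMeasure m) := by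
  have hrotc : ∀ t : ℝ, Measurable (rot (m := m) t) := fun t => by unfold rot; fun_prop
  have hfm := hf.continuous.measurable
  refine ge_of_tendsto (tendsto_lintegral_of_dominated_convergence
    (F := fun (N : ℕ) (p : Vec m × Vec m) =>
      ENNReal.ofReal ((N * (f (rot (Real.pi / N) p).1 - f p.1)) ^ 2)) (μ := pairMeasure m)
    (fun _ => ENNReal.ofReal ((K * (2 * Real.pi)) ^ 2)) ?_ ?_ ?_ ?_)
    (Filter.eventually_atTop.2 ⟨1, fun N hN => lintegral_sq_neg_sub_le hf.continuous N hN⟩)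
  · intro N
    have := hrotc (Real.pi / N)
    fun_prop
  · intro N
    filter_upwards [ae_mem_pairBall] with p hp
    refine ENNReal.ofReal_le_ofReal ?_
    rw [← sq_abs, abs_mul, Nat.abs_cast]
    refine pow_le_pow_left₀ (by positivity) ?_ 2
    rcases Nat.eq_zero_or_pos N with rfl | hN
    · simp; positivity
    have hN' : (N : ℝ) ≠ 0 := by positivity
    calc N * |f (rot (Real.pi / N) p).1 - f p.1|
        ≤ N * (K * (2 * |Real.pi / N|)) := by
          gcongr
          refine (hf.norm_sub_le _ _).trans ?_
          gcongr
          exact norm_rot_fst_sub_le _ hp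
      _ = K * (2 * Real.pi) := by
          rw [abs_of_nonneg (by positivity)]; field_simp
  · simp only [lintegral_const]
    exact ENNReal.mul_ne_top ENNReal.ofReal_ne_top (measure_ne_top _ _)
  · filter_upwards [ae_differentiableAt_fst hf] with p hp
    refine (ENNReal.continuous_ofReal.tendsto _).comp (Tendsto.pow ?_ 2)
    have hcurve : HasDerivAt (fun t : ℝ => (rot t p).1) p.2 0 := by
      have h := ((Real.hasDerivAt_cos 0).smul_const p.1).add
        ((Real.hasDerivAt_sin 0).smul_const p.2)
      simpa [rot] using! h
    have hp' : HasFDerivAt f (fderiv ℝ f p.1) (rot 0 p).1 := by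
      simpa [rot] using hp.hasFDerivAt
    have hd := (hp'.comp_hasDerivAt (0 : ℝ) hcurve).tendsto_slope_zero_right
    have hN : Tendsto (fun N : ℕ => Real.pi / N) atTop (𝓝[>] 0) := by
      refine tendsto_nhdsWithin_iff.2 ⟨tendsto_const_div_atTop_nhds_zero_nat _, ?_⟩
      filter_upwards [Filter.eventually_gt_atTop 0] with N hN
      exact div_pos Real.pi_pos (by exact_mod_cast hN)
    have hlim := (hd.comp hN).const_mul Real.pi
    rw [gradient, InnerProductSpace.toDual_symm_apply]
    refine hlim.congr' ?_
    filter_upwards [Filter.eventually_gt_atTop 0] with N hN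
    have hN' : (N : ℝ) ≠ 0 := by positivity
    have e0 : (rot 0 p).1 = p.1 := by simp [rot]
    simp only [Function.comp_apply, zero_add, e0, smul_eq_mul]
    field_simp

/-- A quarter turn moves the second component into the first. -/
lemma lintegral_fst_eq_lintegral_snd :
    ∫⁻ p, ENNReal.ofReal (‖p.2‖ ^ 2) ∂(pairMeasure m) =
      ∫⁻ p, ENNReal.ofReal (‖p.1‖ ^ 2) ∂(pairMeasure m) := by
  rw [← (measurePreserving_rot (m := m) (Real.pi / 2)).lintegral_comp (f := fun p =>
      ENNReal.ofReal (‖p.1‖ ^ 2)) (by fun_prop)]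
  simp [rot]

lemma lintegral_fst_ne_top : ∫⁻ p, ENNReal.ofReal (‖p.1‖ ^ 2) ∂(pairMeasure m) ≠ ∞ := by
  refine (lt_of_le_of_lt (lintegral_mono_ae (g := fun _ => 1) ?_) ?_).ne
  · filter_upwards [ae_mem_pairBall] with p hp
    rw [← ENNReal.ofReal_one]
    exact ENNReal.ofReal_le_ofReal (pow_le_one₀ (norm_nonneg _) (norm_le_one_of_mem_pairBall hp).1)
  · simp

lemma lintegral_fst_ne_zero (hm : 0 < m) :
    ∫⁻ p, ENNReal.ofReal (‖p.1‖ ^ 2) ∂(pairMeasure m) ≠ 0 := by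
  have := nontrivial_vec hm
  intro h
  rw [lintegral_eq_zero_iff (by fun_prop)] at h
  have h1 : ∀ᵐ p ∂((volume : Measure (Vec m)).prod (volume : Measure (Vec m))),
      p ∉ {p : Vec m × Vec m | ‖p.1‖ ^ 2 + ‖p.2‖ ^ 2 < 1} := by
    have h2 := (ae_restrict_iff' (measurableSet_pairBall (m := m))).1 h
    have h3 : ∀ᵐ p ∂((volume : Measure (Vec m)).prod (volume : Measure (Vec m))), p.1 ≠ 0 :=
      Measure.quasiMeasurePreserving_fst.ae (measure_eq_zero_iff_ae_notMem.1
        (measure_singleton (0 : Vec m)))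
    filter_upwards [h2, h3] with p hp hp3 hlt
    have := hp (le_of_lt hlt)
    simp at this
    exact hp3 this
  have hopen : IsOpen {p : Vec m × Vec m | ‖p.1‖ ^ 2 + ‖p.2‖ ^ 2 < 1} :=
    isOpen_lt (by fun_prop) continuous_const
  exact hopen.measure_ne_zero _ ⟨(0, 0), by simp⟩ (measure_eq_zero_iff_ae_notMem.2 h1)

/-- The positively homogeneous extension of the restriction of `h` to the unit sphere. -/
noncomputable def homExtension (h : Vec m → ℝ) (x : Vec m) : ℝ := ‖x‖ * h (‖x‖⁻¹ • x)

lemma lipschitzWith_homExtension {L : ℝ≥0} {h : Vec m → ℝ} (hL : LipschitzWith L h)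
    (h0 : h 0 = 0) : LipschitzWith (3 * L) (homExtension h) := by
  have hpol : ∀ x : Vec m, ‖x‖ • ‖x‖⁻¹ • x = x := by
    intro x
    rcases eq_or_ne x 0 with rfl | hx
    · simp
    · rw [smul_smul, mul_inv_cancel₀ (norm_ne_zero_iff.2 hx), one_smul]
  have hun : ∀ x : Vec m, ‖‖x‖⁻¹ • x‖ ≤ 1 := by
    intro x
    rw [norm_smul, norm_inv, norm_norm]
    exact inv_mul_le_one
  refine LipschitzWith.of_dist_le_mul fun x y => ?_
  rw [Real.dist_eq, dist_eq_norm]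
  set a := ‖x‖⁻¹ • x with ha
  set b := ‖y‖⁻¹ • y with hb
  have e : homExtension h x - homExtension h y =
      (‖x‖ - ‖y‖) * h a + ‖y‖ * (h a - h b) := by
    simp only [homExtension, ← ha, ← hb]; ring
  have h1 : |h a| ≤ L := by
    have := hL.norm_sub_le a 0
    rw [h0, sub_zero, sub_zero] at this
    exact this.trans (mul_le_of_le_one_right L.2 (hun x))
  -- Radial projection is not Lipschitz near the origin, but the weight `‖y‖` compensates. This `2`
  -- and the `1` from the change of norm make up the constant `3`.
  have h2 : ‖y‖ * ‖a - b‖ ≤ 2 * ‖x - y‖ := by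
    have : ‖y‖ • (a - b) = (‖y‖ - ‖x‖) • a + (x - y) := by
      rw [smul_sub, sub_smul, hpol x, hpol y]; abel
    calc ‖y‖ * ‖a - b‖ = ‖‖y‖ • (a - b)‖ := by rw [norm_smul, norm_norm]
      _ ≤ |‖y‖ - ‖x‖| * ‖a‖ + ‖x - y‖ := by
          rw [this]
          refine (norm_add_le _ _).trans ?_
          rw [norm_smul, Real.norm_eq_abs]
      _ ≤ ‖x - y‖ * 1 + ‖x - y‖ := by
          gcongr
          · rw [abs_sub_comm]; exact abs_norm_sub_norm_le x y
          · exact hun x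
      _ = _ := by ring
  have h3 : |h a - h b| ≤ L * ‖a - b‖ := hL.norm_sub_le a b
  rw [e]
  calc _ ≤ |‖x‖ - ‖y‖| * |h a| + ‖y‖ * |h a - h b| := by
        refine (abs_add_le _ _).trans ?_
        rw [abs_mul, abs_mul, abs_norm]
    _ ≤ ‖x - y‖ * L + ‖y‖ * (L * ‖a - b‖) := by
        gcongr
        exact abs_norm_sub_norm_le x y
    _ ≤ _ := by
        push_cast
        nlinarith [mul_le_mul_of_nonneg_left h2 L.2]

/-- The inner integral over the second variable depends on `‖x‖` only, so the square of the
homogeneous extension is a radial factor times an angular one. This transfers the second moment from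
the ball to the sphere. -/
lemma lintegral_homExtension_sq (hm : 0 < m) {h : Vec m → ℝ} (hh : Measurable h) :
    ∫⁻ p, ENNReal.ofReal (homExtension h p.1 ^ 2) ∂(pairMeasure m) =
      (∫⁻ u, ENNReal.ofReal (h u ^ 2) ∂(sphereUniform m)) *
        ∫⁻ p, ENNReal.ofReal (‖p.1‖ ^ 2) ∂(pairMeasure m) := by
  have hunit : Measurable fun x : Vec m => ‖x‖⁻¹ • x := by fun_prop
  have hhom : Measurable (homExtension h) := measurable_norm.mul (hh.comp hunit)
  rw [lintegral_pairMeasure _ (by fun_prop), lintegral_pairMeasure _ (by fun_prop)]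
  set V : ℝ → ℝ≥0∞ := fun r => ∫⁻ y : Vec m, discWeight r ‖y‖
  have hjoint : Measurable fun q : ℝ × Vec m => discWeight q.1 ‖q.2‖ :=
    measurable_discWeight.comp (by fun_prop : Measurable fun q : ℝ × Vec m => (q.1, ‖q.2‖))
  have hV : Measurable V := hjoint.lintegral_prod_right'
  have hsec : ∀ r : ℝ, Measurable fun y : Vec m => discWeight r ‖y‖ :=
    fun r => hjoint.comp measurable_prodMk_left
  have e1 : ∀ (F : Vec m → ℝ≥0∞) (x : Vec m),
      ∫⁻ y : Vec m, discWeight ‖x‖ ‖y‖ * F x = V ‖x‖ * F x :=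
    fun F x => lintegral_mul_const _ (hsec _)
  have e2 := lintegral_radial_mul_angular hm (fun r => V r * ENNReal.ofReal (r ^ 2))
    (hV.mul (by fun_prop)) (fun u => ENNReal.ofReal (h u ^ 2)) (by fun_prop)
  calc ∫⁻ x : Vec m, ∫⁻ y : Vec m, discWeight ‖x‖ ‖y‖ * ENNReal.ofReal (homExtension h x ^ 2)
      = ∫⁻ x : Vec m, V ‖x‖ * ENNReal.ofReal (‖x‖ ^ 2) *
          ENNReal.ofReal (h (‖x‖⁻¹ • x) ^ 2) := by
        refine lintegral_congr fun x => ?_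
        rw [e1 fun x => ENNReal.ofReal (homExtension h x ^ 2), homExtension, mul_pow,
          ENNReal.ofReal_mul (sq_nonneg _), mul_assoc]
    _ = _ := e2
    _ = _ := by
        congr 1
        exact lintegral_congr fun x => (e1 (fun x => ENNReal.ofReal (‖x‖ ^ 2)) x).symm

/-- The second moment of an odd `L`-Lipschitz function on the unit sphere of `ℝ^m` is of order
`L² / m`. -/
theorem lintegral_sphereUniform_sq_le (hm : 0 < m) {L : ℝ≥0} {h : Vec m → ℝ}
    (hL : LipschitzWith L h) (hodd : ∀ x, h (-x) = -h x) :
    m * ∫⁻ u, ENNReal.ofReal (h u ^ 2) ∂(sphereUniform m) ≤ ENNReal.ofReal (36 * L ^ 2) := by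
  have h0 : h 0 = 0 := by have := hodd 0; rw [neg_zero] at this; linarith
  set f := homExtension h with hf
  have hfL := lipschitzWith_homExtension hL h0
  have hfodd : ∀ x, f (-x) = -f x := by
    intro x; simp only [hf, homExtension, norm_neg, smul_neg, hodd]; ring
  set I := ∫⁻ p, ENNReal.ofReal (‖p.1‖ ^ 2) ∂(pairMeasure m) with hI
  have hfm := hfL.continuous.measurable
  have h1 := lintegral_sq_neg_sub_le_gradient hfL
  -- Oddness turns the difference into `-2 f`, hence the factor `4`.
  have e1 : ∫⁻ p, ENNReal.ofReal ((f (-p.1) - f p.1) ^ 2) ∂(pairMeasure m) =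
      4 * ((∫⁻ u, ENNReal.ofReal (h u ^ 2) ∂(sphereUniform m)) * I) := by
    rw [← lintegral_homExtension_sq hm hL.continuous.measurable,
      ← lintegral_const_mul _ (by fun_prop)]
    refine lintegral_congr fun p => ?_
    rw [hfodd, show (4 : ℝ≥0∞) = ENNReal.ofReal 4 by simp, ← ENNReal.ofReal_mul (by norm_num)]
    congr 1
    rw [← hf]; ring
  have h2 := lintegral_pairMeasure_inner_sq_le (m := m) (K := Real.pi * (3 * L))
    (fun x => Real.pi • ∇ f x) (by have := measurable_gradient f; fun_prop) (fun x => by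
      rw [norm_smul, Real.norm_of_nonneg Real.pi_pos.le]
      have := norm_gradient_le hfL x
      gcongr
      simpa using this)
  rw [lintegral_fst_eq_lintegral_snd, ← hI] at h2
  simp only [real_inner_smul_left] at h2
  have h3 : 4 * (m * ∫⁻ u, ENNReal.ofReal (h u ^ 2) ∂(sphereUniform m)) * I ≤
      ENNReal.ofReal ((Real.pi * (3 * L)) ^ 2) * I := by
    calc _ = m * (4 * ((∫⁻ u, ENNReal.ofReal (h u ^ 2) ∂(sphereUniform m)) * I)) := by ring
      _ ≤ _ := by
        rw [← e1]
        exact (mul_le_mul_right h1 _).trans h2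
  have h4 := (ENNReal.mul_le_mul_iff_left (lintegral_fst_ne_zero hm)
    lintegral_fst_ne_top).1 h3
  -- The crude bound `π ≤ 4` suffices: `(3π)² ≤ 144 = 4 * 36`.
  have h5 : ENNReal.ofReal ((Real.pi * (3 * L)) ^ 2) ≤ 4 * ENNReal.ofReal (36 * L ^ 2) := by
    rw [show (4 : ℝ≥0∞) = ENNReal.ofReal 4 by simp, ← ENNReal.ofReal_mul (by norm_num)]
    refine ENNReal.ofReal_le_ofReal ?_
    have : Real.pi ^ 2 ≤ 16 := by nlinarith [Real.pi_le_four, Real.pi_pos]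
    nlinarith [sq_nonneg (L : ℝ)]
  exact (ENNReal.mul_le_mul_iff_right (by norm_num) (by norm_num)).1 (h4.trans h5)

end SphericalVariance

/-! ### Weak convexity and its gradient inequality. -/

section WeaklyConvex

variable {m : ℕ} {ψ : Vec m → ℝ} {ρ : ℝ} {M : ℝ≥0}

/-- Weak convexity with modulus `ρ` is encoded as strong convexity with modulus `-ρ`. The form based
at `x` suits difference quotients as `t → 0`. -/
lemma strongConvexOn_apply_add_smul_le {c : ℝ} (h : StrongConvexOn Set.univ c ψ) (x y : Vec m)
    {t : ℝ} (h0 : 0 ≤ t) (h1 : t ≤ 1) :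
    ψ (x + t • (y - x)) ≤ t * ψ y + (1 - t) * ψ x - t * (1 - t) * (c / 2 * ‖y - x‖ ^ 2) := by
  have := h.2 (Set.mem_univ y) (Set.mem_univ x) h0 (sub_nonneg.2 h1) (by ring)
  have e : x + t • (y - x) = t • y + (1 - t) • x := by
    rw [smul_sub, sub_smul, one_smul]; abel
  rw [e]
  simpa [smul_eq_mul] using this

/-- If `(1 - t) a ≤ b` for all `t ∈ (0, 1)`, then `a ≤ b`. -/
lemma le_of_forall_one_sub_mul_le {a b : ℝ} (h : ∀ t : ℝ, 0 < t → t < 1 → (1 - t) * a ≤ b) :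
    a ≤ b := by
  have hl : Tendsto (fun t : ℝ => (1 - t) * a) (𝓝[>] 0) (𝓝 ((1 - 0) * a)) :=
    ((tendsto_const_nhds.sub (tendsto_nhdsWithin_of_tendsto_nhds tendsto_id)).mul_const a)
  rw [sub_zero, one_mul] at hl
  refine le_of_tendsto hl ?_
  filter_upwards [Ioo_mem_nhdsGT zero_lt_one] with t ht using h t ht.1 ht.2

/-- The gradient inequality for weakly convex functions. -/
lemma strongConvexOn_add_inner_gradient_le {c : ℝ} (h : StrongConvexOn Set.univ c ψ)
    {x : Vec m} (hx : DifferentiableAt ℝ ψ x) (y : Vec m) :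
    ψ x + inner ℝ (∇ ψ x) (y - x) + c / 2 * ‖y - x‖ ^ 2 ≤ ψ y := by
  have hline : HasDerivAt (fun t : ℝ => x + t • (y - x)) (y - x) 0 := by
    simpa using ((hasDerivAt_id (0 : ℝ)).smul_const (y - x)).const_add x
  have hx' : HasFDerivAt ψ (fderiv ℝ ψ x) (x + (0 : ℝ) • (y - x)) := by
    simpa using hx.hasFDerivAt
  have hd := (hx'.comp_hasDerivAt (0 : ℝ) hline).tendsto_slope_zero_right
  have hr : Tendsto (fun t : ℝ => ψ y - ψ x - (1 - t) * (c / 2 * ‖y - x‖ ^ 2)) (𝓝[>] 0)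
      (𝓝 (ψ y - ψ x - (1 - 0) * (c / 2 * ‖y - x‖ ^ 2))) :=
    tendsto_const_nhds.sub
      ((tendsto_const_nhds.sub (tendsto_nhdsWithin_of_tendsto_nhds tendsto_id)).mul_const _)
  have hle := le_of_tendsto_of_tendsto hd hr (by
    filter_upwards [Ioc_mem_nhdsGT zero_lt_one] with t ht
    have := strongConvexOn_apply_add_smul_le h x y ht.1.le ht.2
    simp only [Function.comp_apply, zero_add, zero_smul, add_zero, smul_eq_mul]
    rw [inv_mul_le_iff₀ ht.1]
    linarith)
  rw [gradient, InnerProductSpace.toDual_symm_apply]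
  linarith

end WeaklyConvex

/-! ### Averaging over small balls. -/

section Smoothing

variable {m : ℕ}

/-- The uniform distribution on the closed unit ball. -/
noncomputable def ballUniform (m : ℕ) : Measure (Vec m) :=
  ((volume : Measure (Vec m)) (Metric.closedBall 0 1))⁻¹ •
    (volume : Measure (Vec m)).restrict (Metric.closedBall 0 1)

instance : IsProbabilityMeasure (ballUniform m) := by
  refine ⟨?_⟩
  rw [ballUniform, Measure.smul_apply, smul_eq_mul, Measure.restrict_apply_univ]
  exact ENNReal.inv_mul_cancel (Metric.measure_closedBall_pos _ _ one_pos).ne'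
    measure_closedBall_lt_top.ne

lemma ae_ballUniform_of_ae {p : Vec m → Prop} (h : ∀ᵐ b, p b) : ∀ᵐ b ∂(ballUniform m), p b :=
  Measure.ae_smul_measure (ae_restrict_of_ae h) _

lemma ae_norm_ballUniform : ∀ᵐ b ∂(ballUniform m), ‖b‖ ≤ 1 := by
  refine Measure.ae_smul_measure ?_ _
  filter_upwards [ae_restrict_mem (μ := (volume : Measure (Vec m)))
    (Metric.isClosed_closedBall (x := (0 : Vec m)) (ε := 1)).measurableSet] with b hb
  simpa using hb

lemma integral_ballUniform_neg (f : Vec m → ℝ) :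
    ∫ b, f (-b) ∂(ballUniform m) = ∫ b, f b ∂(ballUniform m) := by
  rw [ballUniform, integral_smul_measure, integral_smul_measure]
  congr 1
  have h := (Measure.measurePreserving_neg (volume : Measure (Vec m))).setIntegral_preimage_emb
    (MeasurableEquiv.neg (Vec m)).measurableEmbedding f (Metric.closedBall 0 1)
  rw [← h]
  simp

/-- After normalization the volume of the ball cancels and only the factor `m` remains. -/
lemma integral_ballUniform_lineDeriv (hm : 0 < m) {C : ℝ≥0} {f : Vec m → ℝ}
    (hf : LipschitzWith C f) (v : Vec m) :
    ∫ b, lineDeriv ℝ f b v ∂(ballUniform m) =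
      m * ∫ u, f u * inner ℝ u v ∂(sphereUniform m) := by
  have := nontrivial_vec hm
  have hvol : (volume : Measure (Vec m)) (Metric.closedBall 0 1) =
      (volume : Measure (Vec m)) (Metric.ball 0 1) := by
    rw [Measure.addHaar_closedBall _ _ zero_le_one]; simp
  have hne : (volume : Measure (Vec m)).real (Metric.ball 0 1) ≠ 0 := by
    rw [Measure.real, ENNReal.toReal_ne_zero]
    exact ⟨(Metric.measure_ball_pos _ _ one_pos).ne', measure_ball_lt_top.ne⟩
  rw [ballUniform, integral_smul_measure, integral_closedBall_lineDeriv hm hf, hvol,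
    ENNReal.toReal_inv, smul_eq_mul]
  change ((volume : Measure (Vec m)).real (Metric.ball 0 1))⁻¹ * _ = _
  field_simp

/-- The average of `φ` over the ball of radius `ε`. -/
noncomputable def smoothing (φ : Vec m → ℝ) (ε : ℝ) (x : Vec m) : ℝ :=
  ∫ b, φ (x + ε • b) ∂(ballUniform m)

/-- The average gradient of `φ` over the ball of radius `ε`. -/
noncomputable def smoothingGradient (φ : Vec m → ℝ) (ε : ℝ) (x : Vec m) : Vec m :=
  ∫ b, ∇ φ (x + ε • b) ∂(ballUniform m)

variable {φ ψ : Vec m → ℝ} {M : ℝ≥0} {ρ ε : ℝ}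

/-- Rademacher is applied to the rescaled function `b ↦ φ (x + ε • b)`, and differentiability is
carried back through the inverse affine map. -/
lemma ae_differentiableAt_add_smul (hφ : LipschitzWith M φ) (hε : ε ≠ 0) (x : Vec m) :
    ∀ᵐ b ∂(ballUniform m), DifferentiableAt ℝ φ (x + ε • b) := by
  have haff : LipschitzWith ‖ε‖₊ fun b : Vec m => x + ε • b :=
    LipschitzWith.of_dist_le_mul fun a b => by
      rw [dist_add_left, dist_smul₀]; rfl
  refine ae_ballUniform_of_ae ?_
  filter_upwards [(hφ.comp haff).ae_differentiableAt] with b hb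
  have hinv : DifferentiableAt ℝ (fun y : Vec m => ε⁻¹ • (y - x)) (x + ε • b) := by fun_prop
  have e : ε⁻¹ • (x + ε • b - x) = b := by
    rw [add_sub_cancel_left, smul_smul, inv_mul_cancel₀ hε, one_smul]
  have hb' : DifferentiableAt ℝ (φ ∘ fun b => x + ε • b) (ε⁻¹ • (x + ε • b - x)) := by rwa [e]
  have := hb'.comp (x + ε • b) hinv
  refine this.congr_of_eventuallyEq (Eventually.of_forall fun y => ?_)
  simp only [Function.comp_apply, smul_smul, mul_inv_cancel₀ hε, one_smul]
  rw [add_sub_cancel]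

lemma integrable_gradient_add_smul (hφ : LipschitzWith M φ) (ε : ℝ) (x : Vec m) :
    Integrable (fun b => ∇ φ (x + ε • b)) (ballUniform m) := by
  refine Integrable.of_bound (C := M) ?_ (ae_of_all _ fun b => norm_gradient_le hφ _)
  have := measurable_gradient φ
  exact Measurable.aestronglyMeasurable (by fun_prop)

lemma integrable_add_smul (hφ : LipschitzWith M φ) (ε : ℝ) (x : Vec m) :
    Integrable (fun b => φ (x + ε • b)) (ballUniform m) := by
  refine Integrable.of_bound (C := |φ x| + M * |ε|) ?_ ?_
  · have := hφ.continuous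
    exact Continuous.aestronglyMeasurable (by fun_prop)
  · filter_upwards [ae_norm_ballUniform] with b hb
    have h := hφ.norm_sub_le (x + ε • b) x
    rw [add_sub_cancel_left, norm_smul] at h
    have h2 : (M : ℝ) * (‖ε‖ * ‖b‖) ≤ M * (|ε| * 1) := by
      rw [Real.norm_eq_abs]; gcongr
    have h3 := norm_add_le (φ (x + ε • b) - φ x) (φ x)
    rw [sub_add_cancel] at h3
    rw [Real.norm_eq_abs (φ x)] at h3
    linarith

lemma abs_smoothing_sub_le (hφ : LipschitzWith M φ) (hε : 0 ≤ ε) (x : Vec m) :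
    |smoothing φ ε x - φ x| ≤ M * ε := by
  have e : smoothing φ ε x - φ x = ∫ b, (φ (x + ε • b) - φ x) ∂(ballUniform m) := by
    rw [integral_sub (integrable_add_smul hφ ε x) (integrable_const _)]
    simp [smoothing]
  rw [e, ← Real.norm_eq_abs]
  have h := norm_integral_le_of_norm_le_const (μ := ballUniform m) (C := M * ε)
    (f := fun b => φ (x + ε • b) - φ x) (by
      filter_upwards [ae_norm_ballUniform] with b hb
      have h := hφ.norm_sub_le (x + ε • b) x
      rw [add_sub_cancel_left, norm_smul, Real.norm_of_nonneg hε] at h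
      refine h.trans ?_
      gcongr
      exact mul_le_of_le_one_right hε hb)
  simpa using h

lemma continuous_smoothing (hφ : LipschitzWith M φ) (ε : ℝ) :
    Continuous (smoothing φ ε) := by
  have : LipschitzWith M (smoothing φ ε) := by
    refine LipschitzWith.of_dist_le_mul fun x y => ?_
    rw [dist_eq_norm, smoothing, smoothing,
      ← integral_sub (integrable_add_smul hφ ε x) (integrable_add_smul hφ ε y)]
    have h := norm_integral_le_of_norm_le_const (μ := ballUniform m) (C := M * dist x y)
      (f := fun b => φ (x + ε • b) - φ (y + ε • b)) (ae_of_all _ fun b => by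
        have h := hφ.norm_sub_le (x + ε • b) (y + ε • b)
        rwa [add_sub_add_right_eq_sub, ← dist_eq_norm x y] at h)
    simpa using h
  exact this.continuous

lemma measurable_smoothingGradient (φ : Vec m → ℝ) (ε : ℝ) :
    Measurable (smoothingGradient φ ε) := by
  have h := measurable_gradient φ
  have h2 : StronglyMeasurable fun p : Vec m × Vec m => ∇ φ (p.1 + ε • p.2) :=
    Measurable.stronglyMeasurable (by fun_prop)
  exact h2.integral_prod_right.measurable

/-- Smoothing preserves weak convexity, in the form of the gradient inequality. -/
lemma smoothing_add_inner_le (hψ : LipschitzWith M ψ) (hc : StrongConvexOn Set.univ (-ρ) ψ)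
    (hε : ε ≠ 0) (x y : Vec m) :
    smoothing ψ ε x + inner ℝ (smoothingGradient ψ ε x) (y - x) - ρ / 2 * ‖y - x‖ ^ 2 ≤
      smoothing ψ ε y := by
  have hi1 := integrable_add_smul hψ ε x
  have hi2 := integrable_gradient_add_smul hψ ε x
  have hi3 : Integrable (fun b => (inner ℝ (∇ ψ (x + ε • b)) (y - x) : ℝ)) (ballUniform m) :=
    hi2.inner_const _
  have e : smoothing ψ ε x + inner ℝ (smoothingGradient ψ ε x) (y - x) - ρ / 2 * ‖y - x‖ ^ 2 =
      ∫ b, (ψ (x + ε • b) + inner ℝ (∇ ψ (x + ε • b)) (y - x) - ρ / 2 * ‖y - x‖ ^ 2)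
        ∂(ballUniform m) := by
    have e1 : inner ℝ (smoothingGradient ψ ε x) (y - x) =
        ∫ b, inner ℝ (∇ ψ (x + ε • b)) (y - x) ∂(ballUniform m) := by
      rw [real_inner_comm, smoothingGradient, ← integral_inner hi2]
      simp only [real_inner_comm]
    rw [integral_sub (f := fun b => ψ (x + ε • b) + inner ℝ (∇ ψ (x + ε • b)) (y - x))
      (hi1.add hi3) (integrable_const _), integral_add hi1 hi3, e1]
    simp [smoothing]
  rw [e]
  refine integral_mono_ae ((hi1.add hi3).sub (integrable_const _)) (integrable_add_smul hψ ε y) ?_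
  -- Both points are shifted by the same `ε • b`, so the gradient inequality keeps the increment `y
  -- - x` and can be averaged over `b`.
  filter_upwards [ae_differentiableAt_add_smul hψ hε x] with b hb
  have := strongConvexOn_add_inner_gradient_le hc hb (y + ε • b)
  rw [add_sub_add_right_eq_sub] at this
  linarith

/-- The smoothed gradient is an approximate subgradient of `ψ` itself: passing between `ψ` and its
average costs `M * ε` at each of the two points. Both proximal arguments below rest on this. -/
lemma add_inner_smoothingGradient_le (hψ : LipschitzWith M ψ)
    (hc : StrongConvexOn Set.univ (-ρ) ψ) (hε : 0 < ε) (x y : Vec m) :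
    ψ x + inner ℝ (smoothingGradient ψ ε x) (y - x) - ρ / 2 * ‖y - x‖ ^ 2 - 2 * M * ε ≤ ψ y := by
  have h := smoothing_add_inner_le hψ hc hε.ne' x y
  have h1 := (abs_le.1 (abs_smoothing_sub_le hψ hε.le x)).1
  have h2 := (abs_le.1 (abs_smoothing_sub_le hψ hε.le y)).2
  linarith

lemma gradient_neg' (φ : Vec m → ℝ) (x : Vec m) : ∇ (-φ) x = -∇ φ x := by
  simp only [gradient, fderiv_neg, map_neg]

lemma smoothing_neg (φ : Vec m → ℝ) (ε : ℝ) (x : Vec m) :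
    smoothing (-φ) ε x = -smoothing φ ε x := by
  simp [smoothing, integral_neg]

lemma smoothingGradient_neg (φ : Vec m → ℝ) (ε : ℝ) (x : Vec m) :
    smoothingGradient (-φ) ε x = -smoothingGradient φ ε x := by
  simp [smoothingGradient, gradient_neg', integral_neg]

end Smoothing

/-! ### Bias, second moment and one-step decrease of the two-point estimator. -/

section Estimator

variable {m : ℕ} {φ A : Vec m → ℝ} {M : ℝ≥0} {ε w : ℝ}

lemma lipschitzWith_centralDifference (hφ : LipschitzWith M φ) (ε : ℝ) (x : Vec m) :
    LipschitzWith (2 * M * ‖ε‖₊) fun u : Vec m => φ (x + ε • u) - φ (x - ε • u) := by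
  have h1 : LipschitzWith ‖ε‖₊ fun b : Vec m => x + ε • b :=
    LipschitzWith.of_dist_le_mul fun a b => by
      rw [dist_add_left, dist_smul₀]; rfl
  have h2 : LipschitzWith ‖ε‖₊ fun b : Vec m => x - ε • b :=
    LipschitzWith.of_dist_le_mul fun a b => by
      rw [dist_sub_left, dist_smul₀]; rfl
  have := (hφ.comp h1).sub (hφ.comp h2)
  rwa [show 2 * M * ‖ε‖₊ = M * ‖ε‖₊ + M * ‖ε‖₊ by ring]

/-- The exact two-point estimator is unbiased for the gradient of the smoothing. -/
lemma integral_centralDifference_mul_inner (hm : 0 < m) (hφ : LipschitzWith M φ) (hε : 0 < ε)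
    (x v : Vec m) :
    m * ∫ u, (φ (x + ε • u) - φ (x - ε • u)) * inner ℝ u v ∂(sphereUniform m) =
      2 * ε * inner ℝ (smoothingGradient φ ε x) v := by
  rw [← integral_ballUniform_lineDeriv hm (lipschitzWith_centralDifference hφ ε x) v]
  have hi := integrable_gradient_add_smul hφ ε x
  have hi' := integrable_gradient_add_smul hφ (-ε) x
  have e1 : inner ℝ (smoothingGradient φ ε x) v =
      ∫ b, inner ℝ (∇ φ (x + ε • b)) v ∂(ballUniform m) := by
    rw [real_inner_comm, smoothingGradient, ← integral_inner hi]
    simp only [real_inner_comm]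
  have e2 : ∫ b, inner ℝ (∇ φ (x + (-ε) • b)) v ∂(ballUniform m) =
      ∫ b, inner ℝ (∇ φ (x + ε • b)) v ∂(ballUniform m) := by
    rw [← integral_ballUniform_neg fun b => inner ℝ (∇ φ (x + ε • b)) v]
    simp only [smul_neg, neg_smul]
  -- The two halves of the central difference contribute the gradients at `x + ε • b` and `x - ε •
  -- b`, which have equal averages by symmetry of the ball.
  have e3 : ∫ b, lineDeriv ℝ (fun u => φ (x + ε • u) - φ (x - ε • u)) b v ∂(ballUniform m) =
      ∫ b, (ε * inner ℝ (∇ φ (x + ε • b)) v + ε * inner ℝ (∇ φ (x + (-ε) • b)) v)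
        ∂(ballUniform m) := by
    refine integral_congr_ae ?_
    filter_upwards [ae_differentiableAt_add_smul hφ hε.ne' x,
      ae_differentiableAt_add_smul hφ (neg_ne_zero.2 hε.ne') x] with b h1 h2
    have hl1 : HasDerivAt (fun t : ℝ => x + ε • (b + t • v)) (ε • v) 0 := by
      simpa using ((((hasDerivAt_id (0 : ℝ)).smul_const v).const_add b).const_smul ε).const_add x
    have hl2 : HasDerivAt (fun t : ℝ => x + (-ε) • (b + t • v)) ((-ε) • v) 0 := by
      simpa using
        ((((hasDerivAt_id (0 : ℝ)).smul_const v).const_add b).const_smul (-ε)).const_add x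
    have h1' : HasFDerivAt φ (fderiv ℝ φ (x + ε • b)) (x + ε • (b + (0 : ℝ) • v)) := by
      simpa using h1.hasFDerivAt
    have h2' : HasFDerivAt φ (fderiv ℝ φ (x + (-ε) • b)) (x + (-ε) • (b + (0 : ℝ) • v)) := by
      simpa using h2.hasFDerivAt
    have hd := (h1'.comp_hasDerivAt (0 : ℝ) hl1).sub (h2'.comp_hasDerivAt (0 : ℝ) hl2)
    have hd' := hd.deriv
    have e4 : (φ ∘ fun t : ℝ => x + ε • (b + t • v)) - (φ ∘ fun t : ℝ => x + (-ε) • (b + t • v)) =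
        fun t : ℝ => φ (x + ε • (b + t • v)) - φ (x - ε • (b + t • v)) := by
      funext t
      simp only [Pi.sub_apply, Function.comp_apply, neg_smul, ← sub_eq_add_neg]
    rw [e4] at hd'
    rw [lineDeriv, hd', gradient, InnerProductSpace.toDual_symm_apply, gradient,
      InnerProductSpace.toDual_symm_apply, map_smul, map_smul, smul_eq_mul, smul_eq_mul]
    ring
  have hi3 : Integrable (fun b => (inner ℝ (∇ φ (x + ε • b)) v : ℝ)) (ballUniform m) :=
    hi.inner_const _
  have hi4 : Integrable (fun b => (inner ℝ (∇ φ (x + (-ε) • b)) v : ℝ)) (ballUniform m) :=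
    hi'.inner_const _
  rw [e3, integral_add (hi3.const_mul ε) (hi4.const_mul ε), integral_const_mul,
    integral_const_mul, e2, e1]
  ring

lemma measurable_estimator (hA : Measurable A) (ε : ℝ) :
    Measurable fun p : Vec m × Vec m => estimator A ε p.1 p.2 := by
  unfold estimator
  fun_prop

lemma norm_estimator_sub_le (hε : 0 < ε) (hA : ∀ x, |A x - φ x| ≤ w) (x u : Vec m)
    (hu : ‖u‖ = 1) : ‖estimator A ε x u - estimator φ ε x u‖ ≤ m * w / ε := by
  unfold estimator
  rw [← sub_smul, ← mul_sub, norm_smul, hu, mul_one, norm_mul,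
    Real.norm_of_nonneg (by positivity), Real.norm_eq_abs]
  have h1 := abs_le.1 (hA (x + ε • u))
  have h2 := abs_le.1 (hA (x - ε • u))
  have h3 : |A (x + ε • u) - A (x - ε • u) - (φ (x + ε • u) - φ (x - ε • u))| ≤ 2 * w :=
    abs_le.2 ⟨by linarith [h1.1, h2.2], by linarith [h1.2, h2.1]⟩
  calc _ ≤ (m : ℝ) / (2 * ε) * (2 * w) := by gcongr
    _ = _ := by field_simp

lemma norm_estimator_exact_le (hφ : LipschitzWith M φ) (hε : 0 < ε) (x u : Vec m)
    (hu : ‖u‖ = 1) : ‖estimator φ ε x u‖ ≤ m * M := by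
  unfold estimator
  rw [norm_smul, hu, mul_one, norm_mul,
    Real.norm_of_nonneg (show 0 ≤ (m : ℝ) / (2 * ε) by positivity)]
  have h := hφ.norm_sub_le (x + ε • u) (x - ε • u)
  have e : x + ε • u - (x - ε • u) = (2 * ε) • u := by
    rw [mul_smul, two_smul]; abel
  rw [e, norm_smul, hu, mul_one, Real.norm_of_nonneg (show 0 ≤ 2 * ε by positivity)] at h
  calc _ ≤ (m : ℝ) / (2 * ε) * (M * (2 * ε)) := by gcongr
    _ = _ := by field_simp

lemma norm_estimator_le (hφ : LipschitzWith M φ) (hε : 0 < ε) (hA : ∀ x, |A x - φ x| ≤ w)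
    (x u : Vec m) (hu : ‖u‖ = 1) : ‖estimator A ε x u‖ ≤ m * M + m * w / ε := by
  have h1 := norm_estimator_exact_le hφ hε x u hu
  have h2 := norm_estimator_sub_le hε hA x u hu
  have h3 := norm_add_le (estimator A ε x u - estimator φ ε x u) (estimator φ ε x u)
  rw [sub_add_cancel] at h3
  linarith

lemma integrable_estimator (hm : 0 < m) (hφ : LipschitzWith M φ) (hε : 0 < ε)
    (hAm : Measurable A) (hA : ∀ x, |A x - φ x| ≤ w) (x : Vec m) :
    Integrable (fun u => estimator A ε x u) (sphereUniform m) := by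
  have := isProbabilityMeasure_sphereUniform hm
  refine Integrable.of_bound (C := m * M + m * w / ε) ?_ ?_
  · exact ((measurable_estimator hAm ε).comp measurable_prodMk_left).aestronglyMeasurable
  · filter_upwards [ae_norm_sphereUniform] with u hu using norm_estimator_le hφ hε hA x u hu

/-- The exact estimator is unbiased, so the whole bias comes from replacing `φ` by `A`: an error of
at most `2 * w` in the difference, multiplied by `m / (2 * ε)`. -/
lemma norm_integral_estimator_sub_le (hm : 0 < m) (hφ : LipschitzWith M φ) (hε : 0 < ε)
    (hAm : Measurable A) (hA : ∀ x, |A x - φ x| ≤ w) (x : Vec m) :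
    ‖(∫ u, estimator A ε x u ∂(sphereUniform m)) - smoothingGradient φ ε x‖ ≤ m * w / ε := by
  have := isProbabilityMeasure_sphereUniform hm
  have hi := integrable_estimator hm hφ hε hAm hA x
  have hw : 0 ≤ w := (abs_nonneg _).trans (hA x)
  have hi' := integrable_estimator (w := 0) hm hφ hε hφ.continuous.measurable (by simp) x
  have e : smoothingGradient φ ε x = ∫ u, estimator φ ε x u ∂(sphereUniform m) := by
    refine ext_inner_right ℝ fun v => ?_
    have h := integral_centralDifference_mul_inner hm hφ hε x v
    rw [real_inner_comm v (∫ u, _ ∂_), ← integral_inner hi']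
    have e1 : ∀ u : Vec m, inner ℝ v (estimator φ ε x u) =
        (m : ℝ) / (2 * ε) * ((φ (x + ε • u) - φ (x - ε • u)) * inner ℝ u v) := by
      intro u
      rw [estimator, real_inner_smul_right, real_inner_comm, mul_assoc]
    simp only [e1]
    rw [integral_const_mul, div_mul_eq_mul_div, h]
    field_simp
  rw [e, ← integral_sub hi hi']
  have h := norm_integral_le_of_norm_le_const (μ := sphereUniform m) (C := m * w / ε)
    (f := fun u => estimator A ε x u - estimator φ ε x u) (by
      filter_upwards [ae_norm_sphereUniform] with u hu using norm_estimator_sub_le hε hA x u hu)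
  simpa using h

/-- The pointwise bound on the exact estimator would give `m²`. As a function of `u` the exact
central difference is odd and `2Mε`-Lipschitz, so its second moment on the sphere is at most `144 (M
ε)² / m`; with the prefactor `2 (m / (2ε))²` this is `72 m M²`. -/
lemma integral_norm_estimator_sq_le (hm : 0 < m) (hφ : LipschitzWith M φ) (hε : 0 < ε)
    (hA : ∀ x, |A x - φ x| ≤ w) (x : Vec m) :
    ∫ u, ‖estimator A ε x u‖ ^ 2 ∂(sphereUniform m) ≤
      72 * m * (M : ℝ) ^ 2 + 2 * (m * w / ε) ^ 2 := by
  have := isProbabilityMeasure_sphereUniform hm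
  set h : Vec m → ℝ := fun u => φ (x + ε • u) - φ (x - ε • u) with hh
  have hL := lipschitzWith_centralDifference hφ ε x
  have hvar := lintegral_sphereUniform_sq_le hm hL (fun u => by
    simp only [smul_neg, sub_neg_eq_add, ← sub_eq_add_neg]; ring)
  have hL2 : (36 : ℝ) * ((2 * M * ‖ε‖₊ : ℝ≥0) : ℝ) ^ 2 = 144 * (M * ε) ^ 2 := by
    push_cast
    rw [Real.norm_of_nonneg hε.le]; ring
  rw [hL2] at hvar
  have hint : Integrable (fun u => h u ^ 2) (sphereUniform m) := by
    refine Integrable.of_bound (C := (M * (2 * ε)) ^ 2)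
      (hL.continuous.pow 2).aestronglyMeasurable ?_
    filter_upwards [ae_norm_sphereUniform] with u hu
    rw [norm_pow]
    refine pow_le_pow_left₀ (norm_nonneg _) ?_ 2
    have h' := hφ.norm_sub_le (x + ε • u) (x - ε • u)
    have e : x + ε • u - (x - ε • u) = (2 * ε) • u := by
      rw [mul_smul, two_smul]; abel
    rwa [e, norm_smul, hu, mul_one, Real.norm_of_nonneg (show 0 ≤ 2 * ε by positivity)] at h'
  have hvar' : m * ∫ u, h u ^ 2 ∂(sphereUniform m) ≤ 144 * (M * ε) ^ 2 := by
    rw [← ofReal_integral_eq_lintegral_ofReal hint (ae_of_all _ fun u => sq_nonneg _),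
      ← ENNReal.ofReal_natCast, ← ENNReal.ofReal_mul (Nat.cast_nonneg m)] at hvar
    exact (ENNReal.ofReal_le_ofReal_iff (by positivity)).1 hvar
  have hm' : (0 : ℝ) < m := by exact_mod_cast hm
  calc ∫ u, ‖estimator A ε x u‖ ^ 2 ∂(sphereUniform m)
      ≤ ∫ u, (2 * ((m : ℝ) / (2 * ε)) ^ 2 * h u ^ 2 + 2 * (m * w / ε) ^ 2)
          ∂(sphereUniform m) := by
        refine integral_mono_of_nonneg (ae_of_all _ fun u => by positivity)
          ((hint.const_mul _).add (integrable_const _)) ?_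
        filter_upwards [ae_norm_sphereUniform] with u hu
        have h2 := norm_estimator_sub_le hε hA x u hu
        have h3 := norm_add_le (estimator φ ε x u) (estimator A ε x u - estimator φ ε x u)
        rw [add_sub_cancel] at h3
        have h1 : ‖estimator φ ε x u‖ ^ 2 = ((m : ℝ) / (2 * ε)) ^ 2 * h u ^ 2 := by
          rw [estimator, norm_smul, hu, mul_one, Real.norm_eq_abs, sq_abs, mul_pow]
        have h5 : ‖estimator A ε x u‖ ^ 2 ≤ (‖estimator φ ε x u‖ + m * w / ε) ^ 2 :=
          pow_le_pow_left₀ (norm_nonneg _) (by linarith) 2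
        nlinarith [sq_nonneg (‖estimator φ ε x u‖ - m * w / ε)]
    _ = 2 * ((m : ℝ) / (2 * ε)) ^ 2 * ∫ u, h u ^ 2 ∂(sphereUniform m) + 2 * (m * w / ε) ^ 2 := by
        rw [integral_add (hint.const_mul _) (integrable_const _), integral_const_mul]
        simp
    _ = (m : ℝ) / (2 * ε ^ 2) * (m * ∫ u, h u ^ 2 ∂(sphereUniform m)) +
          2 * (m * w / ε) ^ 2 := by
        congr 1; field_simp
    _ ≤ (m : ℝ) / (2 * ε ^ 2) * (144 * (M * ε) ^ 2) + 2 * (m * w / ε) ^ 2 := by gcongr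
    _ = _ := by field_simp; ring

/-- The expected decrease of a function with a quadratic upper model in one step. -/
lemma integral_step_le (hm : 0 < m) (hφ : LipschitzWith M φ) (hε : 0 < ε)
    (hAm : Measurable A) (hA : ∀ x, |A x - φ x| ≤ w) {V : Vec m → ℝ} (hV : Continuous V)
    {c η : ℝ} (hc : 0 ≤ c) (hη : 0 ≤ η) (x d : Vec m)
    (hmodel : ∀ y, V y ≤ V x + inner ℝ d (y - x) + c / 2 * ‖y - x‖ ^ 2) :
    Integrable (fun u => V (x - η • estimator A ε x u)) (sphereUniform m) ∧
    ∫ u, V (x - η • estimator A ε x u) ∂(sphereUniform m) ≤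
      V x - η * inner ℝ d (smoothingGradient φ ε x) + η * (m * w / ε) * ‖d‖ +
        c * η ^ 2 / 2 * (72 * m * (M : ℝ) ^ 2 + 2 * (m * w / ε) ^ 2) := by
  have := isProbabilityMeasure_sphereUniform hm
  have hi := integrable_estimator hm hφ hε hAm hA x
  have hGm : Measurable fun u : Vec m => estimator A ε x u :=
    (measurable_estimator hAm ε).comp measurable_prodMk_left
  have hbound := norm_estimator_le hφ hε hA x
  set B := m * M + m * w / ε
  have hint : Integrable (fun u => V (x - η • estimator A ε x u)) (sphereUniform m) := by
    -- The step has length at most `η * B`, so only values of `V` on a compact ball occur.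
    obtain ⟨K, hK⟩ := (isCompact_closedBall x (η * B)).exists_bound_of_continuousOn
      hV.continuousOn
    refine Integrable.of_bound (C := K) ?_ ?_
    · exact (hV.measurable.comp (by fun_prop)).aestronglyMeasurable
    · filter_upwards [ae_norm_sphereUniform] with u hu
      refine hK _ ?_
      rw [Metric.mem_closedBall, dist_eq_norm, sub_sub_cancel_left, norm_neg, norm_smul,
        Real.norm_of_nonneg hη]
      exact mul_le_mul_of_nonneg_left (hbound u hu) hη
  have hisq : Integrable (fun u => ‖estimator A ε x u‖ ^ 2) (sphereUniform m) := by
    refine Integrable.of_bound (C := B ^ 2) (hGm.norm.pow_const 2).aestronglyMeasurable ?_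
    filter_upwards [ae_norm_sphereUniform] with u hu
    rw [norm_pow, norm_norm]
    exact pow_le_pow_left₀ (norm_nonneg _) (hbound u hu) 2
  have hiin : Integrable (fun u => (inner ℝ d (estimator A ε x u) : ℝ)) (sphereUniform m) :=
    hi.const_inner d
  refine ⟨hint, ?_⟩
  have hsq := integral_norm_estimator_sq_le hm hφ hε hA x
  have hbias := norm_integral_estimator_sub_le hm hφ hε hAm hA x
  set G := ∫ u, estimator A ε x u ∂(sphereUniform m)
  have hin : -(inner ℝ d G : ℝ) ≤
      -inner ℝ d (smoothingGradient φ ε x) + (m * w / ε) * ‖d‖ := by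
    have h1 := (abs_le.1 (abs_real_inner_le_norm d (G - smoothingGradient φ ε x))).1
    have h2 : ‖d‖ * ‖G - smoothingGradient φ ε x‖ ≤ ‖d‖ * (m * w / ε) := by gcongr
    rw [inner_sub_right] at h1
    linarith
  calc ∫ u, V (x - η • estimator A ε x u) ∂(sphereUniform m)
      ≤ ∫ u, (V x - η * inner ℝ d (estimator A ε x u) +
          c * η ^ 2 / 2 * ‖estimator A ε x u‖ ^ 2) ∂(sphereUniform m) := by
        refine integral_mono hint
          (((integrable_const _).sub (hiin.const_mul η)).add (hisq.const_mul _)) fun u => ?_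
        refine (hmodel _).trans (le_of_eq ?_)
        rw [sub_sub_cancel_left, inner_neg_right, real_inner_smul_right, norm_neg, norm_smul,
          mul_pow, Real.norm_eq_abs, sq_abs]
        ring
    _ = V x - η * inner ℝ d G +
          c * η ^ 2 / 2 * ∫ u, ‖estimator A ε x u‖ ^ 2 ∂(sphereUniform m) := by
        rw [integral_add (f := fun u => V x - η * inner ℝ d (estimator A ε x u))
          ((integrable_const _).sub (hiin.const_mul η)) (hisq.const_mul _),
          integral_sub (integrable_const _) (hiin.const_mul η), integral_const_mul,
          integral_const_mul, integral_inner hi]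
        simp [G]
    _ ≤ V x + η * (-inner ℝ d (smoothingGradient φ ε x) + (m * w / ε) * ‖d‖) +
          c * η ^ 2 / 2 * (72 * m * (M : ℝ) ^ 2 + 2 * (m * w / ε) ^ 2) := by
        have h1 := mul_le_mul_of_nonneg_left hin hη
        have h2 := mul_le_mul_of_nonneg_left hsq (by positivity : 0 ≤ c * η ^ 2 / 2)
        linarith
    _ = _ := by ring

end Estimator

/-! ### Proximal points and the gradient of the Moreau envelope. -/

section Proximal

variable {m : ℕ} {ψ : Vec m → ℝ} {M : ℝ≥0} {ρ γ : ℝ}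

/-- A Lipschitz function plus a positive multiple of the squared distance has a minimizer. -/
lemma exists_forall_add_sq_le (hψ : LipschitzWith M ψ) {c : ℝ} (hc : 0 < c) (x : Vec m) :
    ∃ z, ∀ y, ψ z + c * ‖x - z‖ ^ 2 ≤ ψ y + c * ‖x - y‖ ^ 2 := by
  have hcont : Continuous fun y => ψ y + c * ‖x - y‖ ^ 2 := by
    have := hψ.continuous
    fun_prop
  -- Beyond distance `M / c` from `x` the quadratic term exceeds any decrease that the Lipschitz
  -- bound allows, so the minimum over this ball is global.
  obtain ⟨z, -, hz⟩ := (isCompact_closedBall x (M / c)).exists_isMinOn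
    ⟨x, Metric.mem_closedBall_self (by positivity)⟩ hcont.continuousOn
  refine ⟨z, fun y => ?_⟩
  by_cases hy : y ∈ Metric.closedBall x (M / c)
  · exact hz hy
  · have h1 : ψ z + c * ‖x - z‖ ^ 2 ≤ ψ x := by
      simpa using hz (Metric.mem_closedBall_self (by positivity) : x ∈ Metric.closedBall x (M / c))
    rw [Metric.mem_closedBall, not_le, dist_comm, dist_eq_norm, div_lt_iff₀ hc] at hy
    have h2 : |ψ x - ψ y| ≤ M * ‖x - y‖ := hψ.norm_sub_le x y
    have h3 := (abs_le.1 h2).2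
    nlinarith [norm_nonneg (x - y)]

/-- Quadratic growth around the minimizer of a weakly convex function plus a quadratic. -/
lemma add_sq_growth (hc : StrongConvexOn Set.univ (-ρ) ψ) {c : ℝ} {x z : Vec m}
    (hz : ∀ y, ψ z + c / 2 * ‖x - z‖ ^ 2 ≤ ψ y + c / 2 * ‖x - y‖ ^ 2) (y : Vec m) :
    ψ z + c / 2 * ‖x - z‖ ^ 2 + (c - ρ) / 2 * ‖y - z‖ ^ 2 ≤ ψ y + c / 2 * ‖x - y‖ ^ 2 := by
  suffices h : (c - ρ) / 2 * ‖y - z‖ ^ 2 ≤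
      ψ y + c / 2 * ‖x - y‖ ^ 2 - (ψ z + c / 2 * ‖x - z‖ ^ 2) by linarith
  -- Minimality is tested at `z + t • (y - z)`; after division by `t` the growth term carries a
  -- factor `1 - t`, which disappears as `t → 0`.
  refine le_of_forall_one_sub_mul_le fun t ht0 ht1 => ?_
  have h1 := strongConvexOn_apply_add_smul_le hc z y ht0.le ht1.le
  have h2 := hz (z + t • (y - z))
  have e : ‖x - (z + t • (y - z))‖ ^ 2 =
      t * ‖x - y‖ ^ 2 + (1 - t) * ‖x - z‖ ^ 2 - t * (1 - t) * ‖y - z‖ ^ 2 := by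
    have e1 : x - (z + t • (y - z)) = (x - z) - t • (y - z) := by abel
    have e2 : x - y = (x - z) - (y - z) := by abel
    rw [e1, e2, norm_sub_sq_real (x - z) (t • (y - z)), norm_sub_sq_real (x - z) (y - z), real_inner_smul_right, norm_smul,
      Real.norm_of_nonneg ht0.le]
    ring
  rw [e] at h2
  refine le_of_mul_le_mul_left ?_ ht0
  nlinarith

/-- Differentiability from a two-sided quadratic bound on the first-order remainder. -/
lemma hasGradientAt_of_abs_sub_le {V : Vec m → ℝ} {x d : Vec m} {K : ℝ}
    (h : ∀ y, |V y - V x - inner ℝ d (y - x)| ≤ K * ‖y - x‖ ^ 2) : HasGradientAt V d x := by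
  rw [hasGradientAt_iff_hasFDerivAt, hasFDerivAt_iff_isLittleO]
  have hO : (fun y => V y - V x - (InnerProductSpace.toDual ℝ (Vec m) d) (y - x))
      =O[𝓝 x] fun y => ‖y - x‖ ^ 2 := by
    refine Asymptotics.IsBigO.of_bound K (Eventually.of_forall fun y => ?_)
    rw [InnerProductSpace.toDual_apply_apply, Real.norm_eq_abs, norm_pow, norm_norm]
    exact h y
  refine hO.trans_isLittleO ?_
  exact Asymptotics.isLittleO_pow_sub_sub x one_lt_two

/-- The proximal point of a Lipschitz weakly convex function: it attains the Moreau envelope,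
depends continuously on the base point, and gives the gradient of the envelope. -/
theorem exists_prox (hψ : LipschitzWith M ψ) (hc : StrongConvexOn Set.univ (-ρ) ψ)
    (hγ : 0 < γ) (hγρ : γ * ρ < 1) :
    ∃ p : Vec m → Vec m, Continuous p ∧
      (∀ x, moreau γ ψ x = ψ (p x) + 1 / (2 * γ) * ‖x - p x‖ ^ 2) ∧
      (∀ x y, moreau γ ψ x ≤ ψ y + 1 / (2 * γ) * ‖x - y‖ ^ 2) ∧
      ∀ x, HasGradientAt (moreau γ ψ) (γ⁻¹ • (x - p x)) x := by
  have hc' : (0 : ℝ) < 1 / (2 * γ) := by positivity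
  choose p hp using fun x => exists_forall_add_sq_le hψ hc' x
  have hbdd : ∀ x, BddBelow (Set.range fun z : Vec m => ψ z + 1 / (2 * γ) * ‖x - z‖ ^ 2) :=
    fun x => ⟨_, Set.forall_mem_range.2 (hp x)⟩
  have hle : ∀ x y, moreau γ ψ x ≤ ψ y + 1 / (2 * γ) * ‖x - y‖ ^ 2 :=
    fun x y => ciInf_le (hbdd x) y
  have heq : ∀ x, moreau γ ψ x = ψ (p x) + 1 / (2 * γ) * ‖x - p x‖ ^ 2 :=
    fun x => le_antisymm (hle x _) (le_ciInf (hp x))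
  have hμ : 0 < γ⁻¹ - ρ := by
    rw [sub_pos, ← one_div, lt_div_iff₀ hγ]; linarith
  have hhalf : 1 / (2 * γ) = γ⁻¹ / 2 := by field_simp
  have hgrow : ∀ x y, ψ (p x) + γ⁻¹ / 2 * ‖x - p x‖ ^ 2 + (γ⁻¹ - ρ) / 2 * ‖y - p x‖ ^ 2 ≤
      ψ y + γ⁻¹ / 2 * ‖x - y‖ ^ 2 := by
    intro x y
    refine add_sq_growth hc (fun y => ?_) y
    have := hp x y
    rwa [hhalf] at this
  -- Quadratic growth at each of the two proximal points, tested at the other, is added up; the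
  -- values of `ψ` cancel.
  have hlip : ∀ x y, ‖p x - p y‖ ≤ (γ * (γ⁻¹ - ρ))⁻¹ * ‖x - y‖ := by
    intro x y
    have h1 := hgrow x (p y)
    have h2 := hgrow y (p x)
    rw [norm_sub_rev (p y) (p x)] at h1
    have e : ‖x - p y‖ ^ 2 - ‖x - p x‖ ^ 2 + ‖y - p x‖ ^ 2 - ‖y - p y‖ ^ 2 =
        2 * inner ℝ (x - y) (p x - p y) := by
      rw [norm_sub_sq_real, norm_sub_sq_real, norm_sub_sq_real, norm_sub_sq_real,
        inner_sub_left, inner_sub_right, inner_sub_right]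
      ring
    have h3 : (γ⁻¹ - ρ) * ‖p x - p y‖ ^ 2 ≤ γ⁻¹ * inner ℝ (x - y) (p x - p y) := by
      have : γ⁻¹ / 2 * (‖x - p y‖ ^ 2 - ‖x - p x‖ ^ 2 + ‖y - p x‖ ^ 2 - ‖y - p y‖ ^ 2) =
        γ⁻¹ * inner ℝ (x - y) (p x - p y) := by rw [e]; ring
      linarith
    have h4 := real_inner_le_norm (x - y) (p x - p y)
    rcases (norm_nonneg (p x - p y)).eq_or_lt with h0 | h0
    · rw [← h0]; positivity
    · have h5 : (γ⁻¹ - ρ) * ‖p x - p y‖ ≤ γ⁻¹ * ‖x - y‖ := by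
        refine le_of_mul_le_mul_right ?_ h0
        have := mul_le_mul_of_nonneg_left h4 (inv_pos.2 hγ).le
        nlinarith
      rw [← div_eq_inv_mul, le_div_iff₀ (by positivity)]
      have := mul_le_mul_of_nonneg_left h5 hγ.le
      rw [← mul_assoc γ γ⁻¹, mul_inv_cancel₀ hγ.ne', one_mul] at this
      linarith
  set κ := (γ * (γ⁻¹ - ρ))⁻¹ with hκ
  have hκ0 : 0 ≤ κ := by positivity
  have hpc : Continuous p := by
    have : LipschitzWith ⟨κ, hκ0⟩ p := LipschitzWith.of_dist_le_mul fun x y => by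
      rw [dist_eq_norm, dist_eq_norm]; exact hlip x y
    exact this.continuous
  -- The point `p x` is a competitor in the infimum at `y`.
  have hup : ∀ x y, moreau γ ψ y ≤ moreau γ ψ x + inner ℝ (γ⁻¹ • (x - p x)) (y - x) +
      γ⁻¹ / 2 * ‖y - x‖ ^ 2 := by
    intro x y
    have h1 := hle y (p x)
    rw [heq x]
    have e : y - p x = (x - p x) + (y - x) := by abel
    rw [e, norm_add_sq_real] at h1
    rw [real_inner_smul_left]
    rw [hhalf] at h1 ⊢
    linarith
  refine ⟨p, hpc, heq, hle, fun x => ?_⟩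
  -- The upper estimate is `hup`. The lower one is `hup` with the two points exchanged, where moving
  -- the gradient from `y` to `x` costs `γ⁻¹ * (1 + κ)` by the Lipschitz bound on `p`.
  refine hasGradientAt_of_abs_sub_le (K := γ⁻¹ / 2 + γ⁻¹ * (1 + κ)) fun y => abs_le.2 ⟨?_, ?_⟩
  · have h1 := hup y x
    have e : inner ℝ (γ⁻¹ • (y - p y)) (x - y) = -inner ℝ (γ⁻¹ • (x - p x)) (y - x) -
        γ⁻¹ * inner ℝ ((y - x) - (p y - p x)) (y - x) := by
      rw [real_inner_smul_left, real_inner_smul_left, ← neg_sub y x, inner_neg_right]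
      have : y - p y = (x - p x) + ((y - x) - (p y - p x)) := by abel
      rw [this, inner_add_left]; ring
    have h2 : |inner ℝ ((y - x) - (p y - p x)) (y - x)| ≤ (1 + κ) * ‖y - x‖ ^ 2 := by
      refine (abs_real_inner_le_norm _ _).trans ?_
      have h3 := norm_sub_le (y - x) (p y - p x)
      have h4 := hlip y x
      nlinarith [norm_nonneg (y - x)]
    rw [e, norm_sub_rev x y] at h1
    have := mul_le_mul_of_nonneg_left (neg_le_of_abs_le h2) (inv_pos.2 hγ).le
    linarith
  · have h1 := hup x y
    have : 0 ≤ γ⁻¹ * (1 + κ) * ‖y - x‖ ^ 2 := by positivity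
    linarith

end Proximal

/-! ### From a small smoothed gradient to a small Clarke subgradient. -/

section Clarke

variable {m : ℕ} {φ : Vec m → ℝ} {M : ℝ≥0} {ρ ε : ℝ}

/-- In finite dimension the convex hull of a compact set is compact. -/
lemma isCompact_convexHull_of_isCompact {E : Type*} [NormedAddCommGroup E] [NormedSpace ℝ E]
    [FiniteDimensional ℝ E] {L : Set E} (hL : IsCompact L) : IsCompact (convexHull ℝ L) := by
  classical
  rcases L.eq_empty_or_nonempty with rfl | ⟨l₀, hl₀⟩
  · simp
  -- By Carathéodory, `d` points suffice. Shorter combinations are padded with zero weights at `l₀`,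
  -- so the hull is a continuous image of one compact set.
  set d := Module.finrank ℝ E + 1
  have hK : IsCompact ((fun q : (Fin d → ℝ) × (Fin d → E) => ∑ i, q.1 i • q.2 i) ''
      (stdSimplex ℝ (Fin d) ×ˢ Set.univ.pi fun _ => L)) :=
    ((isCompact_stdSimplex ℝ (Fin d)).prod (isCompact_univ_pi fun _ => hL)).image (by fun_prop)
  convert hK using 1
  refine Set.Subset.antisymm ?_ ?_
  · intro x hx
    obtain ⟨ι, _, z, w, hz, hind, hw, hw1, hx⟩ := eq_pos_convex_span_of_mem_convexHull hx
    have hcard : Fintype.card ι ≤ d := by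
      have := hind.card_le_finrank_succ
      refine this.trans (Nat.succ_le_succ (Submodule.finrank_le _))
    obtain ⟨e⟩ : Nonempty (ι ↪ Fin d) := Function.Embedding.nonempty_of_card_le (by simpa)
    have hext : ∀ i, Function.extend e w (0 : Fin d → ℝ) (e i) = w i :=
      e.injective.extend_apply w (0 : Fin d → ℝ)
    have hext' : ∀ i, Function.extend e z (fun _ => l₀) (e i) = z i :=
      e.injective.extend_apply z _
    have hout : ∀ j ∉ Set.range e, Function.extend e w (0 : Fin d → ℝ) j = 0 := fun j hj =>
      Function.extend_apply' w (0 : Fin d → ℝ) j (by simpa using hj)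
    refine ⟨(Function.extend e w (0 : Fin d → ℝ), Function.extend e z fun _ => l₀), ⟨⟨?_, ?_⟩, ?_⟩, ?_⟩
    · intro j
      by_cases hj : j ∈ Set.range e
      · obtain ⟨i, rfl⟩ := hj
        exact (hw i).le.trans_eq (hext i).symm
      · exact (hout j hj).ge
    · rw [← hw1]
      refine (Fintype.sum_of_injective e e.injective w _ hout fun i => (hext i).symm).symm
    · intro j _
      by_cases hj : j ∈ Set.range e
      · obtain ⟨i, rfl⟩ := hj
        simp only [hext']
        exact hz ⟨i, rfl⟩
      · simp only
        rw [Function.extend_apply' z _ j (by simpa using hj)]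
        exact hl₀
    · rw [← hx]
      refine (Fintype.sum_of_injective e e.injective _ _ (fun j hj => ?_) fun i => ?_).symm
      · simp only; rw [hout j hj, zero_smul]
      · simp only [hext, hext']
  · rintro _ ⟨⟨w, z⟩, ⟨hw, hz⟩, rfl⟩
    exact (convex_convexHull ℝ L).sum_mem (fun i _ => hw.1 i) hw.2
      fun i _ => subset_convexHull ℝ L (hz i (Set.mem_univ i))

/-- The limits of gradients at nearby points of differentiability. -/
def limitGradients (g : Vec m → ℝ) (x : Vec m) : Set (Vec m) :=
  {s | ∃ z : ℕ → Vec m, Tendsto z atTop (𝓝 x) ∧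
    (∀ k, DifferentiableAt ℝ g (z k)) ∧ Tendsto (fun k => ∇ g (z k)) atTop (𝓝 s)}

/-- Gradients are bounded by `M`; closedness is a diagonal argument over the approximating
sequences. -/
lemma isCompact_limitGradients (hφ : LipschitzWith M φ) (x : Vec m) :
    IsCompact (limitGradients φ x) := by
  have hsub : limitGradients φ x ⊆ Metric.closedBall 0 M := by
    rintro s ⟨z, -, -, hs⟩
    exact Metric.isClosed_closedBall.mem_of_tendsto hs (Eventually.of_forall fun k => by
      simpa using norm_gradient_le hφ (z k))
  refine Metric.isCompact_of_isClosed_isBounded ?_ (Metric.isBounded_closedBall.subset hsub)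
  rw [← isSeqClosed_iff_isClosed]
  intro σ s hσ hs
  have hstep : ∀ k : ℕ, ∃ y, dist y x < 1 / ((k : ℝ) + 1) ∧ DifferentiableAt ℝ φ y ∧
      dist (∇ φ y) (σ k) < 1 / ((k : ℝ) + 1) := by
    intro k
    obtain ⟨z, hz, hd, hg⟩ := hσ k
    have hpos : (0 : ℝ) < 1 / ((k : ℝ) + 1) := by positivity
    obtain ⟨j, h1, h2⟩ := ((hz.eventually (Metric.ball_mem_nhds x hpos)).and
      (hg.eventually (Metric.ball_mem_nhds (σ k) hpos))).exists
    exact ⟨z j, h1, hd j, h2⟩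
  choose y hy1 hy2 hy3 using hstep
  have h0 := tendsto_one_div_add_atTop_nhds_zero_nat (𝕜 := ℝ)
  refine ⟨y, ?_, hy2, ?_⟩
  · exact tendsto_iff_dist_tendsto_zero.2
      (squeeze_zero (fun _ => dist_nonneg) (fun k => (hy1 k).le) h0)
  · refine tendsto_iff_dist_tendsto_zero.2 (squeeze_zero (fun _ => dist_nonneg)
      (fun k => (dist_triangle (∇ φ (y k)) (σ k) s).trans (add_le_add_left (hy3 k).le _)) ?_)
    simpa using h0.add (tendsto_iff_dist_tendsto_zero.1 hs)

/-- A proximal supergradient of a weakly concave function is a Clarke subgradient. -/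
theorem mem_clarke_of_le (hφ : LipschitzWith M φ) (hc : StrongConvexOn Set.univ (-ρ) (-φ))
    {z s : Vec m} {C : ℝ} (hs : ∀ y, φ y ≤ φ z + inner ℝ s (y - z) + C * ‖y - z‖ ^ 2) :
    s ∈ clarke φ z := by
  by_contra hmem
  have hcomp := isCompact_convexHull_of_isCompact (isCompact_limitGradients hφ z)
  -- If `s` lay outside the hull, a hyperplane with normal `v` would separate it strictly from all
  -- limit gradients.
  obtain ⟨f, u, hf, hfs⟩ := geometric_hahn_banach_closed_point
    (convex_convexHull ℝ (limitGradients φ z)) hcomp.isClosed hmem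
  set v := (InnerProductSpace.toDual ℝ (Vec m)).symm f with hv
  have hfv : ∀ a, f a = inner ℝ v a := fun a => by
    rw [hv, InnerProductSpace.toDual_symm_apply]
  -- Otherwise bounded gradients at points tending to `z` would have a cluster point on the wrong
  -- side of the hyperplane.
  have hnear : ∃ r > 0, ∀ y, dist y z < r → DifferentiableAt ℝ φ y → f (∇ φ y) < u := by
    by_contra! hcon
    have hpos : ∀ k : ℕ, (0 : ℝ) < 1 / ((k : ℝ) + 1) := fun k => by positivity
    choose y hy1 hy2 hy3 using fun k : ℕ => hcon _ (hpos k)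
    obtain ⟨a, -, θ, hθ, ha⟩ := (isCompact_closedBall (0 : Vec m) M).tendsto_subseq
      (x := fun k => ∇ φ (y k)) (fun k => by simpa using norm_gradient_le hφ (y k))
    have hyz : Tendsto y atTop (𝓝 z) := tendsto_iff_dist_tendsto_zero.2
      (squeeze_zero (fun _ => dist_nonneg) (fun k => (hy1 k).le)
        tendsto_one_div_add_atTop_nhds_zero_nat)
    have hmem' : a ∈ limitGradients φ z :=
      ⟨y ∘ θ, hyz.comp hθ.tendsto_atTop, fun k => hy2 _, ha⟩
    have h1 := hf a (subset_convexHull ℝ _ hmem')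
    have h2 : u ≤ f a := ge_of_tendsto ((f.continuous.tendsto a).comp ha)
      (Eventually.of_forall fun k => hy3 _)
    linarith
  obtain ⟨r, hr, hrf⟩ := hnear
  have hdense : Dense {y | DifferentiableAt ℝ φ y} :=
    Measure.dense_of_ae (μ := (volume : Measure (Vec m))) hφ.ae_differentiableAt
  set Q := (‖v‖ + 1) ^ 2 with hQ
  set K := M + |ρ| / 2 * Q + ‖s‖ + |C| * Q with hK
  -- comparison at a point close to `z - t v`
  have key : ∀ t : ℝ, 0 < t → t ≤ 1 → t * (‖v‖ + 1) < r → f s - u ≤ t * K := by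
    intro t ht ht1 htr
    -- A point of differentiability within `t²` of `z - t • v` changes the estimates only at order
    -- `t²`. Adding the supergradient inequality at `z` and weak concavity at `y` gives `t * (f s -
    -- u) ≤ t² * K`.
    obtain ⟨y, hyd, hy⟩ := hdense.exists_dist_lt (z - t • v) (ε := t ^ 2) (by positivity)
    rw [dist_comm, dist_eq_norm] at hy
    set e := y - (z - t • v) with he
    have hyz : y - z = e - t • v := by rw [he]; abel
    have ht2 : t ^ 2 ≤ t := by nlinarith
    have hnorm : ‖y - z‖ ≤ t * (‖v‖ + 1) := by
      rw [hyz]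
      refine (norm_sub_le _ _).trans ?_
      rw [norm_smul, Real.norm_of_nonneg ht.le]
      linarith
    have hnorm2 : ‖y - z‖ ^ 2 ≤ t ^ 2 * Q := by
      rw [hQ, ← mul_pow]
      exact pow_le_pow_left₀ (norm_nonneg _) hnorm 2
    have h1 := hrf y (by rw [dist_eq_norm]; linarith) hyd
    rw [hfv, real_inner_comm] at h1
    have h2 := strongConvexOn_add_inner_gradient_le hc (x := y) hyd.neg z
    rw [gradient_neg', inner_neg_left, norm_sub_rev z y] at h2
    simp only [Pi.neg_apply] at h2
    have e1 : z - y = t • v - e := by rw [← neg_sub, hyz, neg_sub]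
    rw [e1, inner_sub_right, real_inner_smul_right] at h2
    have h3 : |(inner ℝ (∇ φ y) e : ℝ)| ≤ M * t ^ 2 :=
      (abs_real_inner_le_norm _ _).trans
        (mul_le_mul (norm_gradient_le hφ y) hy.le (norm_nonneg _) M.2)
    have h4 := hs y
    rw [hyz, inner_sub_right, real_inner_smul_right, ← hyz] at h4
    have h5 : |(inner ℝ s e : ℝ)| ≤ ‖s‖ * t ^ 2 :=
      (abs_real_inner_le_norm _ _).trans (mul_le_mul_of_nonneg_left hy.le (norm_nonneg _))
    rw [hfv, real_inner_comm]
    have h6 : C * ‖y - z‖ ^ 2 ≤ |C| * (t ^ 2 * Q) :=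
      mul_le_mul (le_abs_self C) hnorm2 (by positivity) (abs_nonneg _)
    have h7 : ρ / 2 * ‖y - z‖ ^ 2 ≤ |ρ| / 2 * (t ^ 2 * Q) :=
      mul_le_mul (by linarith [le_abs_self ρ]) hnorm2 (by positivity) (by positivity)
    have h8 := mul_lt_mul_of_pos_left h1 ht
    refine le_of_mul_le_mul_left ?_ ht
    have h9 := (abs_le.1 h3).1
    have h10 := (abs_le.1 h5).2
    rw [hK]
    nlinarith
  have hlim : Tendsto (fun t : ℝ => t * K) (𝓝[>] 0) (𝓝 (0 * K)) :=
    (tendsto_nhdsWithin_of_tendsto_nhds tendsto_id).mul_const K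
  have hge : f s - u ≤ 0 * K := by
    refine ge_of_tendsto hlim ?_
    have hv1 : 0 < ‖v‖ + 1 := by positivity
    filter_upwards [Ioo_mem_nhdsGT (lt_min one_pos (div_pos hr hv1))] with t ht
    refine key t ht.1 (ht.2.le.trans (min_le_left _ _)) ?_
    rw [← lt_div_iff₀ hv1]
    exact ht.2.trans_le (min_le_right _ _)
  linarith

/-- For a weakly concave function, a small gradient of the smoothing yields a small Clarke
subgradient at a nearby point. -/
theorem exists_mem_clarkeBall (hφ : LipschitzWith M φ)
    (hc : StrongConvexOn Set.univ (-ρ) (-φ)) (hρ : 0 ≤ ρ) (hε : 0 < ε) (x : Vec m) :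
    ∃ s ∈ clarkeBall φ (2 * √(M * ε)) x,
      ‖s‖ ^ 2 ≤ 2 * ‖smoothingGradient φ ε x‖ ^ 2 + 8 * (ρ + 1) ^ 2 * (M * ε) := by
  have hψ : LipschitzWith M (-φ) := hφ.neg
  set g := smoothingGradient φ ε x with hg
  have hgn : smoothingGradient (-φ) ε x = -g := smoothingGradient_neg φ ε x
  have hlin : LipschitzWith (M + ‖g‖₊) fun y => -φ y + inner ℝ g y := by
    refine hψ.add (LipschitzWith.of_dist_le_mul fun a b => ?_)
    rw [Real.dist_eq, ← inner_sub_right, dist_eq_norm]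
    exact abs_real_inner_le_norm _ _
  -- The weight `ρ + 1` exceeds the weak convexity modulus by `1`. Comparison with `x`, where `-g`
  -- is a subgradient of `-φ` up to `2Mε`, therefore leaves `‖x - z‖² / 2 ≤ 2Mε`. Optimality of `z`
  -- makes `g + (ρ + 1) • (z - x)` a proximal supergradient of `φ`.
  obtain ⟨z, hz⟩ := exists_forall_add_sq_le hlin (c := (ρ + 1) / 2) (by positivity) x
  have hclose : ‖x - z‖ ^ 2 ≤ 4 * (M * ε) := by
    have h1 := hz x
    have h2 := add_inner_smoothingGradient_le hψ hc hε x z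
    rw [hgn, inner_neg_left, inner_sub_right, norm_sub_rev z x] at h2
    simp only [Pi.neg_apply, sub_self, norm_zero] at h1 h2
    linarith
  have hdist : ‖x - z‖ ≤ 2 * √(M * ε) := by
    refine le_of_sq_le_sq ?_ (by positivity)
    rw [mul_pow, Real.sq_sqrt (by positivity)]
    linarith
  refine ⟨g + (ρ + 1) • (z - x), ?_, ?_⟩
  · refine Set.mem_iUnion₂.2 ⟨z, ?_, ?_⟩
    · rwa [Metric.mem_closedBall, dist_comm, dist_eq_norm]
    · refine mem_clarke_of_le hφ hc (C := (ρ + 1) / 2) fun y => ?_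
      have h1 := hz y
      have e : x - y = (x - z) - (y - z) := by abel
      rw [e, norm_sub_sq_real (x - z) (y - z)] at h1
      rw [inner_add_left, real_inner_smul_left, inner_sub_right, ← neg_sub x z, inner_neg_left]
      linarith
  · have h1 : ‖g + (ρ + 1) • (z - x)‖ ≤ ‖g‖ + (ρ + 1) * ‖x - z‖ := by
      refine (norm_add_le _ _).trans ?_
      rw [norm_smul, Real.norm_of_nonneg (by positivity), norm_sub_rev]
    have h2 := pow_le_pow_left₀ (norm_nonneg _) h1 2
    nlinarith [sq_nonneg (‖g‖ - (ρ + 1) * ‖x - z‖),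
      mul_le_mul_of_nonneg_left hclose (sq_nonneg (ρ + 1))]

end Clarke

/-! ### The random iterates: independence, conditioning and telescoping. -/

section Sampling

variable {m T : ℕ} {A : Vec m → ℝ} {η ε : ℝ} {x₀ : Vec m}

lemma iterate_succ_of_lt {u : Fin T → Vec m} {t : ℕ} (h : t < T) :
    iterate A η ε x₀ u (t + 1) =
      iterate A η ε x₀ u t - η • estimator A ε (iterate A η ε x₀ u t) (u ⟨t, h⟩) := by
  simp [iterate, h]

lemma measurable_iterate (hA : Measurable A) (t : ℕ) :
    Measurable fun u : Fin T → Vec m => iterate A η ε x₀ u t := by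
  induction t with
  | zero => exact measurable_const
  | succ t ih =>
    by_cases h : t < T
    · simp only [iterate_succ_of_lt h]
      have := (measurable_estimator hA ε).comp (ih.prodMk (measurable_pi_apply ⟨t, h⟩))
      exact ih.sub (this.const_smul η)
    · simpa only [iterate, h, dite_false] using ih

/-- The `t`-th iterate only depends on the first `t` directions. -/
lemma iterate_congr {u v : Fin T → Vec m} (t : ℕ) (h : ∀ i : Fin T, (i : ℕ) < t → u i = v i) :
    iterate A η ε x₀ u t = iterate A η ε x₀ v t := by
  induction t with
  | zero => rfl
  | succ t ih =>
    have ih' := ih fun i hi => h i (hi.trans (Nat.lt_succ_self t))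
    by_cases ht : t < T
    · rw [iterate_succ_of_lt ht, iterate_succ_of_lt ht, ih', h ⟨t, ht⟩ (Nat.lt_succ_self t)]
    · simpa only [iterate, ht, dite_false] using ih'

variable {Ω : Type*} [MeasurableSpace Ω] {P : Measure Ω}
  {u : Fin T → Ω → Vec m} {R : Ω → Fin T}

/-- The iterate at time `t` is a measurable function of the directions with index below `t`, which
are jointly independent of the one at `t`. -/
lemma IsSampling.indepFun_iterate (hS : IsSampling P u R) (hA : Measurable A) (t : Fin T) :
    IndepFun (fun ω => iterate A η ε x₀ (fun i => u i ω) t) (u t) P := by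
  classical
  set S : Finset (Fin T) := Finset.univ.filter fun i => i < t
  have hdisj : Disjoint S {t} := by simp [S]
  have h := hS.indep_dir.indepFun_finset S {t} hdisj hS.measurable_dir
  -- The missing directions are filled with `0`; by `iterate_congr` they do not influence the
  -- iterate.
  have hext : Measurable fun a : S → Vec m =>
      fun i : Fin T => if hi : i ∈ S then a ⟨i, hi⟩ else 0 := by
    refine measurable_pi_lambda _ fun i => ?_
    by_cases hi : i ∈ S
    · simpa only [hi, dite_true] using measurable_pi_apply _
    · simpa only [hi, dite_false] using measurable_const
  have h' := h.comp ((measurable_iterate (A := A) (η := η) (ε := ε) (x₀ := x₀) hA t).comp hext)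
    (measurable_pi_apply (⟨t, Finset.mem_singleton_self t⟩ : ({t} : Finset (Fin T))))
  convert h' using 1
  · funext ω
    refine iterate_congr _ fun i hi => ?_
    have : i ∈ S := by simpa [S] using hi
    simp [this]
  · rfl

/-- Conditioning on the past: the joint law of iterate and new direction is a product, and Tonelli
applies without any integrability. -/
lemma IsSampling.lintegral_step [IsProbabilityMeasure P] (hm : 0 < m) (hS : IsSampling P u R) (hA : Measurable A)
    (t : Fin T) {H : Vec m → ℝ≥0∞} (hH : Measurable H) :
    ∫⁻ ω, H (iterate A η ε x₀ (fun i => u i ω) (t + 1)) ∂P =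
      ∫⁻ ω, ∫⁻ v, H (iterate A η ε x₀ (fun i => u i ω) t - η • estimator A ε
        (iterate A η ε x₀ (fun i => u i ω) t) v) ∂(sphereUniform m) ∂P := by
  have := isProbabilityMeasure_sphereUniform hm
  set X : Ω → Vec m := fun ω => iterate A η ε x₀ (fun i => u i ω) t
  have hX : Measurable X :=
    (measurable_iterate hA t).comp (measurable_pi_lambda _ fun i => hS.measurable_dir i)
  have hstep : Measurable fun p : Vec m × Vec m => H (p.1 - η • estimator A ε p.1 p.2) :=
    hH.comp (measurable_fst.sub ((measurable_estimator hA ε).const_smul η))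
  have hlaw := (indepFun_iff_map_prod_eq_prod_map_map hX.aemeasurable
    (hS.measurable_dir t).aemeasurable).1 (hS.indepFun_iterate hA t)
  calc ∫⁻ ω, H (iterate A η ε x₀ (fun i => u i ω) (t + 1)) ∂P
      = ∫⁻ ω, H (X ω - η • estimator A ε (X ω) (u t ω)) ∂P := by
        refine lintegral_congr fun ω => ?_
        rw [iterate_succ_of_lt t.2]
    _ = ∫⁻ p, H (p.1 - η • estimator A ε p.1 p.2) ∂(P.map fun ω => (X ω, u t ω)) :=
        (lintegral_map hstep (hX.prodMk (hS.measurable_dir t))).symm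
    _ = ∫⁻ x, ∫⁻ v, H (x - η • estimator A ε x v) ∂(sphereUniform m) ∂(P.map X) := by
        rw [hlaw, hS.law_dir, lintegral_prod _ hstep.aemeasurable]
    _ = _ := lintegral_map hstep.lintegral_prod_right' hX

lemma IsSampling.lintegral_output (hS : IsSampling P u R) (hA : Measurable A)
    {H : Vec m → ℝ≥0∞} (hH : Measurable H) :
    ∫⁻ ω, H (output A η ε x₀ u R ω) ∂P =
      (T : ℝ≥0∞)⁻¹ * ∑ t : Fin T, ∫⁻ ω, H (iterate A η ε x₀ (fun i => u i ω) t) ∂P := by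
  have hU : Measurable fun ω => fun i => u i ω :=
    measurable_pi_lambda _ fun i => hS.measurable_dir i
  have hX : ∀ t : Fin T, Measurable fun ω => H (iterate A η ε x₀ (fun i => u i ω) t) :=
    fun t => hH.comp ((measurable_iterate hA t).comp hU)
  have hpt : ∀ ω, H (output A η ε x₀ u R ω) = ∑ t : Fin T,
      (({t} : Set (Fin T)).indicator (fun _ => (1 : ℝ≥0∞)) (R ω)) *
        H (iterate A η ε x₀ (fun i => u i ω) t) := by
    intro ω
    rw [Finset.sum_eq_single (R ω)]
    · simp [output]
    · intro t _ ht
      rw [Set.indicator_of_notMem (by simpa using ht.symm), zero_mul]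
    · simp
  have hind : ∀ t : Fin T,
      Measurable (({t} : Set (Fin T)).indicator (fun _ => (1 : ℝ≥0∞))) :=
    fun t => measurable_const.indicator (measurableSet_singleton t)
  simp only [hpt]
  rw [lintegral_finsetSum (f := fun (t : Fin T) ω =>
      (({t} : Set (Fin T)).indicator (fun _ => (1 : ℝ≥0∞)) (R ω)) *
        H (iterate A η ε x₀ (fun i => u i ω) t)) _
      fun t _ => ((hind t).comp hS.measurable_index).mul (hX t),
    Finset.mul_sum]
  refine Finset.sum_congr rfl fun t _ => ?_
  have hi : IndepFun (fun ω => ({t} : Set (Fin T)).indicator (fun _ => (1 : ℝ≥0∞)) (R ω))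
      (fun ω => H (iterate A η ε x₀ (fun i => u i ω) t)) P :=
    hS.indep_index.symm.comp (hind t) (hH.comp (measurable_iterate hA t))
  have hmul := lintegral_mul_eq_lintegral_mul_lintegral_of_indepFun
    ((hind t).comp hS.measurable_index) (hX t) hi
  refine hmul.trans ?_
  congr 1
  have e : ∀ ω, ({t} : Set (Fin T)).indicator (fun _ => (1 : ℝ≥0∞)) (R ω) =
      (R ⁻¹' {t}).indicator (fun _ => 1) ω := fun ω => rfl
  simp only [Function.comp_apply, e]
  rw [lintegral_indicator (hS.measurable_index (measurableSet_singleton t))]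
  simp [hS.law_index t]

/-- Telescoping a one-step expected decrease inequality along the iterates. -/
theorem IsSampling.lintegral_output_le [IsProbabilityMeasure P] (hm : 0 < m) (hS : IsSampling P u R)
    (hA : Measurable A) {V D : Vec m → ℝ} (hV : Measurable V) (hD : Measurable D)
    (hD0 : ∀ x, 0 ≤ D x) {a c v : ℝ} (ha : 0 < a) (hc : 0 ≤ c) (hv : ∀ x, v ≤ V x)
    (hstep : ∀ x, Integrable (fun w => V (x - η • estimator A ε x w)) (sphereUniform m) ∧
      ∫ w, V (x - η • estimator A ε x w) ∂(sphereUniform m) ≤ V x - a * D x + c) :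
    ∫⁻ ω, ENNReal.ofReal (D (output A η ε x₀ u R ω)) ∂P ≤
      ENNReal.ofReal ((V x₀ - v) / (a * T) + c / a) := by
  have := isProbabilityMeasure_sphereUniform hm
  have hU : Measurable fun ω => fun i => u i ω :=
    measurable_pi_lambda _ fun i => hS.measurable_dir i
  set X : ℕ → Ω → Vec m := fun t ω => iterate A η ε x₀ (fun i => u i ω) t
  have hX : ∀ t, Measurable (X t) := fun t => (measurable_iterate hA t).comp hU
  -- Subtracting the lower bound `v` makes every term nonnegative, so the recursion runs in `ℝ≥0∞`
  -- and integrability of `V` along the iterates is never required.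
  have hone : ∀ x, ∫⁻ w, ENNReal.ofReal (V (x - η • estimator A ε x w) - v)
      ∂(sphereUniform m) + ENNReal.ofReal a * ENNReal.ofReal (D x) ≤
      ENNReal.ofReal (V x - v) + ENNReal.ofReal c := by
    intro x
    obtain ⟨hi, hle⟩ := hstep x
    rw [← ofReal_integral_eq_lintegral_ofReal
      (f := fun w => V (x - η • estimator A ε x w) - v) (hi.sub (integrable_const v))
      (ae_of_all _ fun w => sub_nonneg.2 (hv _)), ← ENNReal.ofReal_mul ha.le,
      ← ENNReal.ofReal_add (integral_nonneg fun w => sub_nonneg.2 (hv _))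
        (mul_nonneg ha.le (hD0 x)), ← ENNReal.ofReal_add (sub_nonneg.2 (hv x)) hc]
    refine ENNReal.ofReal_le_ofReal ?_
    rw [integral_sub hi (integrable_const v)]
    simp
    linarith
  have hrec : ∀ t : ℕ, t ≤ T →
      ∫⁻ ω, ENNReal.ofReal (V (X t ω) - v) ∂P + ∑ k ∈ Finset.range t,
        ENNReal.ofReal a * ∫⁻ ω, ENNReal.ofReal (D (X k ω)) ∂P ≤
      ENNReal.ofReal (V x₀ - v) + t * ENNReal.ofReal c := by
    intro t
    induction t with
    | zero => simp [X, iterate]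
    | succ t ih =>
      intro ht
      have ih' := ih (Nat.le_of_succ_le ht)
      have hs := hS.lintegral_step (A := A) (η := η) (ε := ε) (x₀ := x₀) hm hA ⟨t, ht⟩
        (H := fun x => ENNReal.ofReal (V x - v)) (by fun_prop)
      rw [Finset.sum_range_succ]
      have hXt := hX t
      calc ∫⁻ ω, ENNReal.ofReal (V (X (t + 1) ω) - v) ∂P + (∑ k ∈ Finset.range t,
            ENNReal.ofReal a * ∫⁻ ω, ENNReal.ofReal (D (X k ω)) ∂P +
            ENNReal.ofReal a * ∫⁻ ω, ENNReal.ofReal (D (X t ω)) ∂P)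
          = ∫⁻ ω, (∫⁻ w, ENNReal.ofReal (V (X t ω - η • estimator A ε (X t ω) w) - v)
              ∂(sphereUniform m) + ENNReal.ofReal a * ENNReal.ofReal (D (X t ω))) ∂P +
            ∑ k ∈ Finset.range t, ENNReal.ofReal a * ∫⁻ ω, ENNReal.ofReal (D (X k ω)) ∂P := by
            rw [lintegral_add_right _ (by fun_prop), lintegral_const_mul _ (by fun_prop),
              show ∫⁻ ω, ENNReal.ofReal (V (X (t + 1) ω) - v) ∂P = _ from hs]
            ring
        _ ≤ ∫⁻ ω, (ENNReal.ofReal (V (X t ω) - v) + ENNReal.ofReal c) ∂P +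
            ∑ k ∈ Finset.range t, ENNReal.ofReal a * ∫⁻ ω, ENNReal.ofReal (D (X k ω)) ∂P :=
            add_le_add_left (lintegral_mono fun ω => hone _) _
        _ = (∫⁻ ω, ENNReal.ofReal (V (X t ω) - v) ∂P +
            ∑ k ∈ Finset.range t, ENNReal.ofReal a * ∫⁻ ω, ENNReal.ofReal (D (X k ω)) ∂P) +
              ENNReal.ofReal c := by
            rw [lintegral_add_right _ measurable_const]
            simp
            ring
        _ ≤ (ENNReal.ofReal (V x₀ - v) + t * ENNReal.ofReal c) + ENNReal.ofReal c :=
            add_le_add_left ih' _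
        _ = _ := by push_cast; ring
  have hT : 0 < T := by
    obtain ⟨ω⟩ : Nonempty Ω := nonempty_of_isProbabilityMeasure P
    exact (R ω).pos
  have hT' : (0 : ℝ) < T := by exact_mod_cast hT
  rw [hS.lintegral_output hA (H := fun x => ENNReal.ofReal (D x)) (by fun_prop)]
  -- The final value of the potential is nonnegative and is dropped.
  have hfin := (le_add_left le_rfl).trans (hrec T le_rfl)
  rw [← Finset.mul_sum] at hfin
  rw [Finset.sum_range (fun k => ∫⁻ ω, ENNReal.ofReal (D (X k ω)) ∂P)] at hfin
  have ha0 : ENNReal.ofReal a ≠ 0 := by simpa using ha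
  have hTr : (T : ℝ≥0∞) = ENNReal.ofReal T := by simp
  have hT0 : (T : ℝ≥0∞) ≠ 0 := by simpa using hT.ne'
  rw [ENNReal.inv_mul_le_iff hT0 (by simp)]
  refine (ENNReal.mul_le_mul_iff_right ha0 ENNReal.ofReal_ne_top).1 (hfin.trans (le_of_eq ?_))
  rw [hTr, ← ENNReal.ofReal_mul hT'.le, ← ENNReal.ofReal_add (sub_nonneg.2 (hv x₀))
    (by positivity), ← ENNReal.ofReal_mul hT'.le, ← ENNReal.ofReal_mul ha.le]
  congr 1
  field_simp

end Sampling

/-! ### Interpolation errors along segments. -/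

section Interpolation

/-- The interpolation error of a function on `[0, 1]` whose derivative is one-sided
`κ`-Lipschitz. -/
lemma le_convexCombination_of_deriv {c c' : ℝ → ℝ} {κ : ℝ} (hd : ∀ t, HasDerivAt c (c' t) t)
    (hκ : ∀ s t, s ≤ t → -(κ * (t - s)) ≤ c' t - c' s) {t : ℝ} (h0 : 0 ≤ t) (h1 : t ≤ 1) :
    c t ≤ t * c 1 + (1 - t) * c 0 + κ / 2 * (t * (1 - t)) := by
  have hder : ∀ s, HasDerivAt (fun s => c s + κ / 2 * s ^ 2) (c' s + κ * s) s := by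
    intro s
    have := (hd s).add (((hasDerivAt_pow 2 s)).const_mul (κ / 2))
    convert! this using 1
    simp; ring
  have hconv : ConvexOn ℝ Set.univ fun s => c s + κ / 2 * s ^ 2 := by
    refine Monotone.convexOn_univ_of_deriv (fun s => (hder s).differentiableAt) ?_
    intro s r hsr
    rw [(hder s).deriv, (hder r).deriv]
    linarith [hκ s r hsr]
  have := hconv.2 (Set.mem_univ (1 : ℝ)) (Set.mem_univ (0 : ℝ)) h0 (sub_nonneg.2 h1) (by ring)
  simp only [smul_eq_mul] at this
  norm_num at this
  nlinarith

variable {E : Type*} [NormedAddCommGroup E] [InnerProductSpace ℝ E] [CompleteSpace E]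

lemma IsSmooth.le_convexCombination {L : ℝ≥0} {g : E → ℝ} (hg : IsSmooth L g) (p q : E) {t : ℝ}
    (h0 : 0 ≤ t) (h1 : t ≤ 1) :
    g (q + t • (p - q)) ≤ t * g p + (1 - t) * g q + L / 2 * (t * (1 - t)) * ‖p - q‖ ^ 2 := by
  have hline : ∀ t : ℝ, HasDerivAt (fun t : ℝ => q + t • (p - q)) (p - q) t := fun t => by
    simpa using ((hasDerivAt_id t).smul_const (p - q)).const_add q
  have h := le_convexCombination_of_deriv (c := fun t => g (q + t • (p - q)))
    (c' := fun t => inner ℝ (∇ g (q + t • (p - q))) (p - q)) (κ := L * ‖p - q‖ ^ 2)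
    (fun t => by
      have := (hg.differentiable (q + t • (p - q))).hasFDerivAt.comp_hasDerivAt t (hline t)
      rw [gradient, InnerProductSpace.toDual_symm_apply]
      exact this)
    (fun s t hst => by
      have h2 := hg.lipschitz_gradient.norm_sub_le (q + t • (p - q)) (q + s • (p - q))
      have h3 := neg_le_of_abs_le (abs_real_inner_le_norm
        (∇ g (q + t • (p - q)) - ∇ g (q + s • (p - q))) (p - q))
      rw [inner_sub_left] at h3
      rw [add_sub_add_left_eq_sub, ← sub_smul, norm_smul,
        Real.norm_of_nonneg (sub_nonneg.2 hst)] at h2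
      nlinarith [mul_le_mul_of_nonneg_right h2 (norm_nonneg (p - q))]) h0 h1
  simp only [one_smul, zero_smul, add_zero, add_sub_cancel] at h
  linarith

/-- The vector estimate reduces to the scalar one by pairing `G` with its own interpolation error
`e`: the scalar error is then `‖e‖²`, while the modulus contains `‖e‖` once. -/
lemma norm_convexCombination_sub_le {E F : Type*} [NormedAddCommGroup E] [NormedSpace ℝ E]
    [NormedAddCommGroup F] [InnerProductSpace ℝ F] {G : E → F} (hG : Differentiable ℝ G) (p q : E) {κ : ℝ}
    (hκ : ∀ s t : ℝ, s ≤ t →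
      ‖fderiv ℝ G (q + t • (p - q)) - fderiv ℝ G (q + s • (p - q))‖ ≤ κ * (t - s)) {t : ℝ}
    (h0 : 0 ≤ t) (h1 : t ≤ 1) :
    ‖t • G p + (1 - t) • G q - G (q + t • (p - q))‖ ≤ κ / 2 * (t * (1 - t)) * ‖p - q‖ := by
  set e := G (q + t • (p - q)) - (t • G p + (1 - t) • G q) with he
  have hline : ∀ t : ℝ, HasDerivAt (fun t : ℝ => q + t • (p - q)) (p - q) t := fun t => by
    simpa using ((hasDerivAt_id t).smul_const (p - q)).const_add q
  have h := le_convexCombination_of_deriv (c := fun t => inner ℝ e (G (q + t • (p - q))))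
    (c' := fun t => inner ℝ e (fderiv ℝ G (q + t • (p - q)) (p - q)))
    (κ := ‖e‖ * (κ * ‖p - q‖))
    (fun t => by
      have h := (hG (q + t • (p - q))).hasFDerivAt.comp_hasDerivAt t (hline t)
      simpa using! (hasDerivAt_const t e).inner ℝ h)
    (fun s t hst => by
      have h3 := neg_le_of_abs_le (abs_real_inner_le_norm e
        ((fderiv ℝ G (q + t • (p - q)) - fderiv ℝ G (q + s • (p - q))) (p - q)))
      have h4 := ((fderiv ℝ G (q + t • (p - q)) - fderiv ℝ G (q + s • (p - q))).le_opNorm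
        (p - q)).trans (mul_le_mul_of_nonneg_right (hκ s t hst) (norm_nonneg _))
      have h5 := mul_le_mul_of_nonneg_left h4 (norm_nonneg e)
      rw [_root_.sub_apply, inner_sub_right] at h3
      rw [_root_.sub_apply] at h5
      linarith) h0 h1
  simp only [one_smul, zero_smul, add_zero, add_sub_cancel] at h
  have h6 : inner ℝ e e ≤ ‖e‖ * (κ * ‖p - q‖) / 2 * (t * (1 - t)) := by
    nth_rewrite 2 [he]
    rw [inner_sub_right, inner_add_right, real_inner_smul_right, real_inner_smul_right]
    linarith
  rw [← norm_neg, neg_sub, ← he]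
  rcases (norm_nonneg e).eq_or_lt with h7 | h7
  · rw [← h7]
    -- When `e = 0` the claim still needs `0 ≤ κ`, which the hypothesis yields on `[0, 1]`.
    have := (norm_nonneg _).trans (hκ 0 1 zero_le_one)
    have : 0 ≤ 1 - t := sub_nonneg.2 h1
    have : 0 ≤ κ := by linarith
    positivity
  · refine le_of_mul_le_mul_left ?_ h7
    rw [real_inner_self_eq_norm_sq] at h6
    nlinarith

end Interpolation

/-! ### Regularity of the solution map and of the hyper-objectives. -/

section HyperObjective

variable {m n : ℕ} {Lf Hf MF LF : ℝ≥0} {τ : ℝ} {f F : Joint m n → ℝ}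

lemma norm_sq_joint (p : Joint m n) : ‖p‖ ^ 2 = ‖p.fst‖ ^ 2 + ‖p.snd‖ ^ 2 :=
  WithLp.prod_norm_sq_eq_of_L2 p

lemma norm_joint_le (p : Joint m n) : ‖p‖ ≤ ‖p.fst‖ + ‖p.snd‖ := by
  refine le_of_sq_le_sq ?_ (by positivity)
  rw [norm_sq_joint]
  nlinarith [mul_nonneg (norm_nonneg p.fst) (norm_nonneg p.snd)]

lemma LowerLevel.gradY_eq (hf : LowerLevel Lf Hf τ f) (p : Joint m n) :
    gradY f p = (∇ f p).snd := by
  refine HasGradientAt.gradient ?_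
  rw [hasGradientAt_iff_hasFDerivAt]
  have hin : HasFDerivAt (fun y : Vec n => pair p.fst y)
      ((WithLp.prodContinuousLinearEquiv 2 ℝ (Vec m) (Vec n)).symm.toContinuousLinearMap ∘L
        ContinuousLinearMap.inr ℝ (Vec m) (Vec n)) p.snd :=
    (WithLp.prodContinuousLinearEquiv 2 ℝ (Vec m) (Vec n)).symm.hasFDerivAt.comp p.snd
      (hasFDerivAt_prodMk_right p.fst p.snd)
  have hfp : HasFDerivAt f (InnerProductSpace.toDual ℝ _ (∇ f p)) (pair p.fst p.snd) :=
    (hf.smooth.differentiable p).hasGradientAt.hasFDerivAt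
  have e : (InnerProductSpace.toDual ℝ (Joint m n) (∇ f p)) ∘L
      ((WithLp.prodContinuousLinearEquiv 2 ℝ (Vec m) (Vec n)).symm.toContinuousLinearMap ∘L
        ContinuousLinearMap.inr ℝ (Vec m) (Vec n)) =
      InnerProductSpace.toDual ℝ (Vec n) (∇ f p).snd := by
    refine ContinuousLinearMap.ext fun v => ?_
    change inner ℝ (∇ f p) (pair 0 v) = inner ℝ (∇ f p).snd v
    rw [WithLp.prod_inner_apply]
    change inner ℝ (∇ f p).fst 0 + inner ℝ (∇ f p).snd v = _
    rw [inner_zero_right, zero_add]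
  rw [← e]
  exact hfp.comp p.snd hin

lemma LowerLevel.differentiable_gradY (hf : LowerLevel Lf Hf τ f) :
    Differentiable ℝ (gradY f) := by
  have e : gradY f = fun p => (WithLp.sndL 2 ℝ (Vec m) (Vec n)) (∇ f p) := by
    funext p; exact hf.gradY_eq p
  rw [e]
  exact (ContinuousLinearMap.differentiable _).comp hf.twice_differentiable

lemma LowerLevel.norm_gradY_sub_le (hf : LowerLevel Lf Hf τ f) (p q : Joint m n) :
    ‖gradY f p - gradY f q‖ ≤ Lf * ‖p - q‖ := by
  rw [hf.gradY_eq, hf.gradY_eq]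
  refine le_trans ?_ (hf.smooth.lipschitz_gradient.norm_sub_le p q)
  refine le_of_sq_le_sq ?_ (norm_nonneg _)
  rw [norm_sq_joint (∇ f p - ∇ f q)]
  exact le_add_of_nonneg_left (sq_nonneg _)

lemma gradY_eq_zero {x : Vec m} {y : Vec n} (hy : y ∈ solSet f x) : gradY f (pair x y) = 0 := by
  have : IsLocalMin (fun y : Vec n => f (pair x y)) y := Eventually.of_forall hy
  simp [gradY, gradient, this.fderiv_eq_zero]

lemma LowerLevel.exists_near (hf : LowerLevel Lf Hf τ f) (x : Vec m) (y : Vec n) :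
    ∃ y' ∈ solSet f x, ‖y - y'‖ ≤ τ * ‖gradY f (pair x y)‖ := by
  obtain ⟨y', hy', h⟩ := (hf.sol_closed x).exists_infDist_eq_dist (hf.sol_nonempty x) y
  exact ⟨y', hy', by rw [← dist_eq_norm, ← h]; exact hf.error_bound x y⟩

/-- A solution at `x` has partial gradient at most `Lf * ‖x - x'‖` when the base point moves to
`x'`; the error bound converts this into a distance. -/
lemma LowerLevel.exists_lipschitz (hf : LowerLevel Lf Hf τ f) {x : Vec m} {y : Vec n}
    (hy : y ∈ solSet f x) (x' : Vec m) :
    ∃ y' ∈ solSet f x', ‖y - y'‖ ≤ Lf * τ * ‖x - x'‖ := by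
  obtain ⟨y', hy', h⟩ := hf.exists_near x' y
  refine ⟨y', hy', h.trans ?_⟩
  have h1 := hf.norm_gradY_sub_le (pair x' y) (pair x y)
  rw [gradY_eq_zero hy, sub_zero] at h1
  have h2 : ‖pair x' y - pair x y‖ ≤ ‖x' - x‖ + ‖y - y‖ := norm_joint_le _
  rw [sub_self, norm_zero, add_zero, norm_sub_rev x' x] at h2
  have h3 : (Lf : ℝ) * ‖pair x' y - pair x y‖ ≤ Lf * ‖x - x'‖ := by gcongr
  have := mul_le_mul_of_nonneg_left (h1.trans h3) hf.tau_pos.le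
  linarith

/-- Second-order interpolation of lower-level solutions. -/
lemma LowerLevel.exists_interpolation (hf : LowerLevel Lf Hf τ f) (x₁ x₂ : Vec m) {t : ℝ}
    (h0 : 0 < t) (h1 : t ≤ 1) {y : Vec n} (hy : y ∈ solSet f (x₂ + t • (x₁ - x₂))) :
    ∃ y₁ ∈ solSet f x₁, ∃ y₂ ∈ solSet f x₂, ∃ y₁' : Vec n,
      y = y₂ + t • (y₁' - y₂) ∧
      ‖y₁' - y₂‖ ≤ Lf * τ * ‖x₁ - x₂‖ ∧
      ‖y₁' - y₁‖ ≤ (1 - t) * (Hf * τ * (1 + ((Lf : ℝ) * τ) ^ 2)) * ‖x₁ - x₂‖ ^ 2 := by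
  have hτ := hf.tau_pos
  obtain ⟨y₂, hy₂, hyy₂⟩ := hf.exists_lipschitz hy x₂
  rw [add_sub_cancel_left, norm_smul, Real.norm_of_nonneg h0.le] at hyy₂
  -- The line from `y₂` to `y` is extended to parameter `1`. Since `‖y - y₂‖` is itself proportional
  -- to `t`, division by `t` does no harm.
  set y₁' : Vec n := y₂ + t⁻¹ • (y - y₂) with hy₁'
  have hcomb : y = y₂ + t • (y₁' - y₂) := by
    rw [hy₁', add_sub_cancel_left, smul_smul, mul_inv_cancel₀ h0.ne', one_smul, add_sub_cancel]
  have hlen : ‖y₁' - y₂‖ ≤ Lf * τ * ‖x₁ - x₂‖ := by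
    rw [hy₁', add_sub_cancel_left, norm_smul, norm_inv, Real.norm_of_nonneg h0.le,
      inv_mul_le_iff₀ h0]
    linarith
  obtain ⟨y₁, hy₁, hyy₁⟩ := hf.exists_near x₁ y₁'
  refine ⟨y₁, hy₁, y₂, hy₂, y₁', hcomb, hlen, hyy₁.trans ?_⟩
  set p := pair x₁ y₁'
  set q := pair x₂ y₂
  set a := ‖x₁ - x₂‖
  set b := ‖y₁' - y₂‖
  have hpt : q + t • (p - q) = pair (x₂ + t • (x₁ - x₂)) y := by
    rw [hcomb]; rfl
  have hint := norm_convexCombination_sub_le (κ := Hf * (a + b)) hf.differentiable_gradY p q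
    (fun s r hsr => by
      refine (hf.lipschitz_hessian _ _).trans (le_of_eq ?_)
      have e1 : (q + r • (p - q)).fst - (q + s • (p - q)).fst = (r - s) • (x₁ - x₂) := by
        change (x₂ + r • (x₁ - x₂)) - (x₂ + s • (x₁ - x₂)) = _
        rw [add_sub_add_left_eq_sub, sub_smul]
      have e2 : (q + r • (p - q)).snd - (q + s • (p - q)).snd = (r - s) • (y₁' - y₂) := by
        change (y₂ + r • (y₁' - y₂)) - (y₂ + s • (y₁' - y₂)) = _
        rw [add_sub_add_left_eq_sub, sub_smul (r) s (y₁' - y₂)]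
      rw [e1, e2, norm_smul, norm_smul, Real.norm_of_nonneg (sub_nonneg.2 hsr)]
      ring) h0.le h1
  -- The partial gradient vanishes at `q` and at the intermediate point, so the interpolation error
  -- is exactly `t • gradY f p`; cancelling `t` keeps the factor `1 - t`.
  rw [hpt, gradY_eq_zero hy, gradY_eq_zero hy₂, smul_zero, add_zero, sub_zero, norm_smul,
    Real.norm_of_nonneg h0.le] at hint
  have hpq : ‖p - q‖ ≤ a + b := norm_joint_le (p - q)
  have ha : 0 ≤ a := norm_nonneg _
  have hb : 0 ≤ b := norm_nonneg _
  have ht : 0 ≤ 1 - t := sub_nonneg.2 h1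
  have h2 : ‖gradY f p‖ ≤ (1 - t) * (Hf * (1 + ((Lf : ℝ) * τ) ^ 2)) * a ^ 2 := by
    refine le_of_mul_le_mul_left (hint.trans ?_) h0
    have h3 : (a + b) * ‖p - q‖ ≤ 2 * (1 + ((Lf : ℝ) * τ) ^ 2) * a ^ 2 := by
      have h4 : (a + b) * ‖p - q‖ ≤ (a + b) * (a + b) := by gcongr
      have h5 : b ^ 2 ≤ (Lf * τ * a) ^ 2 := pow_le_pow_left₀ hb hlen 2
      nlinarith [sq_nonneg (a - b)]
    have h6 := mul_le_mul_of_nonneg_left h3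
      (by positivity : 0 ≤ (Hf : ℝ) / 2 * (t * (1 - t)))
    linarith
  have := mul_le_mul_of_nonneg_left h2 hτ.le
  linarith

lemma LowerLevel.exists_upper_le (hf : LowerLevel Lf Hf τ f) (hF : UpperLevel MF LF F)
    {x : Vec m} {y : Vec n} (hy : y ∈ solSet f x) (x' : Vec m) :
    ∃ y' ∈ solSet f x', F (pair x y) ≤ F (pair x' y') + Mphi Lf MF τ * ‖x - x'‖ := by
  obtain ⟨y', hy', h⟩ := hf.exists_lipschitz hy x'
  refine ⟨y', hy', ?_⟩
  have h1 : |F (pair x y) - F (pair x' y')| ≤ MF * ‖pair x y - pair x' y'‖ :=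
    hF.lipschitz.norm_sub_le _ _
  have h2 : ‖pair x y - pair x' y'‖ ≤ ‖x - x'‖ + ‖y - y'‖ := norm_joint_le _
  have h3 : (MF : ℝ) * ‖pair x y - pair x' y'‖ ≤ MF * (‖x - x'‖ + Lf * τ * ‖x - x'‖) := by
    gcongr
    exact h2.trans (by gcongr)
  have := (abs_le.1 h1).2
  unfold Mphi
  linarith

lemma LowerLevel.bddAbove_upperValues (hf : LowerLevel Lf Hf τ f) (hF : UpperLevel MF LF F)
    (h : ∃ x, BddAbove (upperValues f F x)) (x : Vec m) : BddAbove (upperValues f F x) := by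
  obtain ⟨x', B, hB⟩ := h
  refine ⟨B + Mphi Lf MF τ * ‖x - x'‖, ?_⟩
  rintro _ ⟨y, hy, rfl⟩
  obtain ⟨y', hy', h⟩ := hf.exists_upper_le hF hy x'
  have : F (pair x' y') ≤ B := hB ⟨y', hy', rfl⟩
  simp only
  linarith

lemma LowerLevel.Mphi_nonneg (hf : LowerLevel Lf Hf τ f) : 0 ≤ Mphi Lf MF τ := by
  have := hf.tau_pos
  unfold Mphi
  positivity

lemma LS_nonneg : 0 ≤ LS Lf Hf τ := le_max_of_le_right (by positivity)

lemma rho_nonneg : 0 ≤ rho Lf Hf MF LF τ := by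
  have := LS_nonneg (Lf := Lf) (Hf := Hf) (τ := τ)
  unfold rho
  positivity

/-- The pessimistic hyper-objective is Lipschitz. -/
theorem LowerLevel.lipschitzWith_phiP (hf : LowerLevel Lf Hf τ f) (hF : UpperLevel MF LF F)
    (h : ∃ x, BddAbove (upperValues f F x)) :
    LipschitzWith (Mphi Lf MF τ).toNNReal (phiP f F) := by
  have key : ∀ x x', phiP f F x ≤ phiP f F x' + Mphi Lf MF τ * ‖x - x'‖ := by
    intro x x'
    refine csSup_le ((hf.sol_nonempty x).image _) ?_
    rintro _ ⟨y, hy, rfl⟩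
    obtain ⟨y', hy', h'⟩ := hf.exists_upper_le hF hy x'
    have : F (pair x' y') ≤ phiP f F x' :=
      le_csSup (hf.bddAbove_upperValues hF h x') ⟨y', hy', rfl⟩
    simp only
    linarith
  refine LipschitzWith.of_dist_le_mul fun x x' => ?_
  rw [Real.coe_toNNReal _ hf.Mphi_nonneg, Real.dist_eq, dist_eq_norm]
  refine abs_le.2 ⟨?_, ?_⟩
  · have := key x' x
    rw [norm_sub_rev] at this
    linarith
  · linarith [key x x']

/-- The pessimistic hyper-objective is weakly convex. -/
theorem LowerLevel.strongConvexOn_phiP (hf : LowerLevel Lf Hf τ f) (hF : UpperLevel MF LF F)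
    (h : ∃ x, BddAbove (upperValues f F x)) :
    StrongConvexOn Set.univ (-rho Lf Hf MF LF τ) (phiP f F) := by
  have hτ := hf.tau_pos
  refine ⟨convex_univ, fun x₁ _ x₂ _ t s h0 hs hts => ?_⟩
  obtain rfl : s = 1 - t := by linarith
  have h1 : t ≤ 1 := by linarith
  -- The extrapolation divides by `t`, so `t = 0` is treated apart.
  rcases h0.eq_or_lt with rfl | h0
  · simp
  have hx : t • x₁ + (1 - t) • x₂ = x₂ + t • (x₁ - x₂) := by
    rw [smul_sub, sub_smul, one_smul]; abel
  rw [hx]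
  refine csSup_le ((hf.sol_nonempty _).image _) ?_
  rintro _ ⟨y, hy, rfl⟩
  obtain ⟨y₁, hy₁, y₂, hy₂, y₁', hcomb, hlen, herr⟩ := hf.exists_interpolation x₁ x₂ h0 h1 hy
  have hv₁ : F (pair x₁ y₁) ≤ phiP f F x₁ :=
    le_csSup (hf.bddAbove_upperValues hF h x₁) ⟨y₁, hy₁, rfl⟩
  have hv₂ : F (pair x₂ y₂) ≤ phiP f F x₂ :=
    le_csSup (hf.bddAbove_upperValues hF h x₂) ⟨y₂, hy₂, rfl⟩
  have hsm := hF.smooth.le_convexCombination (pair x₁ y₁') (pair x₂ y₂) h0.le h1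
  have hpt : pair x₂ y₂ + t • (pair x₁ y₁' - pair x₂ y₂) = pair (x₂ + t • (x₁ - x₂)) y := by
    rw [hcomb]; rfl
  rw [hpt] at hsm
  have hlip : |F (pair x₁ y₁') - F (pair x₁ y₁)| ≤ MF * ‖pair x₁ y₁' - pair x₁ y₁‖ :=
    hF.lipschitz.norm_sub_le _ _
  have hn : ‖pair x₁ y₁' - pair x₁ y₁‖ ≤ ‖x₁ - x₁‖ + ‖y₁' - y₁‖ := norm_joint_le _
  rw [sub_self, norm_zero, zero_add] at hn
  have hn2 : ‖pair x₁ y₁' - pair x₂ y₂‖ ^ 2 = ‖x₁ - x₂‖ ^ 2 + ‖y₁' - y₂‖ ^ 2 :=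
    norm_sq_joint _
  rw [hn2] at hsm
  set a := ‖x₁ - x₂‖
  have ht : 0 ≤ 1 - t := sub_nonneg.2 h1
  have hb : ‖y₁' - y₂‖ ^ 2 ≤ (Lf * τ * a) ^ 2 := pow_le_pow_left₀ (norm_nonneg _) hlen 2
  -- The correction of `y₁'` must fit into half of `LS`, because weak convexity carries a factor `1
  -- / 2`. The coefficients `9` and `4` in `LS` leave room to spare.
  have hLS1 : 2 * (Hf * τ * (1 + ((Lf : ℝ) * τ) ^ 2)) ≤ LS Lf Hf τ := by
    refine le_trans ?_ (le_max_left _ _)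
    have : 0 ≤ (Hf : ℝ) * τ * ((Lf : ℝ) * τ) ^ 2 := by positivity
    nlinarith
  have hLS2 : ((Lf : ℝ) * τ) ^ 2 ≤ LS Lf Hf τ := by
    refine le_trans ?_ (le_max_right _ _)
    nlinarith [sq_nonneg ((Lf : ℝ) * τ)]
  have e1 : (MF : ℝ) * ‖pair x₁ y₁' - pair x₁ y₁‖ ≤ MF * ((1 - t) * (LS Lf Hf τ / 2) * a ^ 2) := by
    refine mul_le_mul_of_nonneg_left (hn.trans (herr.trans ?_)) MF.2
    gcongr
    linarith
  have e2 : (LF : ℝ) / 2 * (t * (1 - t)) * (a ^ 2 + ‖y₁' - y₂‖ ^ 2) ≤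
      LF / 2 * (t * (1 - t)) * ((1 + LS Lf Hf τ) * a ^ 2) := by
    refine mul_le_mul_of_nonneg_left ?_ (by positivity)
    nlinarith [mul_le_mul_of_nonneg_right hLS2 (sq_nonneg a)]
  have e3 := mul_le_mul_of_nonneg_left ((abs_le.1 hlip).2.trans e1) h0.le
  have e4 := mul_le_mul_of_nonneg_left hv₁ h0.le
  have e5 := mul_le_mul_of_nonneg_left hv₂ ht
  simp only [smul_eq_mul, rho]
  linarith

/-- This sign change transfers the pessimistic results to the optimistic objective. -/
lemma phiP_neg (f F : Joint m n → ℝ) : phiP f (-F) = -phiO f F := by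
  funext x
  have e : upperValues f (-F) x = -upperValues f F x := by
    simp only [upperValues, ← Set.image_neg_eq_neg, Set.image_image, Pi.neg_apply]
  rw [phiP, e, Real.sSup_neg]
  rfl

lemma UpperLevel.neg (hF : UpperLevel MF LF F) : UpperLevel MF LF (-F) := by
  refine ⟨hF.lipschitz.neg, hF.smooth.differentiable.neg, ?_⟩
  have e : ∇ (-F) = -∇ F := by
    funext x; simp only [gradient, fderiv_neg, map_neg, Pi.neg_apply]
  rw [e]
  exact hF.smooth.lipschitz_gradient.neg

lemma exists_bddAbove_neg (h : ∃ x, BddBelow (upperValues f F x)) :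
    ∃ x, BddAbove (upperValues f (-F) x) := by
  obtain ⟨x, B, hB⟩ := h
  refine ⟨x, -B, ?_⟩
  rintro _ ⟨y, hy, rfl⟩
  exact neg_le_neg (hB ⟨y, hy, rfl⟩)

theorem LowerLevel.lipschitzWith_phiO (hf : LowerLevel Lf Hf τ f) (hF : UpperLevel MF LF F)
    (h : ∃ x, BddBelow (upperValues f F x)) :
    LipschitzWith (Mphi Lf MF τ).toNNReal (phiO f F) := by
  have := hf.lipschitzWith_phiP hF.neg (exists_bddAbove_neg h)
  rw [phiP_neg] at this
  simpa using this.neg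

theorem LowerLevel.strongConvexOn_neg_phiO (hf : LowerLevel Lf Hf τ f)
    (hF : UpperLevel MF LF F) (h : ∃ x, BddBelow (upperValues f F x)) :
    StrongConvexOn Set.univ (-rho Lf Hf MF LF τ) (-phiO f F) := by
  rw [← phiP_neg]
  exact hf.strongConvexOn_phiP hF.neg (exists_bddAbove_neg h)

end HyperObjective

/-! ### The parameter choice in terms of the rate. -/

section Rates

variable {cη Cη Cε Cw Cr η ε w : ℝ} {m T : ℕ}

lemma rpow_neg_half (k : ℕ) : (k : ℝ) ^ (-(1 / 2) : ℝ) = (√(k : ℝ))⁻¹ := by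
  rw [Real.rpow_neg (Nat.cast_nonneg k), ← Real.sqrt_eq_rpow]

/-- The consequences of the parameter choice in terms of the rate `√m / √T`. -/
lemma IsParameterChoice.bounds (h : IsParameterChoice cη Cη Cε Cw Cr m T η ε w) (hm : 0 < m)
    (hT : 0 < T) (hcη : 0 < cη) :
    0 < η ∧ 0 ≤ Cη ∧ 0 ≤ Cε ∧ 1 / (η * T) ≤ √(m : ℝ) / √(T : ℝ) / cη ∧
      η * m ≤ Cη * (√(m : ℝ) / √(T : ℝ)) ∧ (m * w / ε) ^ 2 ≤ Cr ^ 2 * (√(m : ℝ) / √(T : ℝ)) ∧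
      ε ≤ Cε * (√(m : ℝ) / √(T : ℝ)) ∧ η ≤ Cη := by
  have hm1 : (1 : ℝ) ≤ m := by exact_mod_cast hm
  have hT1 : (1 : ℝ) ≤ T := by exact_mod_cast hT
  obtain ⟨h1, h2, h3, h4, h5, -, h7⟩ := h
  rw [rpow_neg_half, rpow_neg_half] at h1 h2
  rw [rpow_neg_half] at h4
  have hsm := Real.one_le_sqrt.2 hm1
  have hsT := Real.one_le_sqrt.2 hT1
  have hm2 : √(m : ℝ) * √(m : ℝ) = m := Real.mul_self_sqrt (Nat.cast_nonneg m)
  have hT2 : √(T : ℝ) * √(T : ℝ) = T := Real.mul_self_sqrt (Nat.cast_nonneg T)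
  -- Here the bound on `w / ε` enters: `m² * m^(-3/2) * T^(-1/2) = √m / √T`.
  have hbsq : (m * w / ε) ^ 2 ≤ Cr ^ 2 * (√(m : ℝ) / √(T : ℝ)) := by
    have hb0 : 0 ≤ m * w / ε := by positivity
    have hb : m * w / ε ≤ m * (Cr * ((m : ℝ) ^ (-(3 / 4) : ℝ) * (T : ℝ) ^ (-(1 / 4) : ℝ))) := by
      rw [mul_div_assoc]
      exact mul_le_mul_of_nonneg_left h7 (Nat.cast_nonneg m)
    refine (pow_le_pow_left₀ hb0 hb 2).trans (le_of_eq ?_)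
    have e1 : ((m : ℝ) ^ (-(3 / 4) : ℝ)) ^ 2 * (m : ℝ) ^ 2 = √(m : ℝ) := by
      rw [← Real.rpow_natCast, ← Real.rpow_natCast, ← Real.rpow_mul (Nat.cast_nonneg m),
        ← Real.rpow_add (by positivity), Real.sqrt_eq_rpow]
      norm_num
    have e2 : ((T : ℝ) ^ (-(1 / 4) : ℝ)) ^ 2 = (√(T : ℝ))⁻¹ := by
      rw [← Real.rpow_natCast, ← Real.rpow_mul (Nat.cast_nonneg T), ← rpow_neg_half]
      norm_num
    calc _ = Cr ^ 2 * ((((m : ℝ) ^ (-(3 / 4) : ℝ)) ^ 2 * (m : ℝ) ^ 2) *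
          ((T : ℝ) ^ (-(1 / 4) : ℝ)) ^ 2) := by ring
      _ = _ := by rw [e1, e2, div_eq_mul_inv]
  set a := √(m : ℝ)
  set b := √(T : ℝ)
  have ha0 : 0 < a := by linarith
  have hb0 : 0 < b := by linarith
  have hη : 0 < η := lt_of_lt_of_le (by positivity) h1
  -- The signs of `Cη` and `Cε` are not assumed; they follow from `η` and `ε` being positive.
  have hCη : 0 ≤ Cη := by
    by_contra! hneg
    have : Cη * (a⁻¹ * b⁻¹) < 0 := mul_neg_of_neg_of_pos hneg (by positivity)
    linarith
  have hCε : 0 ≤ Cε := by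
    by_contra! hneg
    have : Cε * b⁻¹ < 0 := mul_neg_of_neg_of_pos hneg (by positivity)
    linarith
  refine ⟨hη, hCη, hCε, ?_, ?_, hbsq, ?_, ?_⟩
  · rw [div_div, div_le_div_iff₀ (by positivity) (by positivity), ← hT2]
    have := mul_le_mul_of_nonneg_right h1 (by positivity : 0 ≤ a * b * b)
    have e : cη * (a⁻¹ * b⁻¹) * (a * b * b) = b * cη := by field_simp
    linarith
  · rw [← hm2]
    have := mul_le_mul_of_nonneg_right h2 (by positivity : 0 ≤ a * a)
    have e : Cη * (a⁻¹ * b⁻¹) * (a * a) = Cη * (a / b) := by field_simp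
    linarith
  · refine h4.trans (mul_le_mul_of_nonneg_left ?_ hCε)
    rw [div_eq_mul_inv]
    exact le_mul_of_one_le_left (by positivity) hsm
  · refine h2.trans (mul_le_of_le_one_right hCη ?_)
    exact mul_le_one₀ (inv_le_one_of_one_le₀ hsm) (by positivity) (inv_le_one_of_one_le₀ hsT)

lemma IsParameterChoice.sqrt_le (h : IsParameterChoice cη Cη Cε Cw Cr m T η ε w) {M : ℝ}
    (hM : 0 ≤ M) (hCε : 0 ≤ Cε) :
    2 * √(M * ε) ≤ 2 * √(M * Cε) * (T : ℝ) ^ (-(1 / 4) : ℝ) := by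
  have e : (T : ℝ) ^ (-(1 / 4) : ℝ) = √((T : ℝ) ^ (-(1 / 2) : ℝ)) := by
    rw [Real.sqrt_eq_rpow, ← Real.rpow_mul (Nat.cast_nonneg T)]
    norm_num
  rw [e, mul_assoc, ← Real.sqrt_mul (by positivity)]
  refine mul_le_mul_of_nonneg_left (Real.sqrt_le_sqrt ?_) zero_le_two
  rw [mul_assoc]
  exact mul_le_mul_of_nonneg_left h.radius_upper hM

end Rates

/-! ### Convergence bounds before inserting the parameters. -/

section Convergence

variable {m T : ℕ} {M : ℝ≥0} {ρ η ε w : ℝ} {φ A : Vec m → ℝ} {Ω : Type*} [MeasurableSpace Ω]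
  {P : Measure Ω} [IsProbabilityMeasure P] {u : Fin T → Ω → Vec m} {R : Ω → Fin T}

/-- Expected squared norm of the gradient of the smoothing at the output, for Lipschitz weakly
concave objectives. -/
theorem lintegral_smoothingGradient_output_le (hm : 0 < m) (hφ : LipschitzWith M φ)
    (hc : StrongConvexOn Set.univ (-ρ) (-φ)) (hρ : 0 ≤ ρ) (hε : 0 < ε) (hη : 0 < η)
    (hA : IsSubroutine φ w A) (hbdd : BddBelow (Set.range φ)) (x₀ : Vec m)
    (hS : IsSampling P u R) :
    ∫⁻ ω, ENNReal.ofReal (‖smoothingGradient φ ε (output A η ε x₀ u R ω)‖ ^ 2) ∂P ≤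
      ENNReal.ofReal (2 * (φ x₀ - (⨅ x, φ x) + M * ε) * (1 / (η * T)) + (m * w / ε) ^ 2 +
        ρ * (72 * (η * m) * (M : ℝ) ^ 2 + 2 * (η * (m * w / ε) ^ 2))) := by
  set b := m * w / ε with hb
  have hv : ∀ x, (⨅ x, φ x) ≤ smoothing φ ε x := by
    intro x
    have h := integral_mono (integrable_const (⨅ x, φ x)) (integrable_add_smul hφ ε x)
      fun b => ciInf_le hbdd (x + ε • b)
    simpa [smoothing] using h
  have h := hS.lintegral_output_le (η := η) (ε := ε) (x₀ := x₀) hm hA.measurable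
    (V := smoothing φ ε) (D := fun x => ‖smoothingGradient φ ε x‖ ^ 2)
    (continuous_smoothing hφ ε).measurable
    ((measurable_smoothingGradient φ ε).norm.pow_const 2) (fun x => sq_nonneg _)
    -- Young's inequality spends half of `η ‖g‖²` on the bias term `η b ‖g‖`, which leaves `η / 2`
    -- and adds `η b² / 2`.
    (a := η / 2) (c := η * b ^ 2 / 2 + ρ * η ^ 2 / 2 * (72 * m * (M : ℝ) ^ 2 + 2 * b ^ 2))
    (v := ⨅ x, φ x) (by positivity) (by positivity) hv
    (fun x => by
      have hmodel : ∀ y, smoothing φ ε y ≤ smoothing φ ε x +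
          inner ℝ (smoothingGradient φ ε x) (y - x) + ρ / 2 * ‖y - x‖ ^ 2 := by
        intro y
        have := smoothing_add_inner_le hφ.neg hc hε.ne' x y
        rw [smoothing_neg, smoothingGradient_neg, smoothing_neg, inner_neg_left] at this
        linarith
      obtain ⟨h1, h2⟩ := integral_step_le hm hφ hε hA.measurable hA.accurate
        (continuous_smoothing hφ ε) hρ hη.le x (smoothingGradient φ ε x) hmodel
      refine ⟨h1, h2.trans ?_⟩
      rw [← hb, real_inner_self_eq_norm_sq]
      nlinarith [mul_nonneg hη.le (sq_nonneg (‖smoothingGradient φ ε x‖ - b))])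
  refine h.trans (ENNReal.ofReal_le_ofReal ?_)
  have hT : 0 < T := by
    obtain ⟨ω⟩ : Nonempty Ω := nonempty_of_isProbabilityMeasure P
    exact (R ω).pos
  have hT' : (0 : ℝ) < T := by exact_mod_cast hT
  have h1 := (abs_le.1 (abs_smoothing_sub_le hφ hε.le x₀)).2
  have h2 : (smoothing φ ε x₀ - ⨅ x, φ x) / (η / 2 * T) ≤
      2 * (φ x₀ - (⨅ x, φ x) + M * ε) * (1 / (η * T)) := by
    have e : (smoothing φ ε x₀ - ⨅ x, φ x) / (η / 2 * T) =
        2 * (smoothing φ ε x₀ - ⨅ x, φ x) * (1 / (η * T)) := by field_simp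
    rw [e]
    gcongr
    linarith
  have h3 : (η * b ^ 2 / 2 + ρ * η ^ 2 / 2 * (72 * m * (M : ℝ) ^ 2 + 2 * b ^ 2)) / (η / 2) =
      b ^ 2 + ρ * (72 * (η * m) * (M : ℝ) ^ 2 + 2 * (η * b ^ 2)) := by field_simp
  rw [h3]
  linarith

/-- Expected squared distance to the proximal point at the output, for Lipschitz weakly convex
objectives. -/
theorem lintegral_moreau_output_le (hm : 0 < m) (hφ : LipschitzWith M φ)
    (hc : StrongConvexOn Set.univ (-ρ) φ) {γ : ℝ} (hγ : 0 < γ)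
    (hγρ : γ * (ρ + 1) < 1) (hε : 0 < ε) (hη : 0 < η)
    (hA : IsSubroutine φ w A) (hbdd : BddBelow (Set.range (moreau γ φ))) (x₀ : Vec m)
    (hS : IsSampling P u R) :
    ∫⁻ ω, ‖∇ (moreau γ φ) (output A η ε x₀ u R ω)‖ₑ ^ 2 ∂P ≤
      ENNReal.ofReal ((γ⁻¹) ^ 2 * (4 * γ * (moreau γ φ x₀ - ⨅ x, moreau γ φ x) * (1 / (η * T)) +
        8 * M * ε + 4 * (m * w / ε) ^ 2 + 144 * (η * m) * (M : ℝ) ^ 2 +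
          4 * (η * (m * w / ε) ^ 2))) := by
  set b := m * w / ε with hb
  obtain ⟨p, hpc, hpeq, hple, hpg⟩ := exists_prox hφ hc hγ (by nlinarith)
  have hcont : Continuous (moreau γ φ) :=
    continuous_iff_continuousAt.2 fun x => (hpg x).hasFDerivAt.continuousAt
  have hgap : 1 < γ⁻¹ - ρ := by
    have := mul_lt_mul_of_pos_left hγρ (inv_pos.2 hγ)
    rw [← mul_assoc, inv_mul_cancel₀ hγ.ne'] at this
    linarith
  have hb0 : 0 ≤ b := (norm_nonneg _).trans
    (norm_integral_estimator_sub_le hm hφ hε hA.measurable hA.accurate x₀)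
  have h := hS.lintegral_output_le (η := η) (ε := ε) (x₀ := x₀) hm hA.measurable
    (V := moreau γ φ) (D := fun x => ‖x - p x‖ ^ 2) hcont.measurable
    (by have := hpc.measurable; fun_prop) (fun x => sq_nonneg _)
    -- Of the `D² / 2` in `h5` below, the bias `b * D` consumes `D² / 4` and leaves a quarter.
    (a := η * γ⁻¹ / 4)
    (c := η * γ⁻¹ * (2 * M * ε + b ^ 2) + γ⁻¹ * η ^ 2 / 2 * (72 * m * (M : ℝ) ^ 2 + 2 * b ^ 2))
    (v := ⨅ x, moreau γ φ x) (by positivity) (by positivity) (fun x => ciInf_le hbdd x)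
    (fun x => by
      have hmodel : ∀ y, moreau γ φ y ≤ moreau γ φ x + inner ℝ (γ⁻¹ • (x - p x)) (y - x) +
          γ⁻¹ / 2 * ‖y - x‖ ^ 2 := by
        intro y
        have h1 := hple y (p x)
        have e : y - p x = (x - p x) + (y - x) := by abel
        have hhalf : 1 / (2 * γ) = γ⁻¹ / 2 := by field_simp
        rw [e, norm_add_sq_real, hhalf] at h1
        rw [hpeq x, real_inner_smul_left, hhalf]
        linarith
      obtain ⟨h1, h2⟩ := integral_step_le hm hφ hε hA.measurable hA.accurate
        hcont (inv_pos.2 hγ).le hη.le x (γ⁻¹ • (x - p x)) hmodel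
      refine ⟨h1, h2.trans ?_⟩
      have h3 := add_inner_smoothingGradient_le hφ hc hε x (p x)
      have h4 := hple x x
      rw [hpeq x, sub_self, norm_zero] at h4
      have hhalf : 1 / (2 * γ) = γ⁻¹ / 2 := by field_simp
      rw [hhalf] at h4
      rw [← neg_sub x (p x), inner_neg_right, norm_neg, real_inner_comm] at h3
      rw [← hb, real_inner_smul_left, norm_smul, Real.norm_of_nonneg (inv_pos.2 hγ).le]
      set D := ‖x - p x‖
      set I : ℝ := inner ℝ (x - p x) (smoothingGradient φ ε x)
      -- The approximate subgradient inequality towards `p x` and the comparison of `p x` with `x`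
      -- in the envelope give `I ≥ (γ⁻¹ - ρ) / 2 * D² - 2Mε`, and `γ⁻¹ - ρ > 1` by `hgap`.
      have h5 : D ^ 2 / 2 - 2 * M * ε ≤ I := by
        nlinarith [sq_nonneg D]
      have h6 : b * D ≤ D ^ 2 / 4 + b ^ 2 := by nlinarith [sq_nonneg (D / 2 - b)]
      have hpos : 0 ≤ η * γ⁻¹ := by positivity
      have h7 := mul_le_mul_of_nonneg_left h5 hpos
      have h8 := mul_le_mul_of_nonneg_left h6 hpos
      linarith)
  have hnorm : ∀ x, ‖∇ (moreau γ φ) x‖ₑ ^ 2 =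
      ENNReal.ofReal ((γ⁻¹) ^ 2) * ENNReal.ofReal (‖x - p x‖ ^ 2) := by
    intro x
    rw [(hpg x).gradient, ← ofReal_norm, ← ENNReal.ofReal_pow (norm_nonneg _),
      ← ENNReal.ofReal_mul (sq_nonneg _), norm_smul, mul_pow,
      Real.norm_of_nonneg (inv_pos.2 hγ).le]
  simp only [hnorm]
  rw [lintegral_const_mul' _ _ ENNReal.ofReal_ne_top, ENNReal.ofReal_mul (sq_nonneg _)]
  gcongr
  refine h.trans (ENNReal.ofReal_le_ofReal (le_of_eq ?_))
  have hT : 0 < T := by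
    obtain ⟨ω⟩ : Nonempty Ω := nonempty_of_isProbabilityMeasure P
    exact (R ω).pos
  have hT' : (0 : ℝ) < T := by exact_mod_cast hT
  field_simp
  ring

/-- Expected squared distance of `0` to the Clarke subdifferentials near the output. -/
theorem lintegral_infEDist_output_le (hm : 0 < m) (hφ : LipschitzWith M φ)
    (hc : StrongConvexOn Set.univ (-ρ) (-φ)) (hρ : 0 ≤ ρ) (hε : 0 < ε) (hη : 0 < η)
    (hA : IsSubroutine φ w A) (hbdd : BddBelow (Set.range φ)) (x₀ : Vec m)
    (hS : IsSampling P u R) :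
    ∫⁻ ω, (Metric.infEDist 0 (clarkeBall φ (2 * √(M * ε)) (output A η ε x₀ u R ω))) ^ 2 ∂P ≤
      ENNReal.ofReal (2 * (2 * (φ x₀ - (⨅ x, φ x) + M * ε) * (1 / (η * T)) + (m * w / ε) ^ 2 +
        ρ * (72 * (η * m) * (M : ℝ) ^ 2 + 2 * (η * (m * w / ε) ^ 2))) +
          8 * (ρ + 1) ^ 2 * (M * ε)) := by
  have hpt : ∀ x, (Metric.infEDist 0 (clarkeBall φ (2 * √(M * ε)) x)) ^ 2 ≤
      2 * ENNReal.ofReal (‖smoothingGradient φ ε x‖ ^ 2) +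
        ENNReal.ofReal (8 * (ρ + 1) ^ 2 * (M * ε)) := by
    intro x
    obtain ⟨s, hs, hle⟩ := exists_mem_clarkeBall hφ hc hρ hε x
    calc (Metric.infEDist 0 (clarkeBall φ (2 * √(M * ε)) x)) ^ 2
        ≤ (edist 0 s) ^ 2 := by
          gcongr
          exact Metric.infEDist_le_edist_of_mem hs
      _ = ENNReal.ofReal (‖s‖ ^ 2) := by
          rw [edist_comm, edist_zero_right, ← ofReal_norm, ENNReal.ofReal_pow (norm_nonneg _)]
      _ ≤ ENNReal.ofReal (2 * ‖smoothingGradient φ ε x‖ ^ 2 + 8 * (ρ + 1) ^ 2 * (M * ε)) :=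
          ENNReal.ofReal_le_ofReal hle
      _ = _ := by
          rw [ENNReal.ofReal_add (by positivity) (by positivity), ENNReal.ofReal_mul zero_le_two]
          simp
  have hmain := lintegral_smoothingGradient_output_le hm hφ hc hρ hε hη hA hbdd x₀ hS
  set X := 2 * (φ x₀ - (⨅ x, φ x) + M * ε) * (1 / (η * T)) + (m * w / ε) ^ 2 +
    ρ * (72 * (η * m) * (M : ℝ) ^ 2 + 2 * (η * (m * w / ε) ^ 2)) with hX
  have hX0 : 0 ≤ X := by
    have : 0 ≤ φ x₀ - ⨅ x, φ x := sub_nonneg.2 (ciInf_le hbdd x₀)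
    positivity
  refine (lintegral_mono fun ω => hpt _).trans ?_
  rw [lintegral_add_right _ measurable_const, lintegral_const_mul' _ _ (by norm_num),
    ENNReal.ofReal_add (by positivity) (by positivity), ENNReal.ofReal_mul zero_le_two]
  simp only [lintegral_const, measure_univ, mul_one, ENNReal.ofReal_ofNat]
  gcongr

end Convergence

end Bilevel

/-! ### The two rates. -/

theorem theorem4p1 (Lf Hf MF LF : ℝ≥0) (τ cη Cη Cε Cw Cr : ℝ) (hcη : 0 < cη) :
    -- optimistic case
    (∃ K C : ℝ, ∀ (m n T : ℕ), 0 < m → 0 < T →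
      ∀ f F : Bilevel.Joint m n → ℝ,
      Bilevel.LowerLevel Lf Hf τ f → Bilevel.UpperLevel MF LF F →
      (∃ x, BddBelow (Bilevel.upperValues f F x)) →
      BddBelow (Set.range (Bilevel.phiO f F)) →
      ∀ η ε w : ℝ, Bilevel.IsParameterChoice cη Cη Cε Cw Cr m T η ε w →
      ∃ δ : ℝ, 0 ≤ δ ∧ δ ≤ K * (T : ℝ) ^ (-(1 / 4) : ℝ) ∧
      ∀ A : Bilevel.Vec m → ℝ, Bilevel.IsSubroutine (Bilevel.phiO f F) w A →
      ∀ (x₀ : Bilevel.Vec m) (Ω : Type*) [MeasurableSpace Ω] (P : Measure Ω)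
        [IsProbabilityMeasure P] (u : Fin T → Ω → Bilevel.Vec m) (R : Ω → Fin T),
      Bilevel.IsSampling P u R →
      ∫⁻ ω, (Metric.infEDist 0
          (Bilevel.clarkeBall (Bilevel.phiO f F) δ (Bilevel.output A η ε x₀ u R ω))) ^ 2 ∂P
        ≤ ENNReal.ofReal (C * (√(m : ℝ) *
          ((Bilevel.phiO f F x₀ - ⨅ x, Bilevel.phiO f F x) + 2 * Bilevel.Mphi Lf MF τ * ε + 1)
            / √(T : ℝ)))) ∧
    -- pessimistic case
    (∀ γ : ℝ, 0 < γ → γ < 1 / (Bilevel.rho Lf Hf MF LF τ + 1) →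
      ∃ C : ℝ, ∀ (m n T : ℕ), 0 < m → 0 < T →
      ∀ f F : Bilevel.Joint m n → ℝ,
      Bilevel.LowerLevel Lf Hf τ f → Bilevel.UpperLevel MF LF F →
      (∃ x, BddAbove (Bilevel.upperValues f F x)) →
      Differentiable ℝ (Bilevel.moreau γ (Bilevel.phiP f F)) ∧
      (BddBelow (Set.range (Bilevel.moreau γ (Bilevel.phiP f F))) →
      ∀ η ε w : ℝ, Bilevel.IsParameterChoice cη Cη Cε Cw Cr m T η ε w →
      ∀ A : Bilevel.Vec m → ℝ, Bilevel.IsSubroutine (Bilevel.phiP f F) w A →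
      ∀ (x₀ : Bilevel.Vec m) (Ω : Type*) [MeasurableSpace Ω] (P : Measure Ω)
        [IsProbabilityMeasure P] (u : Fin T → Ω → Bilevel.Vec m) (R : Ω → Fin T),
      Bilevel.IsSampling P u R →
      ∫⁻ ω, ‖∇ (Bilevel.moreau γ (Bilevel.phiP f F))
          (Bilevel.output A η ε x₀ u R ω)‖ₑ ^ 2 ∂P
        ≤ ENNReal.ofReal (C * (√(m : ℝ) *
          ((Bilevel.moreau γ (Bilevel.phiP f F) x₀
            - ⨅ x, Bilevel.moreau γ (Bilevel.phiP f F) x) + 1)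
            / √(T : ℝ))))) := by
  have hρ : 0 ≤ Bilevel.rho Lf Hf MF LF τ := Bilevel.rho_nonneg
  set ρ := Bilevel.rho Lf Hf MF LF τ
  set μ := Bilevel.Mphi Lf MF τ
  refine ⟨⟨2 * √(μ * Cε), 4 / cη + 2 * Cr ^ 2 + 144 * ρ * μ ^ 2 * Cη + 4 * ρ * Cη * Cr ^ 2 +
    8 * (ρ + 1) ^ 2 * μ * Cε, ?_⟩, ?_⟩
  · intro m n T hm hT f F hf hF hb hbdd η ε w hpar
    obtain ⟨hη, hCη, hCε, b1, b2, b3, b4, b5⟩ := hpar.bounds hm hT hcη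
    have hε := hpar.radius_pos
    have hμ : 0 ≤ μ := hf.Mphi_nonneg
    -- The radius depends only on `μ` and `ε`, hence it is fixed before `A`, `x₀` and the sampling.
    refine ⟨2 * √(μ * ε), by positivity, hpar.sqrt_le hμ hCε, ?_⟩
    intro A hA x₀ Ω _ P _ u R hS
    have h := Bilevel.lintegral_infEDist_output_le (ρ := ρ) (η := η) hm (hf.lipschitzWith_phiO hF hb)
      (hf.strongConvexOn_neg_phiO hF hb) hρ hε hη hA hbdd x₀ hS
    rw [Real.coe_toNNReal _ hμ] at h
    refine h.trans (ENNReal.ofReal_le_ofReal ?_)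
    rw [mul_div_right_comm (√(m : ℝ))]
    set q := √(m : ℝ) / √(T : ℝ)
    have hq : 0 ≤ q := by positivity
    set Δ := Bilevel.phiO f F x₀ - ⨅ x, Bilevel.phiO f F x
    have hΔ : 0 ≤ Δ := sub_nonneg.2 (ciInf_le hbdd x₀)
    set b := (m * w / ε) ^ 2
    have hb0 : 0 ≤ b := sq_nonneg _
    have t1 : 4 * (Δ + μ * ε) * (1 / (η * T)) ≤ 4 * (Δ + 2 * μ * ε) * (q / cη) := by
      have : 0 ≤ μ * ε := by positivity
      gcongr
      linarith
    have t2 : η * b ≤ Cη * (Cr ^ 2 * q) := by gcongr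
    have t3 : 144 * ρ * μ ^ 2 * (η * m) ≤ 144 * ρ * μ ^ 2 * (Cη * q) := by gcongr
    have t4 : 4 * ρ * (η * b) ≤ 4 * ρ * (Cη * (Cr ^ 2 * q)) := by gcongr
    have t5 : 8 * (ρ + 1) ^ 2 * (μ * ε) ≤ 8 * (ρ + 1) ^ 2 * (μ * (Cε * q)) := by gcongr
    -- The term `4 / cη` is needed only against `q * (Δ + 2με)`, the other constants only against
    -- `q`. The remaining products in `C * q * (Δ + 2με + 1)` are slack, nonnegative by `t6` and
    -- `t7`.
    have t6 : 0 ≤ (2 * Cr ^ 2 + 144 * ρ * μ ^ 2 * Cη + 4 * ρ * Cη * Cr ^ 2 +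
        8 * (ρ + 1) ^ 2 * μ * Cε) * (q * (Δ + 2 * μ * ε)) := by positivity
    have t7 : 0 ≤ 4 / cη * q := by positivity
    have e : 4 * (Δ + 2 * μ * ε) * (q / cη) = 4 / cη * q * (Δ + 2 * μ * ε) := by ring
    rw [e] at t1
    linarith
  · intro γ hγ hγ'
    have hγρ : γ * (ρ + 1) < 1 := by
      rwa [lt_div_iff₀ (by positivity)] at hγ'
    refine ⟨(γ⁻¹) ^ 2 * (4 * γ / cη + 8 * μ * Cε + 4 * Cr ^ 2 + 144 * μ ^ 2 * Cη +
      4 * Cη * Cr ^ 2), ?_⟩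
    intro m n T hm hT f F hf hF hb
    have hlip := hf.lipschitzWith_phiP hF hb
    have hconv := hf.strongConvexOn_phiP hF hb
    have hμ : 0 ≤ μ := hf.Mphi_nonneg
    refine ⟨?_, ?_⟩
    · obtain ⟨p, -, -, -, hpg⟩ := Bilevel.exists_prox hlip hconv hγ (by nlinarith)
      exact fun x => (hpg x).hasFDerivAt.differentiableAt
    intro hbdd η ε w hpar A hA x₀ Ω _ P _ u R hS
    obtain ⟨hη, hCη, hCε, b1, b2, b3, b4, b5⟩ := hpar.bounds hm hT hcη
    have hε := hpar.radius_pos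
    have h := Bilevel.lintegral_moreau_output_le (ρ := ρ) (η := η) hm hlip hconv hγ hγρ hε hη hA hbdd x₀ hS
    rw [Real.coe_toNNReal _ hμ] at h
    refine h.trans (ENNReal.ofReal_le_ofReal ?_)
    rw [mul_div_right_comm (√(m : ℝ)), mul_assoc ((γ⁻¹) ^ 2) (4 * γ / cη + _ + _ + _ + _)]
    refine mul_le_mul_of_nonneg_left ?_ (sq_nonneg _)
    set q := √(m : ℝ) / √(T : ℝ)
    have hq : 0 ≤ q := by positivity
    set Δ := Bilevel.moreau γ (Bilevel.phiP f F) x₀ - ⨅ x, Bilevel.moreau γ (Bilevel.phiP f F) x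
    have hΔ : 0 ≤ Δ := sub_nonneg.2 (ciInf_le hbdd x₀)
    set b := (m * w / ε) ^ 2
    have hb0 : 0 ≤ b := sq_nonneg _
    have t1 : 4 * γ * Δ * (1 / (η * T)) ≤ 4 * γ * Δ * (q / cη) := by gcongr
    have t2 : η * b ≤ Cη * (Cr ^ 2 * q) := by gcongr
    have t3 : 144 * μ ^ 2 * (η * m) ≤ 144 * μ ^ 2 * (Cη * q) := by gcongr
    have t5 : 8 * μ * ε ≤ 8 * μ * (Cε * q) := by gcongr
    have t6 : 0 ≤ (8 * μ * Cε + 4 * Cr ^ 2 + 144 * μ ^ 2 * Cη + 4 * Cη * Cr ^ 2) *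
        (q * Δ) := by positivity
    have t7 : 0 ≤ 4 * γ / cη * q := by positivity
    have e : 4 * γ * Δ * (q / cη) = 4 * γ / cη * q * Δ := by ring
    rw [e] at t1
    linarith
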